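/- **Setting.** Let $d\ge 1$, let $\Omega\subset\mathbb R^d$ be open and bounded, and let $\Phi:\mathbb R^d\to\mathbb R$ be continuous and radial with $|\Phi|\le 1$, $\operatorname{supp}\Phi\subset\{\|x\|_2\le 1\}$ and $$c_\Phi(1+\|\omega\|_2^2)^{-\tau}\le\widehat\Phi(\omega)\le C_\Phi(1+\|\omega\|_2^2)^{-\tau}\quad(\omega\in\mathbb R^d),\qquad \widehat\Phi(\omega)=(2\pi)^{-d/2}\int\Phi(x)e^{-i\langle x,\omega\rangle}dx,$$ for some $\tau>d/2$ and $c_\Phi,C_\Phi>0$. Put $\Phi_\delta(x)=\delta^{-d}\Phi(x/\delta)$. For $\ell=1,2,\dots$ let $X_\ell=\{x^{(\ell)}_1,\dots,x^{(\ell)}_{N(\ell)}\}\subset\Omega$, $N(\ell)\ge1$, have fill distance $h_\ell=\sup_{x\in\Omega}\min_j\|x-x^{(\ell)}_j\|_2$ and separation distance $q_\ell=\frac12\min_{j\ne k}\|x_j^{(\ell)}-x_k^{(\ell)}\|_2$, and suppose that there are $\mu\in(0,1)$ with $\mu^{-d}>2$, $c_h\in(0,1]$ and $c_q$ such that for all $\ell\ge1$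 $$c_h\mu h_\ell\le h_{\ell+1}\le\mu h_\ell,\qquad q_\ell\le h_\ell\le c_q q_\ell .$$ Let $\nu>0$ and $\delta_\ell=\nu h_\ell$. **Constants.** Let $M_d=12\big(\tfrac{\pi\Gamma(d/2+1)^2}{9}\big)^{1/(d+1)}$, $C_d=\tfrac1{2\Gamma(d/2+1)}\big(\tfrac{M_d}{2^{3/2}}\big)^d$, $K=(C_dc_\Phi)^{-1}(1+4M_d^2\nu^2c_q^2)^\tau$, $z=4^dK$, $R=\sqrt d\,\max\{c_q\nu,4\}$, $$\theta=-\tfrac1{2R}\log\tfrac{\sqrt z-1}{\sqrt z+1},\quad C=2Ke^{2\theta\sqrt d}e^{c_q\nu\theta}(1+\nu c_q)^d\max\{1,\nu^{-d}\},\quad C_\Sigma=\sum_{m=0}^\infty(m+2)^de^{-\theta m}.$$ **Linear systems.** Let $B_{k\ell}=\big(\Phi_{\delta_\ell}(x^{(k)}_i-x^{(\ell)}_n)\big)_{i,n}$, $A_\ell=B_{\ell\ell}$ and $\mathfrak X_{k\ell}=B_{k\ell}A_\ell^{-1}$. Let $D_L=\operatorname{diag}(A_1,\dots,A_L)$ and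 let $T'_L$ be the lower block triangular matrix with identity diagonal blocks and blocks $\mathfrak X_{k\ell}$ for $k>\ell$. For $T>0$ let $\tilde{\mathfrak X}_{k\ell}(T)$ arise from $\mathfrak X_{k\ell}$ by replacing by $0$ all entries $(i,n)$ with $\|x_i^{(k)}-x_n^{(\ell)}\|_2\ge T\max\{q_k,q_\ell\}$, and let $\tilde M(T)$ be the strictly lower block triangular matrix with blocks $-\tilde{\mathfrak X}_{k\ell}(T)$, $k>\ell$ (the thresholded version of $M=\mathrm{id}-T'_L$). For a function $f$ on $\Omega$ let $\mathbf f=(f|_{X_1},\dots,f|_{X_L})$, and let $\alpha,\tilde\alpha$ solve $$D_L\alpha=\beta,\quad T'_L\beta=\mathbf f,\qquad\qquad D_L\tilde\alpha=\tilde\beta,\quad(\mathrm{id}-\tilde M(T))\tilde\beta=\mathbf f .$$ The multiscale approximant and its perturbation are $$f_L=\sum_{\ell=1}^L\sum_{n=1}^{N(\ell)}\alpha^{(\ell)}_n\Phi_{\delta_\ell}(\cdot-x_n^{(\ell)}),\qquad \tilde f_L=\sum_{\ell=1}^L\sum_{n=1}^{N(\ell)}\tilde\alpha^{(\ell)}_n\Phi_{\delta_\ell}(\cdot-x_n^{(\ell)}).$$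 **Theorem 4.9.** Let $f:\Omega\to\mathbb R$ be continuous (for instance the continuous representative of an element of $H^\tau(\Omega)$ when $\Omega$ is a Lipschitz domain), let $L\in\mathbb N$ satisfy $$2CC_\Sigma L\,e^{\theta/L}c_q^{\frac d{2L}-\frac d2}\le(c_h\mu)^{-dL/2},$$ and let $T>0$ satisfy $T^d\le e^{\frac\theta2T}$ and $T\ge-\frac{4dL^2}\theta\ln(c_h\mu)$. Then $$\|f_L-\tilde f_L\|_{L^2(\Omega)}\le c_f\sqrt L\,e^{-\frac\theta4T}\|f\|_{L_\infty(\Omega)},\qquad c_f^2=\frac{N(1)(1+2\nu c_q)^d\pi^{d/2}q_1^d(1+4M_d^2\nu^2c_q^2)^{2\tau}}{\nu^d(C_dc_\Phi)^2\,\Gamma(\frac d2+1)} .$$ -/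

import Mathlib

open scoped Matrix ENNReal FourierTransform

noncomputable section

namespace Multiscale

/-- The Euclidean space `ℝ^d`. -/
abbrev E (d : ℕ) : Type := EuclideanSpace ℝ (Fin d)

/-- The Fourier transform `(2π)^(-d/2) ∫ Φ(x) exp(-i ⟪x, ω⟫) dx`, written through Mathlib's transform
`𝓕 g ξ = ∫ exp(-2πi ⟪x, ξ⟫) g(x) dx`. -/
def unitaryFourier {d : ℕ} (Φ : E d → ℝ) (ω : E d) : ℂ :=
  (((2 * Real.pi) ^ (-(d : ℝ) / 2) : ℝ) : ℂ) *
    𝓕 (fun x : E d => (Φ x : ℂ)) ((2 * Real.pi)⁻¹ • ω)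

/-- The kernel assumption: `Φ` is continuous and radial, supported in the closed unit ball,
normalised by `|Φ| ≤ 1`, and its Fourier transform (real-valued, because `Φ` is real and even)
lies between `cΦ (1+‖ω‖²)^(-τ)` and `CΦ (1+‖ω‖²)^(-τ)`, with `τ > d/2`. -/
structure IsKernel {d : ℕ} (Φ : E d → ℝ) (τ cΦ CΦ : ℝ) : Prop where
  tau_gt : (d : ℝ) / 2 < τ
  c_pos : 0 < cΦ
  C_pos : 0 < CΦ
  cont : Continuous Φ
  radial : ∃ φ : ℝ → ℝ, ∀ x, Φ x = φ ‖x‖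
  support_subset : Function.support Φ ⊆ Metric.closedBall 0 1
  abs_le_one : ∀ x, |Φ x| ≤ 1
  lower : ∀ ω, cΦ * (1 + ‖ω‖ ^ 2) ^ (-τ) ≤ (unitaryFourier Φ ω).re
  upper : ∀ ω, (unitaryFourier Φ ω).re ≤ CΦ * (1 + ‖ω‖ ^ 2) ^ (-τ)

/-- The scaled kernel `Φ_δ(x) = δ^(-d) Φ(x/δ)`. -/
def scaledKernel {d : ℕ} (Φ : E d → ℝ) (δ : ℝ) (x : E d) : ℝ :=
  (δ ^ d)⁻¹ * Φ (δ⁻¹ • x)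

/-- The fill distance `sup_{y ∈ Ω} min_j ‖y - x_j‖`. -/
def fillDist {d n : ℕ} (Ω : Set (E d)) (x : Fin n → E d) : ℝ :=
  ⨆ y : Ω, ⨅ j : Fin n, ‖(y : E d) - x j‖

/-- The separation distance `(1/2) min_{j ≠ k} ‖x_j - x_k‖`. -/
def sepDist {d n : ℕ} (x : Fin n → E d) : ℝ :=
  (1 / 2) * sInf {r : ℝ | ∃ j k : Fin n, j ≠ k ∧ r = ‖x j - x k‖}

/-- The assumption on the node sets `X_1, X_2, …`, where `X_ℓ = {x ℓ i : i < N ℓ} ⊆ Ω`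
(the levels start at `ℓ = 1`; the value at `ℓ = 0` plays no role). -/
structure IsNodeSequence {d : ℕ} (Ω : Set (E d)) (N : ℕ → ℕ) (x : ∀ ℓ, Fin (N ℓ) → E d)
    (μ ch cq : ℝ) : Prop where
  mem : ∀ ℓ, 1 ≤ ℓ → ∀ i, x ℓ i ∈ Ω
  nonempty : ∀ ℓ, 1 ≤ ℓ → 1 ≤ N ℓ
  mu_pos : 0 < μ
  mu_lt_one : μ < 1
  ch_pos : 0 < ch
  ch_le_one : ch ≤ 1
  fill_lower : ∀ ℓ, 1 ≤ ℓ → ch * μ * fillDist Ω (x ℓ) ≤ fillDist Ω (x (ℓ + 1))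
  fill_upper : ∀ ℓ, 1 ≤ ℓ → fillDist Ω (x (ℓ + 1)) ≤ μ * fillDist Ω (x ℓ)
  sep_le_fill : ∀ ℓ, 1 ≤ ℓ → sepDist (x ℓ) ≤ fillDist Ω (x ℓ)
  fill_le_sep : ∀ ℓ, 1 ≤ ℓ → fillDist Ω (x ℓ) ≤ cq * sepDist (x ℓ)
  two_lt : 2 < (μ ^ d)⁻¹

/-! ### The explicit constants -/

/-- `M_d = 12 (π Γ(d/2+1)² / 9)^(1/(d+1))`. -/
def constMd (d : ℕ) : ℝ :=
  12 * (Real.pi * Real.Gamma ((d : ℝ) / 2 + 1) ^ 2 / 9) ^ (1 / ((d : ℝ) + 1))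

/-- `C_d = (1 / (2 Γ(d/2+1))) (M_d / 2^(3/2))^d`. -/
def constCd (d : ℕ) : ℝ :=
  1 / (2 * Real.Gamma ((d : ℝ) / 2 + 1)) * (constMd d / (2 : ℝ) ^ ((3 : ℝ) / 2)) ^ d

/-- `K = (C_d cΦ)⁻¹ (1 + 4 M_d² ν² cq²)^τ`. -/
def constK (d : ℕ) (τ cΦ cq ν : ℝ) : ℝ :=
  (constCd d * cΦ)⁻¹ * (1 + 4 * constMd d ^ 2 * ν ^ 2 * cq ^ 2) ^ τ

/-- `z = 4^d K`, the uniform bound for the condition numbers of the matrices `A_ℓ`. -/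
def constZ (d : ℕ) (τ cΦ cq ν : ℝ) : ℝ :=
  4 ^ d * constK d τ cΦ cq ν

/-- `R = √d max {cq ν, 4}`. -/
def constR (d : ℕ) (cq ν : ℝ) : ℝ :=
  Real.sqrt d * max (cq * ν) 4

/-- `θ = -(1 / (2R)) log ((√z - 1) / (√z + 1))`. -/
def constTheta (d : ℕ) (τ cΦ cq ν : ℝ) : ℝ :=
  -(1 / (2 * constR d cq ν)) *
    Real.log ((Real.sqrt (constZ d τ cΦ cq ν) - 1) / (Real.sqrt (constZ d τ cΦ cq ν) + 1))

/-- `C = 2 K e^(2θ√d) e^(cq ν θ) (1 + ν cq)^d max {1, ν^(-d)}`, the constant in the exponential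
decay of the Lagrange functions. -/
def constC (d : ℕ) (τ cΦ cq ν : ℝ) : ℝ :=
  2 * constK d τ cΦ cq ν * Real.exp (2 * constTheta d τ cΦ cq ν * Real.sqrt d) *
    Real.exp (cq * ν * constTheta d τ cΦ cq ν) * (1 + ν * cq) ^ d * max 1 (ν ^ d)⁻¹

/-- `C_Σ = ∑_{m ≥ 0} (m+2)^d e^(-θ m)`. -/
def constCSigma (d : ℕ) (τ cΦ cq ν : ℝ) : ℝ :=
  ∑' m : ℕ, ((m : ℝ) + 2) ^ d * Real.exp (-constTheta d τ cΦ cq ν * m)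

/-- `c_f²`, as a function of `N(1)` and `q_1` and of the parameters. -/
def constCfSq (d : ℕ) (τ cΦ cq ν : ℝ) (N1 : ℕ) (q1 : ℝ) : ℝ :=
  (N1 * (1 + 2 * ν * cq) ^ d * Real.pi ^ ((d : ℝ) / 2) * q1 ^ d *
      (1 + 4 * constMd d ^ 2 * ν ^ 2 * cq ^ 2) ^ (2 * τ)) /
    (ν ^ d * (constCd d * cΦ) ^ 2 * Real.Gamma ((d : ℝ) / 2 + 1))

/-! ### The matrices and the multiscale approximants -/

section Matrices

variable {d : ℕ} (Φ : E d → ℝ) (Ω : Set (E d)) (N : ℕ → ℕ) (x : ∀ ℓ, Fin (N ℓ) → E d) (ν : ℝ)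

/-- The basis function `Φ_{δ_ℓ}(y - x_n^(ℓ))`, with `δ_ℓ = ν h_ℓ`. -/
def basisFun (ℓ : ℕ) (n : Fin (N ℓ)) (y : E d) : ℝ :=
  scaledKernel Φ (ν * fillDist Ω (x ℓ)) (y - x ℓ n)

/-- `B_{k,ℓ} = (Φ_{δ_ℓ}(x_i^(k) - x_n^(ℓ)))_{i,n}`. -/
def matB (k ℓ : ℕ) : Matrix (Fin (N k)) (Fin (N ℓ)) ℝ :=
  Matrix.of fun i n => basisFun Φ Ω N x ν ℓ n (x k i)

/-- `A_ℓ = B_{ℓ,ℓ}`. -/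
def matA (ℓ : ℕ) : Matrix (Fin (N ℓ)) (Fin (N ℓ)) ℝ :=
  matB Φ Ω N x ν ℓ ℓ

/-- The matrix `𝔛_{k,ℓ} = B_{k,ℓ} A_ℓ⁻¹`. Its entry `(i, n)` is the value at `x_i^(k)` of the Lagrange
function of the node `x_n^(ℓ)`. -/
def matX (k ℓ : ℕ) : Matrix (Fin (N k)) (Fin (N ℓ)) ℝ :=
  matB Φ Ω N x ν k ℓ * (matA Φ Ω N x ν ℓ)⁻¹

open Classical in
/-- The thresholded matrix: only the entries of `𝔛_{k,ℓ}` that belong to nodes at distance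
`< T max {q_k, q_ℓ}` are kept. -/
def matXTrunc (T : ℝ) (k ℓ : ℕ) : Matrix (Fin (N k)) (Fin (N ℓ)) ℝ :=
  Matrix.of fun i n =>
    if ‖x k i - x ℓ n‖ < T * max (sepDist (x k)) (sepDist (x ℓ)) then matX Φ Ω N x ν k ℓ i n else 0

/-- The index set of `ℝ^(N(1)) × ⋯ × ℝ^(N(L))`; `⟨a, i⟩` stands for node `i` on level `a + 1`. -/
abbrev Idx (N : ℕ → ℕ) (L : ℕ) : Type := Σ a : Fin L, Fin (N (a + 1))

/-- The block diagonal matrix `D_L = diag (A_1, …, A_L)`. -/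
def matD (L : ℕ) : Matrix (Idx N L) (Idx N L) ℝ :=
  Matrix.blockDiagonal' fun a : Fin L => matA Φ Ω N x ν (a + 1)

/-- The unit lower block triangular matrix `T'_L`, with the blocks `𝔛_{k,ℓ}` for `k > ℓ`. -/
def matT' (L : ℕ) : Matrix (Idx N L) (Idx N L) ℝ :=
  Matrix.of fun p r =>
    if r.1 < p.1 then matX Φ Ω N x ν (p.1 + 1) (r.1 + 1) p.2 r.2 else if p = r then 1 else 0

/-- The perturbed iteration matrix: `M = id - T'_L` is strictly lower block triangular with the
blocks `-𝔛_{k,ℓ}`, `k > ℓ`; here the blocks `𝔛_{k,ℓ}` are replaced by the thresholded ones. -/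
def matMTrunc (T : ℝ) (L : ℕ) : Matrix (Idx N L) (Idx N L) ℝ :=
  Matrix.of fun p r =>
    if r.1 < p.1 then -matXTrunc Φ Ω N x ν T (p.1 + 1) (r.1 + 1) p.2 r.2 else 0

/-- The samples `(f|_{X_1}, …, f|_{X_L})`. -/
def samples (f : E d → ℝ) (L : ℕ) : Idx N L → ℝ :=
  fun p => f (x (p.1 + 1) p.2)

/-- The function `∑_ℓ ∑_n α_n^(ℓ) Φ_{δ_ℓ}(· - x_n^(ℓ))` with the coefficients `α`. -/
def approximant (L : ℕ) (α : Idx N L → ℝ) (y : E d) : ℝ :=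
  ∑ a : Fin L, ∑ n : Fin (N (a + 1)), α ⟨a, n⟩ * basisFun Φ Ω N x ν (a + 1) n y

end Matrices

end Multiscale

end

noncomputable section

namespace Multiscale

open MeasureTheory

/-! The coefficients of `f_L - f̃_L` solve `D_L (α - α') = β - β'`. So the proof needs the stability
of the triangular system under thresholding, and a bound for the `L²` norm of an approximant in
terms of the image of its coefficients under `D_L`.

Both rest on the coercivity of the level matrices. Their quadratic form is an integral of the
transform of `Φ` against the square modulus of an exponential sum. On a ball of frequencies the
transform is bounded below, and `ingham` bounds the integral of the exponential sum from below
because the nodes are separated. This gives the constant `(K q^d)⁻¹`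
(`IsKernel.kernelMatrix_lower`), and row sums then bound the condition number by `z`.

Since `Φ` has compact support, the level matrices are banded. Approximating `1/t` by Chebyshev
polynomials on the spectrum gives exponential decay of the inverse (`abs_inv_apply_le_of_banded`)
and of the Lagrange functions (`IsKernel.abs_lagrange_le`). Summing over shells, the rows of each
`𝔛_{k,ℓ}` have absolute sum at most `b = C C_Σ`, and the rows of the discarded part at most
`e^(-θT/2) b`. Forward substitution, a discrete Gronwall argument, yields `|β - β'| ≤ e^(-θT/2)
‖f‖_∞ L (1+b)^(L-1)` (`abs_sub_solution_le`).

For the `L²` norm, only boundedly many kernels of one level overlap at a point, coercivity bounds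
the coefficients, and a volume count bounds `N(ℓ) q_ℓ^d` by its value on level one. After squaring,
the decay is `e^(-θT)`. Half of it is spent on the factor `L^3 (2 c_q)^d (1+b)^(2(L-1))`, which the
assumptions on `L` and `T` bound by `e^(θT/2)` (`polynomial_le_exp`). The other half is the square
of the claimed `e^(-θT/4)`. -/

/-! ### The hat function and its Fourier transform -/

/-- The hat function `(1 - |x|)₊`. -/
def hat (x : ℝ) : ℝ := max 0 (1 - |x|)

lemma continuous_hat : Continuous hat := by unfold hat; fun_prop

lemma hat_eq_zero {x : ℝ} (hx : 1 ≤ |x|) : hat x = 0 := by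
  unfold hat; exact max_eq_left (by linarith)

lemma hat_of_abs_le {x : ℝ} (hx : |x| ≤ 1) : hat x = 1 - |x| := by
  unfold hat; exact max_eq_right (by linarith)

lemma hasCompactSupport_hat : HasCompactSupport hat :=
  HasCompactSupport.intro (isCompact_Icc (a := (-1 : ℝ)) (b := 1)) fun x hx => by
    refine hat_eq_zero ?_
    by_contra! h
    exact hx (abs_le.1 h.le)

lemma integrable_hat : Integrable hat :=
  continuous_hat.integrable_of_hasCompactSupport hasCompactSupport_hat

/-- The hat function with complex values. -/
def hatC (x : ℝ) : ℂ := hat x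

lemma continuous_hatC : Continuous hatC := Complex.continuous_ofReal.comp continuous_hat

lemma integrable_hatC : Integrable hatC := integrable_hat.ofReal

lemma integral_hat_exp {c : ℂ} (hc : c ≠ 0) :
    ∫ x : ℝ, Complex.exp (c * x) * hatC x =
      (Complex.exp c + Complex.exp (-c) - 2) / c ^ 2 := by
  have hcont : Continuous fun x : ℝ => Complex.exp (c * x) * hatC x :=
    (by fun_prop : Continuous fun x : ℝ => Complex.exp (c * x)).mul continuous_hatC
  have h1 : ∫ x : ℝ, Complex.exp (c * x) * hatC x =
      ∫ x in (-1 : ℝ)..1, Complex.exp (c * x) * hatC x := by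
    symm
    apply intervalIntegral.integral_eq_integral_of_support_subset
    intro x hx
    have : hat x ≠ 0 := by
      intro h
      apply hx
      simp [hatC, h]
    have h2 : |x| < 1 := by
      by_contra! h
      exact this (hat_eq_zero h)
    rw [abs_lt] at h2
    exact ⟨h2.1, h2.2.le⟩
  have hexp : ∀ x : ℝ, HasDerivAt (fun x : ℝ => Complex.exp (c * x)) (c * Complex.exp (c * x)) x := by
    intro x
    have h := ((hasDerivAt_id (x : ℂ)).const_mul c).cexp.comp_ofReal
    simpa [mul_comm] using h
  have hid : ∀ x : ℝ, HasDerivAt (fun x : ℝ => (x : ℂ)) 1 x := fun x =>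
    (hasDerivAt_id (x : ℂ)).comp_ofReal
  have hl : ∫ x in (-1 : ℝ)..0, Complex.exp (c * x) * hatC x =
      1 / c - 1 / c ^ 2 + Complex.exp (-c) / c ^ 2 := by
    have : ∫ x in (-1 : ℝ)..0, Complex.exp (c * x) * hatC x =
        ∫ x in (-1 : ℝ)..0, Complex.exp (c * x) * (1 + x) := by
      apply intervalIntegral.integral_congr
      intro x hx
      rw [Set.uIcc_of_le (by norm_num)] at hx
      have : hat x = 1 + x := by
        rw [hat_of_abs_le (by rw [abs_of_nonpos hx.2]; linarith [hx.1]), abs_of_nonpos hx.2]; ring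
      simp [hatC, this]
    rw [this, intervalIntegral.integral_eq_sub_of_hasDerivAt
      (f := fun x : ℝ => (1 + (x : ℂ)) * Complex.exp (c * x) / c - Complex.exp (c * x) / c ^ 2)]
    · simp
    · intro x _
      have h := ((((hid x).const_add 1).mul (hexp x)).div_const c).sub ((hexp x).div_const (c ^ 2))
      refine h.congr_deriv ?_
      field_simp
      ring
    · exact (by fun_prop : Continuous fun x : ℝ => Complex.exp (c * x) * (1 + x)).intervalIntegrable _ _
  have hr : ∫ x in (0 : ℝ)..1, Complex.exp (c * x) * hatC x =
      Complex.exp c / c ^ 2 - 1 / c - 1 / c ^ 2 := by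
    have : ∫ x in (0 : ℝ)..1, Complex.exp (c * x) * hatC x =
        ∫ x in (0 : ℝ)..1, Complex.exp (c * x) * (1 - x) := by
      apply intervalIntegral.integral_congr
      intro x hx
      rw [Set.uIcc_of_le (by norm_num)] at hx
      have : hat x = 1 - x := by
        rw [hat_of_abs_le (by rw [abs_of_nonneg hx.1]; exact hx.2), abs_of_nonneg hx.1]
      simp [hatC, this]
    rw [this, intervalIntegral.integral_eq_sub_of_hasDerivAt
      (f := fun x : ℝ => (1 - (x : ℂ)) * Complex.exp (c * x) / c + Complex.exp (c * x) / c ^ 2)]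
    · simp; ring
    · intro x _
      have h := ((((hid x).const_sub 1).mul (hexp x)).div_const c).add ((hexp x).div_const (c ^ 2))
      refine h.congr_deriv ?_
      field_simp
      ring
    · exact (by fun_prop : Continuous fun x : ℝ => Complex.exp (c * x) * (1 - x)).intervalIntegrable _ _
  rw [h1, ← intervalIntegral.integral_add_adjacent_intervals (hcont.intervalIntegrable (-1) 0)
    (hcont.intervalIntegrable 0 1), hl, hr]
  field_simp
  ring

/-- The Fourier transform of the hat function, a real function. -/
def hatF (u : ℝ) : ℝ := (𝓕 hatC u).re

lemma fourier_hatC_eq_integral (u : ℝ) :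
    𝓕 hatC u = ∫ x : ℝ, Complex.exp ((-2 * Real.pi * u * Complex.I) * x) * hatC x := by
  rw [Real.fourier_real_eq_integral_exp_smul]
  congr 1; ext x
  rw [smul_eq_mul]
  congr 2
  push_cast; ring

/-- Multiplying by `(2πu)²` instead of dividing covers `u = 0`, and it is the form needed later to
rewrite `u² * weight u` as a trigonometric polynomial times `hatF`. -/
lemma sq_mul_fourier_hatC (u : ℝ) :
    ((2 * Real.pi * u) ^ 2 : ℝ) * 𝓕 hatC u = ((2 - 2 * Real.cos (2 * Real.pi * u) : ℝ) : ℂ) := by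
  rcases eq_or_ne u 0 with rfl | hu
  · simp
  have hc : (-2 * Real.pi * u * Complex.I : ℂ) ≠ 0 := by
    simp [hu, Real.pi_ne_zero]
  rw [fourier_hatC_eq_integral, integral_hat_exp hc]
  have h : (2 * Real.cos (2 * Real.pi * u) : ℂ) =
      Complex.exp (-2 * Real.pi * u * Complex.I) + Complex.exp (-(-2 * Real.pi * u * Complex.I)) := by
    rw [Complex.ofReal_cos, Complex.two_cos, add_comm]
    push_cast
    congr 2 <;> ring
  push_cast
  push_cast at h
  rw [h]
  have hpi : (Real.pi : ℂ) ≠ 0 := by simp [Real.pi_ne_zero]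
  have hu' : (u : ℂ) ≠ 0 := by simp [hu]
  field_simp
  rw [Complex.I_sq]
  ring

lemma fourier_hatC (u : ℝ) : 𝓕 hatC u = (hatF u : ℂ) := by
  rcases eq_or_ne u 0 with rfl | hu
  · have : 𝓕 hatC 0 = ((∫ x, hat x : ℝ) : ℂ) := by
      rw [fourier_hatC_eq_integral]
      simp [hatC, integral_complex_ofReal]
    rw [hatF, this, Complex.ofReal_re]
  · have h := sq_mul_fourier_hatC u
    have h2 : ((2 * Real.pi * u) ^ 2 : ℝ) ≠ 0 := by
      have := Real.pi_ne_zero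
      positivity
    have h3 : 𝓕 hatC u = (((2 - 2 * Real.cos (2 * Real.pi * u)) / (2 * Real.pi * u) ^ 2 : ℝ) : ℂ) := by
      rw [Complex.ofReal_div, ← h]
      have h2' : (((2 * Real.pi * u) ^ 2 : ℝ) : ℂ) ≠ 0 := by exact_mod_cast h2
      rw [mul_div_cancel_left₀ _ h2']
    rw [hatF, h3, Complex.ofReal_re]

lemma sq_mul_hatF (u : ℝ) : (2 * Real.pi * u) ^ 2 * hatF u = 2 - 2 * Real.cos (2 * Real.pi * u) := by
  have h := sq_mul_fourier_hatC u
  rw [fourier_hatC] at h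
  exact_mod_cast h

lemma continuous_fourier_hatC : Continuous (𝓕 hatC) :=
  VectorFourier.fourierIntegral_continuous Real.continuous_fourierChar
    (by exact continuous_inner) integrable_hatC

lemma continuous_hatF : Continuous hatF := Complex.continuous_re.comp continuous_fourier_hatC

/-- Boundedness handles small `u`, `sq_mul_hatF` handles large `u`. This decay makes `hatF`
integrable, so that inversion applies, and gives `weight` a finite second moment. -/
lemma exists_abs_hatF_le : ∃ c : ℝ, 0 ≤ c ∧ ∀ u, |hatF u| ≤ c * (1 + u ^ 2)⁻¹ := by
  set c₀ := ∫ x, ‖hatC x‖ with hc₀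
  have h0 : 0 ≤ c₀ := integral_nonneg fun x => norm_nonneg _
  refine ⟨c₀ + 1, by positivity, fun u => ?_⟩
  have h1 : |hatF u| ≤ c₀ := by
    have : ‖𝓕 hatC u‖ ≤ c₀ := VectorFourier.norm_fourierIntegral_le_integral_norm _ _ _ _ _
    rwa [fourier_hatC, Complex.norm_real, Real.norm_eq_abs] at this
  have h2 : |hatF u| * u ^ 2 ≤ 1 := by
    have h := sq_mul_hatF u
    have h3 : (2 * Real.pi) ^ 2 * (|hatF u| * u ^ 2) ≤ 4 := by
      have : (2 * Real.pi) ^ 2 * (|hatF u| * u ^ 2) = |(2 * Real.pi * u) ^ 2 * hatF u| := by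
        rw [abs_mul, abs_of_nonneg (sq_nonneg (2 * Real.pi * u))]; ring
      rw [this, h, abs_le]
      constructor <;> linarith [Real.neg_one_le_cos (2 * Real.pi * u), Real.cos_le_one (2 * Real.pi * u)]
    have h4 : (4 : ℝ) ≤ (2 * Real.pi) ^ 2 := by nlinarith [Real.pi_gt_three]
    have h5 : 0 ≤ |hatF u| * u ^ 2 := by positivity
    nlinarith
  rw [← div_eq_mul_inv, le_div_iff₀ (by positivity)]
  nlinarith

/-- The weight `hatF²`, a nonnegative function with compactly supported Fourier transform. -/
def weight (u : ℝ) : ℝ := hatF u ^ 2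

lemma weight_nonneg (u : ℝ) : 0 ≤ weight u := sq_nonneg _

lemma continuous_weight : Continuous weight := continuous_hatF.pow 2

lemma integrable_hatF : Integrable hatF := by
  obtain ⟨c, hc, h⟩ := exists_abs_hatF_le
  exact (integrable_inv_one_add_sq.const_mul c).mono' continuous_hatF.aestronglyMeasurable
    (.of_forall fun u => by simpa using h u)

lemma integrable_sq_mul_weight : Integrable fun u => u ^ 2 * weight u := by
  obtain ⟨c, hc, h⟩ := exists_abs_hatF_le
  refine (integrable_inv_one_add_sq.const_mul (c ^ 2)).mono'
    ((continuous_id.pow 2).mul continuous_weight).aestronglyMeasurable (.of_forall fun u => ?_)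
  have h1 : weight u ≤ (c * (1 + u ^ 2)⁻¹) ^ 2 := by
    rw [weight, ← sq_abs]
    exact pow_le_pow_left₀ (abs_nonneg _) (h u) 2
  rw [Real.norm_of_nonneg (mul_nonneg (sq_nonneg _) (weight_nonneg u))]
  calc u ^ 2 * weight u ≤ (1 + u ^ 2) * (c * (1 + u ^ 2)⁻¹) ^ 2 := by
        refine mul_le_mul (by linarith) h1 (weight_nonneg u) (by positivity)
    _ = c ^ 2 * (1 + u ^ 2)⁻¹ := by
        have : 1 + u ^ 2 ≠ 0 := by positivity
        field_simp

lemma integrable_weight : Integrable weight := by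
  obtain ⟨c, hc, h⟩ := exists_abs_hatF_le
  refine (integrable_hatF.norm.const_mul c).mono' continuous_weight.aestronglyMeasurable
    (.of_forall fun u => ?_)
  have h1 : |hatF u| ≤ c := (h u).trans <| mul_le_of_le_one_right hc <|
    inv_le_one_of_one_le₀ (by nlinarith [sq_nonneg u])
  rw [Real.norm_of_nonneg (weight_nonneg u), weight, ← sq_abs, sq, Real.norm_eq_abs]
  gcongr

lemma fourierInv_fourier_hatC (x : ℝ) :
    ∫ u : ℝ, Complex.exp ((2 * Real.pi * x * Complex.I) * u) * hatF u = hatC x := by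
  have hint : Integrable (𝓕 hatC) :=
    integrable_hatF.ofReal.congr (.of_forall fun u => (fourier_hatC u).symm)
  have h := congrFun (continuous_hatC.fourierInv_fourier_eq integrable_hatC hint) x
  rw [Real.fourierInv_eq'] at h
  rw [← h]
  congr 1; ext u
  rw [smul_eq_mul, fourier_hatC]
  congr 2
  simp
  ring

/-- The multiplication formula moves the transform from one factor of `hatF²` to the other.
Inversion then leaves the self-convolution of the hat, which is supported in `[-2, 2]`. -/
lemma integral_weight_exp (x : ℝ) :
    ∫ u : ℝ, Complex.exp ((2 * Real.pi * x * Complex.I) * u) * weight u =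
      ((∫ y : ℝ, hat y * hat (x - y) : ℝ) : ℂ) := by
  have hg : Integrable fun u : ℝ => Complex.exp ((2 * Real.pi * x * Complex.I) * u) * (hatF u : ℂ) := by
    refine integrable_hatF.ofReal.bdd_mul (c := 1) (by fun_prop) (.of_forall fun u => ?_)
    rw [Complex.norm_exp]
    simp
  have h := VectorFourier.integral_fourierIntegral_smul_eq_flip (L := innerₗ ℝ) (μ := volume)
    (ν := volume) Real.continuous_fourierChar (by exact continuous_inner) integrable_hatC hg
  calc ∫ u : ℝ, Complex.exp ((2 * Real.pi * x * Complex.I) * u) * weight u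
      = ∫ u : ℝ, 𝓕 hatC u • (Complex.exp ((2 * Real.pi * x * Complex.I) * u) * (hatF u : ℂ)) := by
        congr 1; ext u
        rw [fourier_hatC, weight, smul_eq_mul]
        push_cast; ring
    _ = ∫ y : ℝ, hatC y •
          𝓕 (fun u : ℝ => Complex.exp ((2 * Real.pi * x * Complex.I) * u) * (hatF u : ℂ)) y := by
        rw [flip_innerₗ] at h
        exact h
    _ = ∫ y : ℝ, ((hat y * hat (x - y) : ℝ) : ℂ) := by
        congr 1; ext y
        rw [Real.fourier_real_eq_integral_exp_smul]
        have := fourierInv_fourier_hatC (x - y)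
        have h2 : ∫ u : ℝ, Complex.exp (((-2 * Real.pi * u * y : ℝ) : ℂ) * Complex.I) •
            (Complex.exp ((2 * Real.pi * x * Complex.I) * u) * (hatF u : ℂ)) = hatC (x - y) := by
          rw [← this]
          congr 1; ext u
          rw [smul_eq_mul, ← mul_assoc, ← Complex.exp_add]
          congr 2
          push_cast; ring
        rw [h2, hatC, hatC]
        push_cast
        simp
    _ = _ := integral_ofReal

lemma integral_weight_exp_eq_zero {x : ℝ} (hx : 2 ≤ |x|) :
    ∫ u : ℝ, Complex.exp ((2 * Real.pi * x * Complex.I) * u) * weight u = 0 := by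
  rw [integral_weight_exp]
  have : ∀ y, hat y * hat (x - y) = 0 := by
    intro y
    rcases le_or_gt 1 |y| with h | h
    · rw [hat_eq_zero h, zero_mul]
    · rw [hat_eq_zero (x := x - y), mul_zero]
      have := abs_sub_abs_le_abs_sub x y
      linarith
  simp [this]

lemma integral_weight : ∫ u : ℝ, weight u = 2 / 3 := by
  have h := integral_weight_exp 0
  simp only [Complex.ofReal_zero, mul_zero, zero_mul, Complex.exp_zero, one_mul] at h
  rw [integral_complex_ofReal] at h
  have h1 : ∫ u : ℝ, weight u = ∫ y : ℝ, hat y * hat (0 - y) := by exact_mod_cast h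
  rw [h1]
  have h2 : ∫ y : ℝ, hat y * hat (0 - y) = ∫ y in (-1 : ℝ)..1, hat y * hat (0 - y) := by
    symm
    apply intervalIntegral.integral_eq_integral_of_support_subset
    intro y hy
    have h2 : |y| < 1 := by
      by_contra! h
      exact hy (by simp [hat_eq_zero h])
    rw [abs_lt] at h2
    exact ⟨h2.1, h2.2.le⟩
  have hcont : Continuous fun y => hat y * hat (0 - y) := by
    unfold hat; fun_prop
  rw [h2, ← intervalIntegral.integral_add_adjacent_intervals (hcont.intervalIntegrable (-1) 0)
    (hcont.intervalIntegrable 0 1)]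
  have hl : ∫ y in (-1 : ℝ)..0, hat y * hat (0 - y) = ∫ y in (-1 : ℝ)..0, (1 + 2 * y + y ^ 2) := by
    apply intervalIntegral.integral_congr
    intro y hy
    rw [Set.uIcc_of_le (by norm_num)] at hy
    have h3 : |y| ≤ 1 := by rw [abs_of_nonpos hy.2]; linarith [hy.1]
    have h4 : |0 - y| ≤ 1 := by simpa using h3
    beta_reduce
    rw [hat_of_abs_le h3, hat_of_abs_le h4, zero_sub, abs_neg, abs_of_nonpos hy.2]
    ring
  have hr : ∫ y in (0 : ℝ)..1, hat y * hat (0 - y) = ∫ y in (0 : ℝ)..1, (1 - 2 * y + y ^ 2) := by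
    apply intervalIntegral.integral_congr
    intro y hy
    rw [Set.uIcc_of_le (by norm_num)] at hy
    have h3 : |y| ≤ 1 := by rw [abs_of_nonneg hy.1]; exact hy.2
    have h4 : |0 - y| ≤ 1 := by simpa using h3
    beta_reduce
    rw [hat_of_abs_le h3, hat_of_abs_le h4, zero_sub, abs_neg, abs_of_nonneg hy.1]
    ring
  rw [hl, hr]
  rw [intervalIntegral.integral_add, intervalIntegral.integral_add, intervalIntegral.integral_add,
    intervalIntegral.integral_sub]
  · rw [intervalIntegral.integral_const_mul, intervalIntegral.integral_const_mul]
    simp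
    norm_num
  all_goals exact Continuous.intervalIntegrable (by fun_prop) _ _

/-- By `sq_mul_hatF`, `u²` times one factor `hatF` is a trigonometric polynomial. Hence the
transform is a second difference of the hat, and it too vanishes for `|x| ≥ 2`. -/
lemma integral_sq_mul_weight_exp (x : ℝ) :
    ∫ u : ℝ, Complex.exp ((2 * Real.pi * x * Complex.I) * u) * ((u ^ 2 * weight u : ℝ) : ℂ) =
      ((2 * hat x - hat (x - 1) - hat (x + 1) : ℝ) : ℂ) / (2 * Real.pi) ^ 2 := by
  have hi : ∀ x : ℝ, Integrable fun u : ℝ =>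
      Complex.exp ((2 * Real.pi * x * Complex.I) * u) * (hatF u : ℂ) := fun x => by
    refine integrable_hatF.ofReal.bdd_mul (c := 1) (by fun_prop) (.of_forall fun u => ?_)
    rw [Complex.norm_exp]
    simp
  have key : ∀ u : ℝ, Complex.exp ((2 * Real.pi * x * Complex.I) * u) * ((u ^ 2 * weight u : ℝ) : ℂ) =
      (2 * (Complex.exp ((2 * Real.pi * x * Complex.I) * u) * (hatF u : ℂ)) -
        Complex.exp ((2 * Real.pi * (x - 1 : ℝ) * Complex.I) * u) * (hatF u : ℂ) -
        Complex.exp ((2 * Real.pi * (x + 1 : ℝ) * Complex.I) * u) * (hatF u : ℂ)) /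
          (2 * Real.pi) ^ 2 := by
    intro u
    have h1 : u ^ 2 * weight u =
        (2 - 2 * Real.cos (2 * Real.pi * u)) * hatF u / (2 * Real.pi) ^ 2 := by
      rw [← sq_mul_hatF, weight]
      have := Real.pi_ne_zero
      field_simp
    have h2 : (2 * Real.cos (2 * Real.pi * u) : ℂ) =
        Complex.exp (2 * Real.pi * u * Complex.I) + Complex.exp (-(2 * Real.pi * u * Complex.I)) := by
      rw [Complex.ofReal_cos, Complex.two_cos]
      push_cast
      congr 2; ring
    have h3 : Complex.exp ((2 * Real.pi * (x - 1 : ℝ) * Complex.I) * u) =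
        Complex.exp ((2 * Real.pi * x * Complex.I) * u) * Complex.exp (-(2 * Real.pi * u * Complex.I)) := by
      rw [← Complex.exp_add]; congr 1; push_cast; ring
    have h4 : Complex.exp ((2 * Real.pi * (x + 1 : ℝ) * Complex.I) * u) =
        Complex.exp ((2 * Real.pi * x * Complex.I) * u) * Complex.exp (2 * Real.pi * u * Complex.I) := by
      rw [← Complex.exp_add]; congr 1; push_cast; ring
    rw [h1, h3, h4]
    have h5 : (((2 - 2 * Real.cos (2 * Real.pi * u)) * hatF u / (2 * Real.pi) ^ 2 : ℝ) : ℂ) =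
        (2 - 2 * Real.cos (2 * Real.pi * u)) * hatF u / (2 * Real.pi) ^ 2 := by push_cast; ring
    rw [h5, h2]
    ring
  simp_rw [key]
  have h2 : ∀ y : ℝ, Integrable fun u : ℝ =>
      2 * (Complex.exp ((2 * Real.pi * x * Complex.I) * u) * (hatF u : ℂ)) -
        Complex.exp ((2 * Real.pi * y * Complex.I) * u) * (hatF u : ℂ) :=
    fun y => ((hi x).const_mul 2).sub (hi y)
  rw [integral_div, integral_sub (h2 _) (hi _),
    integral_sub ((hi x).const_mul 2) (hi _), integral_const_mul, fourierInv_fourier_hatC,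
    fourierInv_fourier_hatC, fourierInv_fourier_hatC]
  simp only [hatC]
  push_cast; ring

lemma integral_sq_mul_weight_exp_eq_zero {x : ℝ} (hx : 2 ≤ |x|) :
    ∫ u : ℝ, Complex.exp ((2 * Real.pi * x * Complex.I) * u) * ((u ^ 2 * weight u : ℝ) : ℂ) = 0 := by
  rw [integral_sq_mul_weight_exp, hat_eq_zero (by linarith : 1 ≤ |x|), hat_eq_zero, hat_eq_zero]
  · simp
  · have := abs_sub_abs_le_abs_sub x (-1)
    simp at this; linarith
  · have := abs_sub_abs_le_abs_sub x 1
    simp at this; linarith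

lemma integral_sq_mul_weight : ∫ u : ℝ, u ^ 2 * weight u = 2 / (2 * Real.pi) ^ 2 := by
  have h := integral_sq_mul_weight_exp 0
  simp only [Complex.ofReal_zero, mul_zero, zero_mul, Complex.exp_zero, one_mul] at h
  rw [integral_complex_ofReal, hat_of_abs_le (by simp), hat_eq_zero (by simp),
    hat_eq_zero (by simp)] at h
  have h2 : ((∫ u : ℝ, u ^ 2 * weight u : ℝ) : ℂ) = ((2 / (2 * Real.pi) ^ 2 : ℝ) : ℂ) := by
    rw [h]; push_cast; simp
  exact_mod_cast h2

/-! ### An Ingham type inequality for separated points -/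

section Ingham

variable {d : ℕ}

lemma integrable_prod_coord {v : Fin d → ℝ → ℝ} (hv : ∀ i, Integrable (v i)) :
    Integrable fun η : E d => ∏ i, v i (η i) := by
  have h := Integrable.fintype_prod (𝕜 := ℝ) (μ := fun _ : Fin d => (volume : Measure ℝ)) hv
  rw [← volume_pi] at h
  exact ((PiLp.volume_preserving_ofLp (Fin d)).integrable_comp_of_integrable h)

lemma integral_prod_coord (v : Fin d → ℝ → ℝ) :
    ∫ η : E d, ∏ i, v i (η i) = ∏ i, ∫ u, v i u := by
  rw [← integral_fintype_prod_volume_eq_prod,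
    ← (PiLp.volume_preserving_ofLp (Fin d)).integral_comp
      (MeasurableEquiv.toLp 2 (Fin d → ℝ)).symm.measurableEmbedding]

lemma integral_exp_prod_coord (v : Fin d → ℝ → ℝ) (x : E d) :
    ∫ η : E d, Complex.exp (2 * Real.pi * (inner ℝ x η : ℝ) * Complex.I) * ((∏ i, v i (η i) : ℝ) : ℂ) =
      ∏ i, ∫ u : ℝ, Complex.exp ((2 * Real.pi * x i * Complex.I) * u) * (v i u : ℂ) := by
  rw [← integral_fintype_prod_volume_eq_prod
      (f := fun i (u : ℝ) => Complex.exp ((2 * Real.pi * x i * Complex.I) * u) * (v i u : ℂ)),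
    ← (PiLp.volume_preserving_ofLp (Fin d)).integral_comp
      (MeasurableEquiv.toLp 2 (Fin d → ℝ)).symm.measurableEmbedding]
  congr 1; ext η
  rw [Finset.prod_mul_distrib, ← Complex.exp_sum, PiLp.inner_apply]
  push_cast
  congr 2
  rw [Finset.mul_sum, Finset.sum_mul]
  refine Finset.sum_congr rfl fun i _ => ?_
  simp
  ring

/-- The product weight `∏ weight (η i)`. -/
def prodWeight (η : E d) : ℝ := ∏ i, weight (η i)

lemma prodWeight_nonneg (η : E d) : 0 ≤ prodWeight η :=
  Finset.prod_nonneg fun _ _ => weight_nonneg _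

lemma continuous_prodWeight : Continuous (prodWeight (d := d)) :=
  continuous_finsetProd _ fun _ _ => continuous_weight.comp (by fun_prop)

lemma integrable_prodWeight : Integrable (prodWeight (d := d)) :=
  integrable_prod_coord fun _ => integrable_weight

lemma integral_prodWeight : ∫ η : E d, prodWeight η = (2 / 3) ^ d := by
  unfold prodWeight
  rw [integral_prod_coord]
  simp only [integral_weight, Finset.prod_const, Finset.card_univ, Fintype.card_fin]

/-- The factors of `η j ^ 2 * prodWeight η`. -/
def coordWeight (j i : Fin d) (u : ℝ) : ℝ := if i = j then u ^ 2 * weight u else weight u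

lemma sq_mul_prodWeight (j : Fin d) (η : E d) :
    η j ^ 2 * prodWeight η =
      ∏ i, coordWeight j i (η i) := by
  have : ∀ i, coordWeight j i (η i) = (if i = j then η i ^ 2 else 1) * weight (η i) := by
    intro i; by_cases h : i = j <;> simp [h, coordWeight]
  simp_rw [this, Finset.prod_mul_distrib, prodWeight]
  simp

lemma integrable_sq_mul_prodWeight (j : Fin d) :
    Integrable fun η : E d => η j ^ 2 * prodWeight η := by
  simp_rw [sq_mul_prodWeight]
  refine integrable_prod_coord fun i => ?_
  unfold coordWeight
  by_cases h : i = j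
  · simpa [h] using integrable_sq_mul_weight
  · simpa [h] using integrable_weight

lemma integral_sq_mul_prodWeight (j : Fin d) :
    ∫ η : E d, η j ^ 2 * prodWeight η = 3 / (2 * Real.pi) ^ 2 * (2 / 3) ^ d := by
  simp_rw [sq_mul_prodWeight]
  rw [integral_prod_coord]
  have : ∀ i, ∫ u, coordWeight j i u =
      (if i = j then 3 / (2 * Real.pi) ^ 2 else 1) * (2 / 3) := by
    intro i; unfold coordWeight; by_cases h : i = j
    · simp only [h, if_true, integral_sq_mul_weight]; ring
    · simp only [h, if_false, integral_weight]; ring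
  simp_rw [this, Finset.prod_mul_distrib]
  simp only [Finset.prod_ite_eq', Finset.mem_univ, if_true, Finset.prod_const, Finset.card_univ,
    Fintype.card_fin]

/-- The transform of a product weight vanishes as soon as one coordinate leaves `(-2, 2)`. This is
the origin of the separation `2√d` in `ingham`. -/
lemma exists_two_le_abs_coord (hd : 1 ≤ d) {x : E d} (hx : 2 * √d ≤ ‖x‖) : ∃ i, 2 ≤ |x i| := by
  by_contra! h
  have hne : (Finset.univ : Finset (Fin d)).Nonempty := ⟨⟨0, hd⟩, Finset.mem_univ _⟩
  have h1 : ‖x‖ ^ 2 < 4 * d := by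
    rw [EuclideanSpace.norm_sq_eq]
    calc ∑ i, ‖x i‖ ^ 2 < ∑ _i : Fin d, (4 : ℝ) := by
          refine Finset.sum_lt_sum_of_nonempty hne fun i _ => ?_
          rw [Real.norm_eq_abs]
          nlinarith [h i, abs_nonneg (x i)]
      _ = 4 * d := by simp [mul_comm]
  have h2 : (2 * √d) ^ 2 ≤ ‖x‖ ^ 2 := by gcongr
  rw [mul_pow, Real.sq_sqrt (by positivity)] at h2
  linarith

/-- The real quadratic majorant kernel used in the proof of `ingham`. -/
def inghamKernel (ρ : ℝ) (η : E d) : ℝ := (1 - ‖η‖ ^ 2 / ρ ^ 2) * prodWeight η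

lemma inghamKernel_eq (ρ : ℝ) (η : E d) :
    inghamKernel ρ η = prodWeight η - (ρ ^ 2)⁻¹ * ∑ j, η j ^ 2 * prodWeight η := by
  rw [inghamKernel, EuclideanSpace.norm_sq_eq, ← Finset.sum_mul]
  simp only [Real.norm_eq_abs, sq_abs]
  ring

lemma integrable_inghamKernel (ρ : ℝ) : Integrable (inghamKernel (d := d) ρ) := by
  have h : Integrable fun η : E d => prodWeight η - (ρ ^ 2)⁻¹ * ∑ j, η j ^ 2 * prodWeight η :=
    integrable_prodWeight.sub
      ((integrable_finsetSum _ fun j _ => integrable_sq_mul_prodWeight j).const_mul _)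
  exact h.congr (.of_forall fun η => (inghamKernel_eq ρ η).symm)

/-- The radius `√(6d) / (2π)`. -/
def inghamRadius (d : ℕ) : ℝ := √(6 * d) / (2 * Real.pi)

lemma inghamRadius_pos (hd : 1 ≤ d) : 0 < inghamRadius d := by
  have : (0 : ℝ) < d := by exact_mod_cast hd
  unfold inghamRadius
  positivity

/-- Every coordinate has relative second moment `3 / (2π)²`. The radius is chosen so that the `d`
quadratic terms together remove exactly half of the mass. -/
lemma integral_inghamKernel (hd : 1 ≤ d) :
    ∫ η : E d, inghamKernel (inghamRadius d) η = 1 / 2 * (2 / 3) ^ d := by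
  simp_rw [inghamKernel_eq]
  rw [integral_sub integrable_prodWeight
      ((integrable_finsetSum _ fun j _ => integrable_sq_mul_prodWeight j).const_mul _),
    integral_const_mul, integral_finsetSum _ fun j _ => integrable_sq_mul_prodWeight j]
  simp_rw [integral_sq_mul_prodWeight, integral_prodWeight]
  have h1 : (0 : ℝ) < d := by exact_mod_cast hd
  have h2 : inghamRadius d ^ 2 = 6 * d / (2 * Real.pi) ^ 2 := by
    rw [inghamRadius, div_pow, Real.sq_sqrt (by positivity)]
  rw [h2]
  have := Real.pi_ne_zero
  simp only [Finset.sum_const, Finset.card_univ, Fintype.card_fin, nsmul_eq_mul]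
  field_simp
  ring

lemma integral_exp_inghamKernel (hd : 1 ≤ d) (ρ : ℝ) {x : E d} (hx : 2 * √d ≤ ‖x‖) :
    ∫ η : E d, Complex.exp (2 * Real.pi * (inner ℝ x η : ℝ) * Complex.I) * (inghamKernel ρ η : ℂ) = 0 := by
  obtain ⟨i₀, hi₀⟩ := exists_two_le_abs_coord hd hx
  have hbd : ∀ f : E d → ℝ, Integrable f → Integrable fun η : E d =>
      Complex.exp (2 * Real.pi * (inner ℝ x η : ℝ) * Complex.I) * (f η : ℂ) := fun f hf => by
    refine hf.ofReal.bdd_mul (c := 1) (by fun_prop) (.of_forall fun u => ?_)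
    rw [Complex.norm_exp]
    simp
  have h0 : ∫ η : E d, Complex.exp (2 * Real.pi * (inner ℝ x η : ℝ) * Complex.I) * (prodWeight η : ℂ) = 0 := by
    unfold prodWeight
    rw [integral_exp_prod_coord]
    exact Finset.prod_eq_zero (Finset.mem_univ i₀) (integral_weight_exp_eq_zero hi₀)
  have h1 : ∀ j : Fin d, ∫ η : E d, Complex.exp (2 * Real.pi * (inner ℝ x η : ℝ) * Complex.I) *
      ((η j ^ 2 * prodWeight η : ℝ) : ℂ) = 0 := by
    intro j
    simp_rw [sq_mul_prodWeight]
    rw [integral_exp_prod_coord]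
    refine Finset.prod_eq_zero (Finset.mem_univ i₀) ?_
    unfold coordWeight
    by_cases h : i₀ = j
    · simp only [h, if_true]
      exact integral_sq_mul_weight_exp_eq_zero (h ▸ hi₀)
    · simp only [h, if_false]
      exact integral_weight_exp_eq_zero hi₀
  have h2 : ∀ η : E d, Complex.exp (2 * Real.pi * (inner ℝ x η : ℝ) * Complex.I) * (inghamKernel ρ η : ℂ) =
      Complex.exp (2 * Real.pi * (inner ℝ x η : ℝ) * Complex.I) * (prodWeight η : ℂ) -
      ((ρ ^ 2 : ℝ) : ℂ)⁻¹ * ∑ j, Complex.exp (2 * Real.pi * (inner ℝ x η : ℝ) * Complex.I) *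
        ((η j ^ 2 * prodWeight η : ℝ) : ℂ) := by
    intro η
    rw [inghamKernel_eq, ← Finset.mul_sum]
    push_cast
    ring
  simp_rw [h2]
  rw [integral_sub (hbd _ integrable_prodWeight)
    ((integrable_finsetSum _ fun j _ => hbd _ (integrable_sq_mul_prodWeight j)).const_mul _),
    integral_const_mul, integral_finsetSum _ fun j _ => hbd _ (integrable_sq_mul_prodWeight j), h0]
  simp only [h1]
  simp

/-- The phase `φ` accounts for the translation by `a` in `integral_inghamKernel_mul_expSumSq`. -/
lemma integral_mul_cos_eq_zero {f : E d → ℝ} {x : E d} (φ : ℝ)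
    (h : ∫ η : E d, Complex.exp (2 * Real.pi * (inner ℝ x η : ℝ) * Complex.I) * (f η : ℂ) = 0)
    (hf : Integrable f) :
    ∫ η : E d, f η * Real.cos (2 * Real.pi * inner ℝ x η + φ) = 0 := by
  have hint : Integrable fun η : E d =>
      Complex.exp (φ * Complex.I) *
        (Complex.exp (2 * Real.pi * (inner ℝ x η : ℝ) * Complex.I) * (f η : ℂ)) := by
    refine Integrable.const_mul (hf.ofReal.bdd_mul (c := 1) (by fun_prop) (.of_forall fun u => ?_)) _
    rw [Complex.norm_exp]
    simp
  have h1 := integral_re hint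
  rw [integral_const_mul, h, mul_zero] at h1
  rw [← RCLike.zero_re (K := ℂ), ← h1]
  congr 1; ext η
  rw [← mul_assoc, ← Complex.exp_add]
  have : (φ : ℂ) * Complex.I + 2 * Real.pi * (inner ℝ x η : ℝ) * Complex.I =
      ((2 * Real.pi * inner ℝ x η + φ : ℝ) : ℂ) * Complex.I := by push_cast; ring
  rw [this]
  change _ = (Complex.exp _ * _).re
  rw [Complex.re_mul_ofReal, Complex.exp_ofReal_mul_I_re, mul_comm]

variable {ι : Type*} [Fintype ι]

/-- The square modulus of the exponential sum `∑ c_j exp(2πi ⟪x_j, ξ⟫)`. -/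
def expSumSq (c : ι → ℝ) (x : ι → E d) (ξ : E d) : ℝ :=
  (∑ j, c j * Real.cos (2 * Real.pi * inner ℝ (x j) ξ)) ^ 2 +
    (∑ j, c j * Real.sin (2 * Real.pi * inner ℝ (x j) ξ)) ^ 2

lemma expSumSq_nonneg (c : ι → ℝ) (x : ι → E d) (ξ : E d) : 0 ≤ expSumSq c x ξ := by
  unfold expSumSq; positivity

lemma continuous_expSumSq (c : ι → ℝ) (x : ι → E d) : Continuous (expSumSq c x) := by
  unfold expSumSq; fun_prop

lemma expSumSq_eq (c : ι → ℝ) (x : ι → E d) (ξ : E d) :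
    expSumSq c x ξ = ∑ j, ∑ k, c j * c k * Real.cos (2 * Real.pi * inner ℝ (x j - x k) ξ) := by
  rw [expSumSq, sq, sq, Finset.sum_mul_sum, Finset.sum_mul_sum, ← Finset.sum_add_distrib]
  refine Finset.sum_congr rfl fun j _ => ?_
  rw [← Finset.sum_add_distrib]
  refine Finset.sum_congr rfl fun k _ => ?_
  rw [inner_sub_left, mul_sub, Real.cos_sub]
  ring

lemma exists_expSumSq_le (c : ι → ℝ) (x : ι → E d) : ∃ B : ℝ, ∀ ξ, expSumSq c x ξ ≤ B := by
  refine ⟨∑ j, ∑ k, |c j * c k|, fun ξ => ?_⟩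
  rw [expSumSq_eq]
  refine Finset.sum_le_sum fun j _ => Finset.sum_le_sum fun k _ => ?_
  refine (le_abs_self _).trans ?_
  rw [abs_mul]
  exact mul_le_of_le_one_right (abs_nonneg _) (Real.abs_cos_le_one _)

lemma integrable_mul_expSumSq {f : E d → ℝ} (hf : Integrable f) (c : ι → ℝ) (x : ι → E d) (a : E d) :
    Integrable fun η => f η * expSumSq c x (η + a) := by
  obtain ⟨B, hB⟩ := exists_expSumSq_le c x
  refine hf.mul_bdd (c := B)
    (((continuous_expSumSq c x).comp (by fun_prop : Continuous fun η : E d => η + a)).aestronglyMeasurable)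
    (.of_forall fun η => ?_)
  rw [Real.norm_of_nonneg (expSumSq_nonneg _ _ _)]
  exact hB _

lemma integral_inghamKernel_mul_expSumSq (hd : 1 ≤ d) (ρ : ℝ) (c : ι → ℝ) {x : ι → E d}
    (hx : ∀ j k, j ≠ k → 2 * √d ≤ ‖x j - x k‖) (a : E d) :
    ∫ η : E d, inghamKernel ρ η * expSumSq c x (η + a) =
      (∑ j, c j ^ 2) * ∫ η : E d, inghamKernel ρ η := by
  classical
  have h1 : ∀ j k, ∫ η : E d, inghamKernel ρ η *
      Real.cos (2 * Real.pi * inner ℝ (x j - x k) η + 2 * Real.pi * inner ℝ (x j - x k) a) =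
      if j = k then ∫ η : E d, inghamKernel ρ η else 0 := by
    intro j k
    split_ifs with h
    · simp [h]
    · exact integral_mul_cos_eq_zero _ (integral_exp_inghamKernel hd ρ (hx j k h))
        (integrable_inghamKernel ρ)
  have h2 : ∀ j k, Integrable fun η : E d => inghamKernel ρ η *
      Real.cos (2 * Real.pi * inner ℝ (x j - x k) η + 2 * Real.pi * inner ℝ (x j - x k) a) := by
    intro j k
    refine (integrable_inghamKernel ρ).mul_bdd (c := 1) (by fun_prop) (.of_forall fun η => ?_)
    exact Real.abs_cos_le_one _
  have h3 : ∀ η : E d, inghamKernel ρ η * expSumSq c x (η + a) = ∑ j, ∑ k, c j * c k *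
      (inghamKernel ρ η *
      Real.cos (2 * Real.pi * inner ℝ (x j - x k) η + 2 * Real.pi * inner ℝ (x j - x k) a)) := by
    intro η
    rw [expSumSq_eq, Finset.mul_sum]
    refine Finset.sum_congr rfl fun j _ => ?_
    rw [Finset.mul_sum]
    refine Finset.sum_congr rfl fun k _ => ?_
    rw [inner_add_right, mul_add]
    ring
  simp_rw [h3]
  rw [integral_finsetSum _ fun j _ => integrable_finsetSum _ fun k _ => (h2 j k).const_mul _,
    Finset.sum_mul]
  refine Finset.sum_congr rfl fun j _ => ?_
  rw [integral_finsetSum _ fun k _ => (h2 j k).const_mul _]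
  simp_rw [integral_const_mul, h1]
  simp only [mul_ite, mul_zero, Finset.sum_ite_eq, Finset.mem_univ, if_true]
  ring

lemma setIntegral_comp_add_le {f : E d → ℝ} (hf : Continuous f) (hf0 : ∀ ξ, 0 ≤ f ξ) {r s : ℝ} {η : E d}
    (hη : ‖η‖ ≤ s) :
    ∫ a in Metric.closedBall (0 : E d) r, f (η + a) ≤ ∫ ξ in Metric.closedBall (0 : E d) (r + s), f ξ := by
  have h := (measurePreserving_add_left (volume : Measure (E d)) η).setIntegral_preimage_emb
    (measurableEmbedding_addLeft η) f (Metric.closedBall η r)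
  have h2 : (fun x => η + x) ⁻¹' Metric.closedBall η r = Metric.closedBall 0 r := by
    ext y; simp
  rw [h2] at h
  rw [h]
  refine setIntegral_mono_set (hf.continuousOn.integrableOn_compact (isCompact_closedBall _ _))
    (.of_forall hf0) (Filter.Eventually.of_forall ?_)
  exact Metric.closedBall_subset_closedBall' (by simpa using hη)

/-- The kernel `inghamKernel ρ` is at most `prodWeight` on the ball of radius `ρ` and nonpositive
outside, while its transform kills all off-diagonal terms. So for every shift `a` the integral of
`prodWeight` against the shifted exponential sum over that ball is at least half of `(2/3)^d ∑
c_j²`. Integrating over `a` in the ball of radius `r` and exchanging the integrals gives the claim,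
since `η + a` stays in the ball of radius `r + ρ` and `prodWeight` has total mass `(2/3)^d`. -/
theorem ingham (hd : 1 ≤ d) (c : ι → ℝ) {x : ι → E d}
    (hx : ∀ j k, j ≠ k → 2 * √d ≤ ‖x j - x k‖) (r : ℝ) :
    1 / 2 * volume.real (Metric.closedBall (0 : E d) r) * ∑ j, c j ^ 2 ≤
      ∫ ξ in Metric.closedBall (0 : E d) (r + inghamRadius d), expSumSq c x ξ := by
  set ρ := inghamRadius d with hρ
  have hρ0 : 0 < ρ := inghamRadius_pos hd
  set J := ∫ ξ in Metric.closedBall (0 : E d) (r + ρ), expSumSq c x ξ with hJ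
  have hJ0 : 0 ≤ J := setIntegral_nonneg measurableSet_closedBall fun ξ _ => expSumSq_nonneg _ _ _
  have h1 : ∀ a : E d, 1 / 2 * (2 / 3) ^ d * ∑ j, c j ^ 2 ≤
      ∫ η in Metric.closedBall (0 : E d) ρ, prodWeight η * expSumSq c x (η + a) := by
    intro a
    have h := integral_inghamKernel_mul_expSumSq hd ρ c hx a
    rw [integral_inghamKernel hd] at h
    rw [mul_comm, ← h, ← integral_indicator measurableSet_closedBall]
    refine integral_mono (integrable_mul_expSumSq (integrable_inghamKernel ρ) c x a)
      ((integrable_mul_expSumSq integrable_prodWeight c x a).indicator measurableSet_closedBall) ?_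
    intro η
    by_cases hη : η ∈ Metric.closedBall (0 : E d) ρ
    · rw [Set.indicator_of_mem hη]
      refine mul_le_mul_of_nonneg_right ?_ (expSumSq_nonneg _ _ _)
      rw [inghamKernel]
      refine mul_le_of_le_one_left (prodWeight_nonneg _) ?_
      have : 0 ≤ ‖η‖ ^ 2 / ρ ^ 2 := by positivity
      linarith
    · rw [Set.indicator_of_notMem hη]
      refine mul_nonpos_of_nonpos_of_nonneg ?_ (expSumSq_nonneg _ _ _)
      rw [inghamKernel]
      refine mul_nonpos_of_nonpos_of_nonneg ?_ (prodWeight_nonneg _)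
      rw [mem_closedBall_zero_iff, not_le] at hη
      rw [sub_nonpos, le_div_iff₀ (by positivity), one_mul]
      gcongr
  have hcont : Continuous fun p : E d × E d => prodWeight p.2 * expSumSq c x (p.2 + p.1) :=
    (continuous_prodWeight.comp continuous_snd).mul ((continuous_expSumSq c x).comp (by fun_prop))
  have hint : Integrable (Function.uncurry fun a η : E d => prodWeight η * expSumSq c x (η + a))
      ((volume.restrict (Metric.closedBall (0 : E d) r)).prod
        (volume.restrict (Metric.closedBall (0 : E d) ρ))) := by
    rw [Measure.prod_restrict]
    exact hcont.continuousOn.integrableOn_compact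
      ((isCompact_closedBall _ _).prod (isCompact_closedBall _ _))
  have h2 : volume.real (Metric.closedBall (0 : E d) r) * (1 / 2 * (2 / 3) ^ d * ∑ j, c j ^ 2) ≤
      ∫ a in Metric.closedBall (0 : E d) r, ∫ η in Metric.closedBall (0 : E d) ρ,
        prodWeight η * expSumSq c x (η + a) := by
    rw [← smul_eq_mul, ← setIntegral_const]
    refine setIntegral_mono_on (integrableOn_const (by exact measure_closedBall_lt_top.ne))
      hint.integral_prod_left measurableSet_closedBall fun a _ => h1 a
  rw [integral_integral_swap hint] at h2
  have h3 : ∫ η in Metric.closedBall (0 : E d) ρ, ∫ a in Metric.closedBall (0 : E d) r,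
        prodWeight η * expSumSq c x (η + a) ≤ ∫ η in Metric.closedBall (0 : E d) ρ, prodWeight η * J := by
    refine setIntegral_mono_on hint.integral_prod_right
      (integrable_prodWeight.integrableOn.mul_const J) measurableSet_closedBall fun η hη => ?_
    rw [integral_const_mul]
    refine mul_le_mul_of_nonneg_left ?_ (prodWeight_nonneg _)
    exact setIntegral_comp_add_le (continuous_expSumSq c x) (expSumSq_nonneg c x)
      (mem_closedBall_zero_iff.1 hη)
  rw [integral_mul_const] at h3
  have h4 : ∫ η in Metric.closedBall (0 : E d) ρ, prodWeight η ≤ (2 / 3) ^ d := by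
    rw [← integral_prodWeight]
    exact setIntegral_le_integral integrable_prodWeight (.of_forall prodWeight_nonneg)
  have h5 := h2.trans (h3.trans (mul_le_mul_of_nonneg_right h4 hJ0))
  have h6 : (0 : ℝ) < (2 / 3) ^ d := by positivity
  refine le_of_mul_le_mul_left ?_ h6
  linarith

end Ingham

/-! ### The constant `M_d` -/

/-- Bounding `(1 + 2/(d+1))^(d+1)` by `e² < 7.4` leaves a quadratic inequality in `d`. It holds only
from `d = 2` on, so two cases are checked directly. -/
lemma constMd_aux_step (d : ℕ) :
    (5 / 36 : ℝ) ^ 2 * ((d : ℝ) + 3) ^ (d + 3) ≤ ((d : ℝ) / 2 + 1) ^ 2 * ((d : ℝ) + 1) ^ (d + 1) := by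
  rcases Nat.lt_or_ge d 2 with h | h
  · interval_cases d <;> norm_num
  have hd : (2 : ℝ) ≤ d := by exact_mod_cast h
  have h1 : ((d : ℝ) + 3) ^ (d + 1) ≤ 7.4 * ((d : ℝ) + 1) ^ (d + 1) := by
    have h2 : 1 + 2 / ((d : ℝ) + 1) ≤ Real.exp (2 / ((d : ℝ) + 1)) := by
      linarith [Real.add_one_le_exp (2 / ((d : ℝ) + 1))]
    have h3 : (1 + 2 / ((d : ℝ) + 1)) ^ (d + 1) ≤ Real.exp 2 := by
      calc (1 + 2 / ((d : ℝ) + 1)) ^ (d + 1) ≤ Real.exp (2 / ((d : ℝ) + 1)) ^ (d + 1) := by gcongr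
        _ = Real.exp 2 := by
          rw [← Real.exp_nat_mul]
          congr 1
          push_cast
          field_simp
    have h4 : Real.exp 2 ≤ 7.4 := by
      have : Real.exp 2 = Real.exp 1 * Real.exp 1 := by rw [← Real.exp_add]; norm_num
      rw [this]
      nlinarith [Real.exp_one_lt_d9, Real.exp_pos 1]
    have h5 : (d : ℝ) + 3 = (1 + 2 / ((d : ℝ) + 1)) * ((d : ℝ) + 1) := by field_simp; ring
    rw [h5, mul_pow]
    exact mul_le_mul_of_nonneg_right (h3.trans h4) (by positivity)
  have h6 : (5 / 36 : ℝ) ^ 2 * 7.4 * ((d : ℝ) + 3) ^ 2 ≤ ((d : ℝ) / 2 + 1) ^ 2 := by nlinarith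
  calc (5 / 36 : ℝ) ^ 2 * ((d : ℝ) + 3) ^ (d + 3)
      = (5 / 36 : ℝ) ^ 2 * ((d : ℝ) + 3) ^ 2 * ((d : ℝ) + 3) ^ (d + 1) := by ring
    _ ≤ (5 / 36 : ℝ) ^ 2 * ((d : ℝ) + 3) ^ 2 * (7.4 * ((d : ℝ) + 1) ^ (d + 1)) := by gcongr
    _ = (5 / 36 : ℝ) ^ 2 * 7.4 * ((d : ℝ) + 3) ^ 2 * ((d : ℝ) + 1) ^ (d + 1) := by ring
    _ ≤ _ := by gcongr

/-- Induction in steps of two, matching the functional equation of `Γ` at half-integers. The number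
`5/36` becomes `5/3` after the prefactor `12` of `constMd`. -/
lemma pow_le_pi_mul_Gamma_sq : ∀ d : ℕ,
    (5 / 36 * ((d : ℝ) + 1)) ^ (d + 1) ≤ Real.pi * Real.Gamma ((d : ℝ) / 2 + 1) ^ 2 / 9
  | 0 => by
    simp
    linarith [Real.pi_gt_three]
  | 1 => by
    have h : Real.Gamma (((1 : ℕ) : ℝ) / 2 + 1) = √Real.pi / 2 := by
      rw [Nat.cast_one, Real.Gamma_add_one (by norm_num), Real.Gamma_one_half_eq]; ring
    rw [h, div_pow, Real.sq_sqrt Real.pi_pos.le]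
    norm_num
    nlinarith [Real.pi_gt_three]
  | d + 2 => by
    have ih := pow_le_pi_mul_Gamma_sq d
    have h : Real.Gamma (((d + 2 : ℕ) : ℝ) / 2 + 1) =
        ((d : ℝ) / 2 + 1) * Real.Gamma ((d : ℝ) / 2 + 1) := by
      rw [← Real.Gamma_add_one (by positivity)]
      congr 1
      push_cast; ring
    rw [h]
    push_cast
    calc (5 / 36 * ((d : ℝ) + 2 + 1)) ^ (d + 2 + 1)
        = (5 / 36) ^ (d + 1) * ((5 / 36 : ℝ) ^ 2 * ((d : ℝ) + 3) ^ (d + 3)) := by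
          rw [mul_pow]; ring
      _ ≤ (5 / 36) ^ (d + 1) * (((d : ℝ) / 2 + 1) ^ 2 * ((d : ℝ) + 1) ^ (d + 1)) := by
          gcongr ?_ * ?_
          exact constMd_aux_step d
      _ = ((d : ℝ) / 2 + 1) ^ 2 * (5 / 36 * ((d : ℝ) + 1)) ^ (d + 1) := by rw [mul_pow]; ring
      _ ≤ ((d : ℝ) / 2 + 1) ^ 2 * (Real.pi * Real.Gamma ((d : ℝ) / 2 + 1) ^ 2 / 9) := by gcongr
      _ = _ := by ring

lemma Gamma_half_pos (d : ℕ) : 0 < Real.Gamma ((d : ℝ) / 2 + 1) :=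
  Real.Gamma_pos_of_pos (by positivity)

/-- The slope matters: fitting `inghamRadius` into the frequency ball requires `M_d ≥ (2√6/3) d`,
and `2√6/3 < 5/3`. For `d ≥ 1` the bound also gives `M_d ≥ π`, used for `K`. -/
lemma le_constMd (d : ℕ) : 5 / 3 * ((d : ℝ) + 1) ≤ constMd d := by
  have h := pow_le_pi_mul_Gamma_sq d
  have h2 : 5 / 36 * ((d : ℝ) + 1) ≤
      (Real.pi * Real.Gamma ((d : ℝ) / 2 + 1) ^ 2 / 9) ^ (1 / ((d : ℝ) + 1)) := by
    rw [one_div, Real.le_rpow_inv_iff_of_pos (by positivity) (by positivity) (by positivity)]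
    exact_mod_cast h
  rw [constMd]
  linarith

lemma constMd_pos (d : ℕ) : 0 < constMd d :=
  lt_of_lt_of_le (by positivity) (le_constMd d)

lemma constMd_pow (d : ℕ) :
    constMd d ^ (d + 1) = 12 ^ (d + 1) * (Real.pi * Real.Gamma ((d : ℝ) / 2 + 1) ^ 2 / 9) := by
  rw [constMd, mul_pow, ← Real.rpow_natCast _ (d + 1), ← Real.rpow_natCast (_ ^ _) (d + 1),
    ← Real.rpow_mul (by positivity)]
  congr 1
  push_cast
  rw [one_div_mul_cancel (by positivity), Real.rpow_one]

lemma constCd_pos (d : ℕ) : 0 < constCd d := by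
  have := constMd_pos d
  have := Gamma_half_pos d
  unfold constCd
  positivity

/-! ### Volumes of Euclidean balls. -/

/-- The volume of the Euclidean unit ball. -/
def ballVol (d : ℕ) : ℝ := √Real.pi ^ d / Real.Gamma ((d : ℝ) / 2 + 1)

lemma ballVol_pos (d : ℕ) : 0 < ballVol d := by
  have := Gamma_half_pos d
  have := Real.pi_pos
  unfold ballVol
  positivity

lemma volume_ball_eq {d : ℕ} (hd : 1 ≤ d) (x : E d) (r : ℝ) :
    volume (Metric.ball x r) = ENNReal.ofReal r ^ d * ENNReal.ofReal (ballVol d) := by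
  have : Nonempty (Fin d) := ⟨⟨0, hd⟩⟩
  simpa [ballVol] using EuclideanSpace.volume_ball (Fin d) x r

lemma volume_closedBall_eq {d : ℕ} (hd : 1 ≤ d) (x : E d) (r : ℝ) :
    volume (Metric.closedBall x r) = ENNReal.ofReal r ^ d * ENNReal.ofReal (ballVol d) := by
  have : Nonempty (Fin d) := ⟨⟨0, hd⟩⟩
  simpa [ballVol] using EuclideanSpace.volume_closedBall (Fin d) x r

lemma volume_real_closedBall {d : ℕ} (hd : 1 ≤ d) (x : E d) {r : ℝ} (hr : 0 ≤ r) :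
    volume.real (Metric.closedBall x r) = r ^ d * ballVol d := by
  rw [Measure.real, volume_closedBall_eq hd, ENNReal.toReal_mul, ENNReal.toReal_pow,
    ENNReal.toReal_ofReal hr, ENNReal.toReal_ofReal (ballVol_pos d).le]

/-! ### The kernel -/

namespace IsKernel

variable {d : ℕ} {Φ : E d → ℝ} {τ cΦ CΦ : ℝ}

lemma tau_pos (hΦ : IsKernel Φ τ cΦ CΦ) : 0 < τ :=
  lt_of_le_of_lt (by positivity) hΦ.tau_gt

lemma map_neg (hΦ : IsKernel Φ τ cΦ CΦ) (x : E d) : Φ (-x) = Φ x := by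
  obtain ⟨φ, h⟩ := hΦ.radial
  rw [h, h, norm_neg]

lemma eq_zero_of_one_lt (hΦ : IsKernel Φ τ cΦ CΦ) {x : E d} (hx : 1 < ‖x‖) : Φ x = 0 := by
  by_contra h
  have := hΦ.support_subset h
  rw [mem_closedBall_zero_iff] at this
  linarith

/-- Continuity along the ray through `x` extends the vanishing to the unit sphere. Including the
sphere makes the level matrix diagonal already for `δ = 2q`. -/
lemma eq_zero_of_one_le (hΦ : IsKernel Φ τ cΦ CΦ) {x : E d} (hx : 1 ≤ ‖x‖) : Φ x = 0 := by
  have h1 : Filter.Tendsto (fun t : ℝ => Φ (t • x)) (nhdsWithin 1 (Set.Ioi 1)) (nhds (Φ ((1 : ℝ) • x))) :=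
    ((hΦ.cont.comp (by fun_prop : Continuous fun t : ℝ => t • x)).tendsto 1).mono_left
      nhdsWithin_le_nhds
  have h2 : Filter.Tendsto (fun t : ℝ => Φ (t • x)) (nhdsWithin 1 (Set.Ioi 1)) (nhds 0) := by
    refine tendsto_const_nhds.congr' ?_
    filter_upwards [self_mem_nhdsWithin] with t ht
    refine (hΦ.eq_zero_of_one_lt ?_).symm
    rw [norm_smul, Real.norm_of_nonneg (by linarith [Set.mem_Ioi.1 ht])]
    nlinarith [Set.mem_Ioi.1 ht]
  rw [one_smul] at h1
  exact tendsto_nhds_unique h1 h2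

lemma hasCompactSupport (hΦ : IsKernel Φ τ cΦ CΦ) : HasCompactSupport Φ :=
  HasCompactSupport.intro (isCompact_closedBall 0 1) fun x hx => by
    by_contra h
    exact hx (hΦ.support_subset h)

lemma integrable (hΦ : IsKernel Φ τ cΦ CΦ) : Integrable Φ :=
  hΦ.cont.integrable_of_hasCompactSupport hΦ.hasCompactSupport

end IsKernel

/-- The real part of Mathlib's Fourier transform of `Φ`. -/
def kernelF {d : ℕ} (Φ : E d → ℝ) (ξ : E d) : ℝ := (𝓕 (fun x : E d => (Φ x : ℂ)) ξ).re

namespace IsKernel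

variable {d : ℕ} {Φ : E d → ℝ} {τ cΦ CΦ : ℝ}

/-- A radial function is even, so the transform of the real function `Φ` equals its own conjugate.
Bounds for the real part thus control the whole transform. -/
lemma fourier_eq (hΦ : IsKernel Φ τ cΦ CΦ) (ξ : E d) :
    𝓕 (fun x : E d => (Φ x : ℂ)) ξ = (kernelF Φ ξ : ℂ) := by
  have key : (starRingEnd ℂ) (𝓕 (fun x : E d => (Φ x : ℂ)) ξ) = 𝓕 (fun x : E d => (Φ x : ℂ)) ξ := by
    rw [Real.fourier_eq', ← integral_conj, ← integral_neg_eq_self]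
    congr 1; ext v
    rw [smul_eq_mul, smul_eq_mul, map_mul, Complex.conj_ofReal, hΦ.map_neg, ← Complex.exp_conj]
    congr 2
    simp
    exact Or.inl (map_ofNat _ 2)
  exact (Complex.conj_eq_iff_re.1 key).symm

lemma re_unitaryFourier (ω : E d) :
    (unitaryFourier Φ ω).re = (2 * Real.pi) ^ (-(d : ℝ) / 2) * kernelF Φ ((2 * Real.pi)⁻¹ • ω) := by
  rw [unitaryFourier, Complex.re_ofReal_mul, kernelF]

lemma kernelF_eq (ξ : E d) :
    kernelF Φ ξ = (2 * Real.pi) ^ ((d : ℝ) / 2) * (unitaryFourier Φ ((2 * Real.pi) • ξ)).re := by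
  have hpi : (0 : ℝ) < 2 * Real.pi := by positivity
  rw [re_unitaryFourier, smul_smul, inv_mul_cancel₀ hpi.ne', one_smul, ← mul_assoc,
    ← Real.rpow_add hpi]
  ring_nf
  simp

lemma kernelF_lower (hΦ : IsKernel Φ τ cΦ CΦ) (ξ : E d) :
    (2 * Real.pi) ^ ((d : ℝ) / 2) * (cΦ * (1 + (2 * Real.pi * ‖ξ‖) ^ 2) ^ (-τ)) ≤ kernelF Φ ξ := by
  rw [kernelF_eq]
  have h := hΦ.lower ((2 * Real.pi) • ξ)
  rw [norm_smul, Real.norm_of_nonneg (by positivity : (0 : ℝ) ≤ 2 * Real.pi)] at h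
  gcongr

lemma kernelF_upper (hΦ : IsKernel Φ τ cΦ CΦ) (ξ : E d) :
    kernelF Φ ξ ≤ (2 * Real.pi) ^ ((d : ℝ) / 2) * (CΦ * (1 + (2 * Real.pi * ‖ξ‖) ^ 2) ^ (-τ)) := by
  rw [kernelF_eq]
  have h := hΦ.upper ((2 * Real.pi) • ξ)
  rw [norm_smul, Real.norm_of_nonneg (by positivity : (0 : ℝ) ≤ 2 * Real.pi)] at h
  gcongr

lemma kernelF_nonneg (hΦ : IsKernel Φ τ cΦ CΦ) (ξ : E d) : 0 ≤ kernelF Φ ξ := by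
  refine le_trans ?_ (hΦ.kernelF_lower ξ)
  have := hΦ.c_pos
  positivity

lemma continuous_kernelF (hΦ : IsKernel Φ τ cΦ CΦ) : Continuous (kernelF Φ) :=
  Complex.continuous_re.comp (VectorFourier.fourierIntegral_continuous Real.continuous_fourierChar
    (by exact continuous_inner) hΦ.integrable.ofReal)

/-- The upper bound decays like `‖ξ‖^(-2τ)` with `2τ > d`. Integrability is what pointwise Fourier
inversion of `Φ` requires. -/
lemma integrable_kernelF (hΦ : IsKernel Φ τ cΦ CΦ) : Integrable (kernelF Φ) := by
  have h1 : Integrable fun x : E d => (1 + ‖x‖ ^ 2) ^ (-(2 * τ) / 2) :=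
    integrable_rpow_neg_one_add_norm_sq (by simpa using by linarith [hΦ.tau_gt])
  have h2 := (h1.comp_smul (R := 2 * Real.pi) (by positivity)).const_mul CΦ |>.const_mul
    ((2 * Real.pi) ^ ((d : ℝ) / 2))
  refine h2.mono' hΦ.continuous_kernelF.aestronglyMeasurable (.of_forall fun ξ => ?_)
  rw [Real.norm_of_nonneg (hΦ.kernelF_nonneg ξ)]
  refine (hΦ.kernelF_upper ξ).trans_eq ?_
  rw [norm_smul, Real.norm_of_nonneg (by positivity : (0 : ℝ) ≤ 2 * Real.pi)]
  congr 3
  ring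

lemma eq_integral_cos (hΦ : IsKernel Φ τ cΦ CΦ) (x : E d) :
    Φ x = ∫ ξ, kernelF Φ ξ * Real.cos (2 * Real.pi * inner ℝ x ξ) := by
  have hfun : 𝓕 (fun x : E d => (Φ x : ℂ)) = fun ξ => (kernelF Φ ξ : ℂ) := funext hΦ.fourier_eq
  have hint : Integrable (𝓕 (fun x : E d => (Φ x : ℂ))) := by
    rw [hfun]; exact hΦ.integrable_kernelF.ofReal
  have h := congrFun (Continuous.fourierInv_fourier_eq (Complex.continuous_ofReal.comp hΦ.cont)
    hΦ.integrable.ofReal hint) x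
  rw [Real.fourierInv_eq'] at h
  have h2 : Integrable fun ξ : E d =>
      Complex.exp (((2 * Real.pi * inner ℝ ξ x : ℝ) : ℂ) * Complex.I) * (kernelF Φ ξ : ℂ) := by
    refine hΦ.integrable_kernelF.ofReal.bdd_mul (c := 1) (by fun_prop) (.of_forall fun u => ?_)
    rw [Complex.norm_exp]
    simp
  have h3 := integral_re h2
  have h4 : ∫ ξ : E d, Complex.exp (((2 * Real.pi * inner ℝ ξ x : ℝ) : ℂ) * Complex.I) *
      (kernelF Φ ξ : ℂ) = Φ x := by
    rw [← Function.comp_apply (f := Complex.ofReal) (g := Φ), ← h]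
    congr 1; ext ξ
    rw [smul_eq_mul]
    congr 1
    exact (hΦ.fourier_eq ξ).symm
  rw [h4] at h3
  change _ = Φ x at h3
  rw [← h3]
  congr 1; ext ξ
  change (Complex.exp _ * _).re = _
  rw [Complex.re_mul_ofReal, Complex.exp_ofReal_mul_I_re, mul_comm, real_inner_comm]

variable {ι : Type*} [Fintype ι]

lemma quadForm_eq (hΦ : IsKernel Φ τ cΦ CΦ) (c : ι → ℝ) (y : ι → E d) :
    ∑ j, ∑ k, c j * c k * Φ (y j - y k) = ∫ ξ, kernelF Φ ξ * expSumSq c y ξ := by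
  have hi : ∀ j k, Integrable fun ξ => c j * c k *
      (kernelF Φ ξ * Real.cos (2 * Real.pi * inner ℝ (y j - y k) ξ)) := fun j k => by
    refine Integrable.const_mul (hΦ.integrable_kernelF.mul_bdd (c := 1) (by fun_prop)
      (.of_forall fun η => ?_)) _
    exact Real.abs_cos_le_one _
  have h1 : ∀ ξ, kernelF Φ ξ * expSumSq c y ξ = ∑ j, ∑ k, c j * c k *
      (kernelF Φ ξ * Real.cos (2 * Real.pi * inner ℝ (y j - y k) ξ)) := fun ξ => by
    rw [expSumSq_eq, Finset.mul_sum]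
    refine Finset.sum_congr rfl fun j _ => ?_
    rw [Finset.mul_sum]
    refine Finset.sum_congr rfl fun k _ => ?_
    ring
  simp_rw [h1]
  rw [integral_finsetSum _ fun j _ => integrable_finsetSum _ fun k _ => hi j k]
  refine Finset.sum_congr rfl fun j _ => ?_
  rw [integral_finsetSum _ fun k _ => hi j k]
  refine Finset.sum_congr rfl fun k _ => ?_
  rw [integral_const_mul, hΦ.eq_integral_cos]

lemma mul_setIntegral_expSumSq_le_quadForm (hΦ : IsKernel Φ τ cΦ CΦ) (c : ι → ℝ) (y : ι → E d)
    {ρ : ℝ} :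
    (2 * Real.pi) ^ ((d : ℝ) / 2) * (cΦ * (1 + (2 * Real.pi * ρ) ^ 2) ^ (-τ)) *
        ∫ ξ in Metric.closedBall (0 : E d) ρ, expSumSq c y ξ ≤
      ∑ j, ∑ k, c j * c k * Φ (y j - y k) := by
  have hint : Integrable fun ξ => kernelF Φ ξ * expSumSq c y ξ := by
    simpa using integrable_mul_expSumSq hΦ.integrable_kernelF c y 0
  rw [hΦ.quadForm_eq, ← integral_const_mul]
  refine le_trans ?_ (setIntegral_le_integral (s := Metric.closedBall (0 : E d) ρ) hint
    (.of_forall fun ξ => mul_nonneg (hΦ.kernelF_nonneg ξ) (expSumSq_nonneg _ _ _)))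
  refine setIntegral_mono_on ?_ hint.integrableOn measurableSet_closedBall fun ξ hξ => ?_
  · exact (((continuous_expSumSq c y).continuousOn.integrableOn_compact
      (isCompact_closedBall _ _)).const_mul _)
  · refine mul_le_mul_of_nonneg_right ?_ (expSumSq_nonneg _ _ _)
    refine le_trans ?_ (hΦ.kernelF_lower ξ)
    have hξ' : ‖ξ‖ ≤ ρ := mem_closedBall_zero_iff.1 hξ
    have := hΦ.c_pos
    have h : (1 + (2 * Real.pi * ρ) ^ 2) ^ (-τ) ≤ (1 + (2 * Real.pi * ‖ξ‖) ^ 2) ^ (-τ) :=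
      Real.rpow_le_rpow_of_nonpos (by positivity) (by gcongr) (by linarith [hΦ.tau_pos])
    gcongr

end IsKernel

/-! ### Coercivity of the kernel quadratic form at separated points. -/

lemma setIntegral_expSumSq_lower {d : ℕ} (hd : 1 ≤ d) {ι : Type*} [Fintype ι] (c : ι → ℝ)
    {y : ι → E d} {s : ℝ} (hs : 0 < s) (hy : ∀ j k, j ≠ k → 2 * s ≤ ‖y j - y k‖) :
    1 / 2 * (constMd d / (4 * Real.pi * s)) ^ d * ballVol d * ∑ j, c j ^ 2 ≤
      ∫ ξ in Metric.closedBall (0 : E d) (constMd d / (Real.pi * s)), expSumSq c y ξ := by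
  have hd0 : (0 : ℝ) < d := by exact_mod_cast hd
  have hsd : 0 < √(d : ℝ) := Real.sqrt_pos.2 hd0
  have hM := constMd_pos d
  have hpi := Real.pi_pos
  -- Dilation by `t⁻¹` turns the separation `2s` into the `2√d` of `ingham`.
  set t := s / √d with ht
  have ht0 : 0 < t := by positivity
  set ρ := constMd d / (Real.pi * s) with hρ
  have hρ0 : 0 < ρ := by positivity
  have hsep : ∀ j k, j ≠ k → 2 * √d ≤ ‖t⁻¹ • y j - t⁻¹ • y k‖ := by
    intro j k hjk
    rw [← smul_sub, norm_smul, norm_inv, Real.norm_of_nonneg ht0.le, ← div_eq_inv_mul,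
      le_div_iff₀ ht0, ht]
    calc 2 * √d * (s / √d) = 2 * s := by field_simp
      _ ≤ _ := hy j k hjk
  have h1 := ingham hd c hsep (t * ρ - inghamRadius d)
  rw [sub_add_cancel] at h1
  have h2 : ∫ ξ in Metric.closedBall (0 : E d) ρ, expSumSq c y ξ =
      (t ^ d)⁻¹ * ∫ ξ in Metric.closedBall (0 : E d) (t * ρ), expSumSq c (fun j => t⁻¹ • y j) ξ := by
    have h := Measure.setIntegral_comp_smul_of_pos (volume : Measure (E d))
      (expSumSq c (fun j => t⁻¹ • y j)) (Metric.closedBall (0 : E d) ρ) ht0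
    rw [smul_closedBall _ _ hρ0.le, smul_zero, Real.norm_of_nonneg ht0.le, smul_eq_mul] at h
    simp only [finrank_euclideanSpace, Fintype.card_fin] at h
    rw [← h]
    congr 1; ext ξ
    simp only [expSumSq, inner_smul_left, inner_smul_right]
    simp [mul_inv_cancel_left₀ ht0.ne']
  -- At least a quarter of the radius remains for the averaging ball. This quarter is the `4` in
  -- `(M_d / (4πs))^d`.
  have h3 : inghamRadius d ≤ 3 / 4 * (t * ρ) := by
    have e1 : t * ρ = constMd d / (Real.pi * √d) := by
      rw [ht, hρ]; field_simp
    have e2 : inghamRadius d = √6 * d / (2 * Real.pi * √d) := by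
      rw [inghamRadius, Real.sqrt_mul (by norm_num)]
      field_simp
      rw [Real.sq_sqrt hd0.le]
    rw [e1, e2]
    have h6 : √(6 : ℝ) ≤ 2.45 := Real.sqrt_le_iff.2 (by norm_num)
    have h7 := le_constMd d
    rw [show 3 / 4 * (constMd d / (Real.pi * √d)) = (3 / 2 * constMd d) / (2 * Real.pi * √d) by
      field_simp; norm_num]
    refine div_le_div_of_nonneg_right ?_ (by positivity)
    nlinarith [mul_le_mul_of_nonneg_right h6 hd0.le]
  have h4 : (t * ρ / 4) ^ d * ballVol d ≤ volume.real (Metric.closedBall (0 : E d) (t * ρ - inghamRadius d)) := by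
    rw [volume_real_closedBall hd _ (by nlinarith [mul_pos ht0 hρ0])]
    have := ballVol_pos d
    gcongr
    linarith
  have h5 : 0 ≤ ∑ j, c j ^ 2 := Finset.sum_nonneg fun j _ => sq_nonneg _
  rw [h2]
  calc 1 / 2 * (constMd d / (4 * Real.pi * s)) ^ d * ballVol d * ∑ j, c j ^ 2
      = (t ^ d)⁻¹ * (1 / 2 * ((t * ρ / 4) ^ d * ballVol d) * ∑ j, c j ^ 2) := by
        have : constMd d / (4 * Real.pi * s) = ρ / 4 := by rw [hρ]; field_simp
        rw [this, mul_div_assoc, mul_pow]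
        field_simp
    _ ≤ (t ^ d)⁻¹ * (1 / 2 * volume.real (Metric.closedBall (0 : E d) (t * ρ - inghamRadius d)) *
          ∑ j, c j ^ 2) := by gcongr
    _ ≤ _ := by gcongr

/-- On frequencies of norm at most `M_d / (πs)` the lower bound for the transform is at least its
value at that radius, which produces `1 + 4 M_d² / s²`. The remaining powers of `2` and `π` combine
to `C_d`. -/
theorem IsKernel.quadForm_lower {d : ℕ} (hd : 1 ≤ d) {Φ : E d → ℝ} {τ cΦ CΦ : ℝ}
    (hΦ : IsKernel Φ τ cΦ CΦ) {ι : Type*} [Fintype ι] (c : ι → ℝ)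
    {y : ι → E d} {s : ℝ} (hs : 0 < s) (hy : ∀ j k, j ≠ k → 2 * s ≤ ‖y j - y k‖) :
    (s ^ d)⁻¹ * (constCd d * cΦ) * (1 + 4 * constMd d ^ 2 / s ^ 2) ^ (-τ) * ∑ j, c j ^ 2 ≤
      ∑ j, ∑ k, c j * c k * Φ (y j - y k) := by
  refine le_trans ?_ (hΦ.mul_setIntegral_expSumSq_le_quadForm c y (ρ := constMd d / (Real.pi * s)))
  have hpi := Real.pi_pos
  have h1 : (2 * Real.pi * (constMd d / (Real.pi * s))) ^ 2 = 4 * constMd d ^ 2 / s ^ 2 := by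
    field_simp; ring
  have h2 : (2 * Real.pi) ^ ((d : ℝ) / 2) * (1 / 2 * (constMd d / (4 * Real.pi * s)) ^ d * ballVol d) =
      (s ^ d)⁻¹ * constCd d := by
    have e1 : (2 * Real.pi) ^ ((d : ℝ) / 2) = √(2 * Real.pi) ^ d := by
      rw [Real.sqrt_eq_rpow, ← Real.rpow_natCast (_ ^ _), ← Real.rpow_mul (by positivity)]
      congr 1; ring
    have e2 : (2 : ℝ) ^ ((3 : ℝ) / 2) = 2 * √2 := by
      rw [Real.sqrt_eq_rpow, show (3 : ℝ) / 2 = 1 + 1 / 2 by norm_num, Real.rpow_add (by norm_num),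
        Real.rpow_one]
    have e3 : √(2 * Real.pi) * (constMd d / (4 * Real.pi * s)) * √Real.pi =
        s⁻¹ * (constMd d / (2 * √2)) := by
      rw [Real.sqrt_mul (by norm_num)]
      have h3 : √Real.pi * √Real.pi = Real.pi := Real.mul_self_sqrt hpi.le
      have h4 : √(2 : ℝ) * √2 = 2 := Real.mul_self_sqrt (by norm_num)
      field_simp
      linear_combination (2 * constMd d * Real.pi) * h4 + 2 * constMd d * √2 ^ 2 * h3
    rw [e1, constCd, e2, ballVol]
    calc _ = (√(2 * Real.pi) * (constMd d / (4 * Real.pi * s)) * √Real.pi) ^ d *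
          (1 / (2 * Real.Gamma ((d : ℝ) / 2 + 1))) := by
          rw [mul_pow, mul_pow]; ring
      _ = _ := by rw [e3, mul_pow, inv_pow]; ring
  rw [h1]
  calc (s ^ d)⁻¹ * (constCd d * cΦ) * (1 + 4 * constMd d ^ 2 / s ^ 2) ^ (-τ) * ∑ j, c j ^ 2
      = (s ^ d)⁻¹ * constCd d * (cΦ * (1 + 4 * constMd d ^ 2 / s ^ 2) ^ (-τ) * ∑ j, c j ^ 2) := by ring
    _ = (2 * Real.pi) ^ ((d : ℝ) / 2) * (cΦ * (1 + 4 * constMd d ^ 2 / s ^ 2) ^ (-τ)) *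
        (1 / 2 * (constMd d / (4 * Real.pi * s)) ^ d * ballVol d * ∑ j, c j ^ 2) := by
        rw [← h2]; ring
    _ ≤ _ := by
        refine mul_le_mul_of_nonneg_left (setIntegral_expSumSq_lower hd c hs hy) ?_
        have := hΦ.c_pos
        positivity

/-! ### Estimates for the constants -/

namespace IsKernel

variable {d : ℕ} {Φ : E d → ℝ} {τ cΦ CΦ : ℝ}

/-- At frequency zero the transform is at most `(2π)^(-d/2) ∫ |Φ|`, and `|Φ| ≤ 1` lives on the unit
ball. This limits `cΦ` and thereby keeps `K` away from zero. -/
lemma cΦ_le (hΦ : IsKernel Φ τ cΦ CΦ) (hd : 1 ≤ d) :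
    cΦ ≤ (2 * Real.pi) ^ (-(d : ℝ) / 2) * ballVol d := by
  have h := hΦ.lower 0
  simp only [norm_zero, ne_eq, OfNat.ofNat_ne_zero, not_false_eq_true, zero_pow, add_zero,
    Real.one_rpow, mul_one] at h
  refine h.trans ?_
  rw [re_unitaryFourier]
  gcongr
  have h1 : ‖𝓕 (fun x : E d => (Φ x : ℂ)) ((2 * Real.pi)⁻¹ • (0 : E d))‖ ≤ ∫ x, ‖(Φ x : ℂ)‖ :=
    VectorFourier.norm_fourierIntegral_le_integral_norm _ _ _ _ _
  refine (Complex.re_le_norm _).trans (h1.trans ?_)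
  simp_rw [Complex.norm_real]
  calc ∫ x, ‖Φ x‖ ≤ ∫ x, (Metric.closedBall (0 : E d) 1).indicator (fun _ => (1 : ℝ)) x := by
        refine integral_mono hΦ.integrable.norm ((integrable_indicator_iff measurableSet_closedBall).2
          (integrableOn_const measure_closedBall_lt_top.ne)) fun x => ?_
        by_cases hx : x ∈ Metric.closedBall (0 : E d) 1
        · rw [Set.indicator_of_mem hx]
          exact hΦ.abs_le_one x
        · rw [Set.indicator_of_notMem hx]
          have : Φ x = 0 := by
            by_contra h0
            exact hx (hΦ.support_subset h0)
          simp [this]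
    _ = ballVol d := by
        rw [integral_indicator measurableSet_closedBall, setIntegral_const,
          volume_real_closedBall hd _ zero_le_one]
        simp

lemma inv_le_constK (hΦ : IsKernel Φ τ cΦ CΦ) (cq ν : ℝ) :
    (constCd d * cΦ)⁻¹ ≤ constK d τ cΦ cq ν := by
  have h1 := constCd_pos d
  have h2 := hΦ.c_pos
  rw [constK]
  refine le_mul_of_one_le_right (by positivity) (Real.one_le_rpow ?_ hΦ.tau_pos.le)
  have : 0 ≤ 4 * constMd d ^ 2 * ν ^ 2 * cq ^ 2 := by positivity
  linarith

lemma constK_pos (hΦ : IsKernel Φ τ cΦ CΦ) (cq ν : ℝ) : 0 < constK d τ cΦ cq ν := by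
  have h1 := constCd_pos d
  have h2 := hΦ.c_pos
  exact lt_of_lt_of_le (by positivity) (hΦ.inv_le_constK cq ν)

/-- The formula for `M_d^(d+1)` eliminates `Γ²`, and the leftover factor `M_d / π` is at least one.
The bound yields `z ≥ 2` and, later, `(2 c_q)^d ≤ C C_Σ`. -/
lemma le_constK (hΦ : IsKernel Φ τ cΦ CΦ) (hd : 1 ≤ d) (cq ν : ℝ) :
    3 / 2 * (3 ^ d)⁻¹ ≤ constK d τ cΦ cq ν := by
  refine le_trans ?_ (hΦ.inv_le_constK cq ν)
  have hC := constCd_pos d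
  have hc := hΦ.c_pos
  have hM := constMd_pos d
  have hG := Gamma_half_pos d
  have hpi := Real.pi_pos
  set G := Real.Gamma ((d : ℝ) / 2 + 1) with hGdef
  rw [le_inv_comm₀ (by positivity) (by positivity)]
  have h1 : constCd d * cΦ ≤ constMd d ^ d * (4 ^ d)⁻¹ / (2 * G ^ 2) := by
    refine (mul_le_mul_of_nonneg_left (hΦ.cΦ_le hd) hC.le).trans_eq ?_
    have e1 : (2 * Real.pi) ^ (-(d : ℝ) / 2) = (√(2 * Real.pi) ^ d)⁻¹ := by
      rw [neg_div, Real.rpow_neg (by positivity), Real.sqrt_eq_rpow, ← Real.rpow_natCast (_ ^ _),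
        ← Real.rpow_mul (by positivity)]
      congr 2; ring
    have e2 : (2 : ℝ) ^ ((3 : ℝ) / 2) = 2 * √2 := by
      rw [Real.sqrt_eq_rpow, show (3 : ℝ) / 2 = 1 + 1 / 2 by norm_num, Real.rpow_add (by norm_num),
        Real.rpow_one]
    have h4 : √(2 : ℝ) * √2 = 2 := Real.mul_self_sqrt (by norm_num)
    have e3 : constMd d / (2 * √2) * (√(2 * Real.pi))⁻¹ * √Real.pi = constMd d * 4⁻¹ := by
      rw [Real.sqrt_mul (by norm_num)]
      field_simp
      linear_combination (-2) * h4
    rw [e1, constCd, e2, ballVol, ← hGdef]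
    calc _ = (constMd d / (2 * √2) * (√(2 * Real.pi))⁻¹ * √Real.pi) ^ d * (1 / (2 * G ^ 2)) := by
          rw [mul_pow, mul_pow, inv_pow]
          field_simp
      _ = _ := by rw [e3, mul_pow, inv_pow]; ring
  refine h1.trans ?_
  have h2 := constMd_pow d
  have h3 : 10 / 3 ≤ constMd d := by
    have := le_constMd d
    have : (1 : ℝ) ≤ d := by exact_mod_cast hd
    linarith
  rw [← hGdef] at h2
  have h5 : G ^ 2 = constMd d ^ (d + 1) * 9 / (12 ^ (d + 1) * Real.pi) := by
    rw [h2]; field_simp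
  rw [div_le_iff₀ (by positivity), h5, mul_inv, inv_inv]
  have e12 : (12 : ℝ) ^ (d + 1) = 12 * 3 ^ d * 4 ^ d := by
    rw [pow_succ, show (12 : ℝ) = 3 * 4 by norm_num, mul_pow]; ring
  rw [e12]
  have h6 : 2 / 3 * 3 ^ d * (2 * (constMd d ^ (d + 1) * 9 / (12 * 3 ^ d * 4 ^ d * Real.pi))) =
      (constMd d ^ d * (4 ^ d)⁻¹) * (constMd d / Real.pi) := by
    field_simp
    ring
  rw [show ((3 : ℝ) / 2)⁻¹ = 2 / 3 by norm_num, h6]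
  refine le_mul_of_one_le_right (by positivity) ?_
  rw [le_div_iff₀ hpi]
  linarith [Real.pi_lt_d2]

lemma two_le_constZ (hΦ : IsKernel Φ τ cΦ CΦ) (hd : 1 ≤ d) (cq ν : ℝ) :
    2 ≤ constZ d τ cΦ cq ν := by
  have h := hΦ.le_constK hd cq ν
  rw [constZ]
  have h1 : (4 / 3 : ℝ) ≤ (4 / 3) ^ d := le_self_pow₀ (by norm_num) (by omega)
  calc (2 : ℝ) ≤ 3 / 2 * (4 / 3) ^ d := by linarith
    _ = 4 ^ d * (3 / 2 * (3 ^ d)⁻¹) := by rw [div_pow]; ring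
    _ ≤ _ := by gcongr

end IsKernel

/-- The convergence factor `(√z - 1) / (√z + 1)`. -/
def rate (z : ℝ) : ℝ := (√z - 1) / (√z + 1)

lemma one_lt_sqrt_of_two_le {z : ℝ} (hz : 2 ≤ z) : 7 / 5 ≤ √z :=
  Real.le_sqrt_of_sq_le (by norm_num; linarith)

lemma rate_lower {z : ℝ} (hz : 2 ≤ z) : 1 / 6 ≤ rate z := by
  have := one_lt_sqrt_of_two_le hz
  rw [rate, le_div_iff₀ (by linarith)]
  linarith

lemma rate_pos {z : ℝ} (hz : 2 ≤ z) : 0 < rate z := lt_of_lt_of_le (by norm_num) (rate_lower hz)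

lemma rate_lt_one {z : ℝ} (hz : 2 ≤ z) : rate z < 1 := by
  have := one_lt_sqrt_of_two_le hz
  rw [rate, div_lt_one (by linarith)]
  linarith

lemma neg_two_le_log_rate {z : ℝ} (hz : 2 ≤ z) : -2 ≤ Real.log (rate z) := by
  rw [Real.le_log_iff_exp_le (rate_pos hz)]
  refine le_trans ?_ (rate_lower hz)
  have : Real.exp 2 = Real.exp 1 * Real.exp 1 := by rw [← Real.exp_add]; norm_num
  rw [Real.exp_neg, one_div]
  refine inv_anti₀ (by norm_num) ?_
  rw [this]
  nlinarith [Real.exp_one_gt_d9]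

lemma four_le_constR {d : ℕ} (hd : 1 ≤ d) (cq ν : ℝ) : 4 ≤ constR d cq ν := by
  have h1 : (1 : ℝ) ≤ √d := Real.one_le_sqrt.2 (by exact_mod_cast hd)
  rw [constR]
  have h2 : 4 ≤ max (cq * ν) 4 := le_max_right _ _
  nlinarith

namespace IsKernel

variable {d : ℕ} {Φ : E d → ℝ} {τ cΦ CΦ : ℝ}

lemma constTheta_pos (hΦ : IsKernel Φ τ cΦ CΦ) (hd : 1 ≤ d) (cq ν : ℝ) :
    0 < constTheta d τ cΦ cq ν := by
  have hz := hΦ.two_le_constZ hd cq ν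
  have hR := four_le_constR hd cq ν
  have h := Real.log_neg (rate_pos hz) (rate_lt_one hz)
  rw [constTheta]
  change 0 < -(1 / (2 * constR d cq ν)) * Real.log (rate _)
  exact mul_pos_of_neg_of_neg (neg_neg_of_pos (by positivity)) h

/-- From `z ≥ 2` the logarithm of the rate is at least `-2`, and `R ≥ 4`. An upper bound for `θ` is
needed to bound `C_Σ` from below and to force `T ≥ 2`. -/
lemma constTheta_le (hΦ : IsKernel Φ τ cΦ CΦ) (hd : 1 ≤ d) (cq ν : ℝ) :
    constTheta d τ cΦ cq ν ≤ 1 / 4 := by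
  have hz := hΦ.two_le_constZ hd cq ν
  have hR := four_le_constR hd cq ν
  have h := neg_two_le_log_rate hz
  rw [constTheta]
  change -(1 / (2 * constR d cq ν)) * Real.log (rate _) ≤ _
  rw [neg_mul, ← mul_neg, one_div_mul_eq_div, div_le_iff₀ (by positivity)]
  linarith

lemma exp_constTheta (hΦ : IsKernel Φ τ cΦ CΦ) (hd : 1 ≤ d) (cq ν : ℝ) :
    Real.exp (-(2 * constR d cq ν * constTheta d τ cΦ cq ν)) = rate (constZ d τ cΦ cq ν) := by
  have hz := hΦ.two_le_constZ hd cq ν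
  have hR := four_le_constR hd cq ν
  have : -(2 * constR d cq ν * constTheta d τ cΦ cq ν) = Real.log (rate (constZ d τ cΦ cq ν)) := by
    rw [constTheta, rate]
    field_simp
  rw [this, Real.exp_log (rate_pos hz)]

lemma summable_constCSigma (hΦ : IsKernel Φ τ cΦ CΦ) (hd : 1 ≤ d) (cq ν : ℝ) :
    Summable fun m : ℕ => ((m : ℝ) + 2) ^ d * Real.exp (-constTheta d τ cΦ cq ν * m) := by
  have hθ := hΦ.constTheta_pos hd cq ν
  set θ := constTheta d τ cΦ cq ν
  have h := ((summable_nat_add_iff 2).2 (Real.summable_pow_mul_exp_neg_nat_mul d hθ)).mul_right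
    (Real.exp (2 * θ))
  refine h.congr fun m => ?_
  rw [mul_assoc, ← Real.exp_add]
  push_cast
  congr 2
  ring

lemma le_constCSigma (hΦ : IsKernel Φ τ cΦ CΦ) (hd : 1 ≤ d) (cq ν : ℝ) :
    6 ^ d / 3 ≤ constCSigma d τ cΦ cq ν := by
  -- The single term `m = 4` suffices: its power is `6^d`, and `4θ ≤ 1` makes its exponential at
  -- least `e⁻¹ ≥ 1/3`.
  have h := (hΦ.summable_constCSigma hd cq ν).le_tsum 4 fun m _ => by positivity
  refine le_trans ?_ h
  have hθ := hΦ.constTheta_le hd cq ν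
  have h1 : Real.exp (-1) ≤ Real.exp (-constTheta d τ cΦ cq ν * (4 : ℕ)) := by
    apply Real.exp_le_exp.2
    push_cast
    linarith
  have h2 : (1 : ℝ) / 3 ≤ Real.exp (-1) := by
    rw [Real.exp_neg, one_div]
    exact inv_anti₀ (Real.exp_pos _) (by linarith [Real.exp_one_lt_d9])
  calc (6 : ℝ) ^ d / 3 = 6 ^ d * (1 / 3) := by ring
    _ ≤ (((4 : ℕ) : ℝ) + 2) ^ d * Real.exp (-constTheta d τ cΦ cq ν * (4 : ℕ)) := by
      norm_num only [Nat.cast_ofNat]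
      push_cast at h1
      gcongr
      linarith

lemma le_constC (hΦ : IsKernel Φ τ cΦ CΦ) (hd : 1 ≤ d) {cq ν : ℝ} (hcq : 0 ≤ cq) (hν : 0 < ν) :
    2 * constK d τ cΦ cq ν * Real.exp (cq * ν * constTheta d τ cΦ cq ν) * (1 + ν * cq) ^ d * (ν ^ d)⁻¹ ≤
      constC d τ cΦ cq ν := by
  have hK := hΦ.constK_pos cq ν
  have hθ := hΦ.constTheta_pos hd cq ν
  rw [constC]
  have h1 : 1 ≤ Real.exp (2 * constTheta d τ cΦ cq ν * √d) := Real.one_le_exp (by positivity)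
  gcongr ?_ * _ * _ * ?_
  · exact le_mul_of_one_le_right (by positivity) h1
  · exact le_max_right _ _

/-- The bound `3 · 3^(-d) c_q^d` for `C` meets the bound `6^d / 3` for `C_Σ`. It lets one power of
`b = C C_Σ` absorb the factor `(2 c_q)^d` from the node count. -/
lemma two_mul_pow_le (hΦ : IsKernel Φ τ cΦ CΦ) (hd : 1 ≤ d) {cq ν : ℝ} (hcq : 0 ≤ cq) (hν : 0 < ν) :
    (2 * cq) ^ d ≤ constC d τ cΦ cq ν * constCSigma d τ cΦ cq ν := by
  have hK := hΦ.constK_pos cq ν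
  have hθ := hΦ.constTheta_pos hd cq ν
  have h1 : 3 * (3 ^ d)⁻¹ * cq ^ d ≤ constC d τ cΦ cq ν := by
    refine le_trans ?_ (hΦ.le_constC hd hcq hν)
    have h2 : 1 ≤ Real.exp (cq * ν * constTheta d τ cΦ cq ν) := Real.one_le_exp (by positivity)
    calc 3 * (3 ^ d)⁻¹ * cq ^ d = 2 * (3 / 2 * (3 ^ d)⁻¹) * 1 * (ν * cq) ^ d * (ν ^ d)⁻¹ := by
          rw [mul_pow]; field_simp
      _ ≤ _ := by
          gcongr
          · exact hΦ.le_constK hd cq ν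
          · linarith
  calc (2 * cq) ^ d = (3 * (3 ^ d)⁻¹ * cq ^ d) * (6 ^ d / 3) := by
        rw [mul_pow, show (6 : ℝ) = 2 * 3 by norm_num, mul_pow]; field_simp
    _ ≤ _ := by
        have := hΦ.le_constCSigma hd cq ν
        gcongr
        exact (by positivity : (0 : ℝ) ≤ _).trans h1

end IsKernel

/-! ### Exponential decay of the entries of the inverse of a banded matrix -/

/-- The evaluation point is `cosh u` with `e^(-u) = rate z`, and `T_n (cosh u) = cosh (n u) ≥ e^(n
u) / 2`. -/
lemma half_mul_rate_inv_pow_le {z : ℝ} (hz : 2 ≤ z) (n : ℕ) :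
    1 / 2 * (rate z ^ n)⁻¹ ≤ (Polynomial.Chebyshev.T ℝ n).eval ((z + 1) / (z - 1)) := by
  have hr := rate_pos hz
  have hs := one_lt_sqrt_of_two_le hz
  have h1 : (z + 1) / (z - 1) = Real.cosh (-Real.log (rate z)) := by
    rw [Real.cosh_eq, neg_neg, Real.exp_neg, Real.exp_log hr, rate]
    have hsq : √z ^ 2 = z := Real.sq_sqrt (by linarith)
    have h3 : √z - 1 ≠ 0 := by linarith
    have h4 : √z + 1 ≠ 0 := by linarith
    have h5 : z - 1 ≠ 0 := by linarith
    field_simp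
    linear_combination (2 - 2 * z) * hsq + (2 * z + 2) * hsq
  rw [h1, Polynomial.Chebyshev.T_real_cosh, Real.cosh_eq]
  have h2 : Real.exp ((n : ℤ) * -Real.log (rate z)) = (rate z ^ n)⁻¹ := by
    rw [mul_neg, Real.exp_neg, Int.cast_natCast, Real.exp_nat_mul, Real.exp_log hr]
  rw [h2]
  have := Real.exp_pos (-((n : ℤ) * -Real.log (rate z)))
  linarith

/-- Approximation of `1/t` on `[a, z a]` by the Chebyshev method. -/
lemma exists_polynomial_approx_inv {a z : ℝ} (ha : 0 < a) (hz : 2 ≤ z) (n : ℕ) :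
    ∃ P : Polynomial ℝ, (∀ k, n ≤ k → P.coeff k = 0) ∧
      ∀ t, a ≤ t → t ≤ z * a → |t⁻¹ - P.eval t| ≤ 2 / a * rate z ^ n := by
  have hr := rate_pos hz
  have hz1 : 0 < z - 1 := by linarith
  set y₀ := (z + 1) / (z - 1) with hy₀
  set t₀ := (Polynomial.Chebyshev.T ℝ n).eval y₀ with ht₀
  have ht₀_lower : 1 / 2 * (rate z ^ n)⁻¹ ≤ t₀ := half_mul_rate_inv_pow_le hz n
  have ht₀_pos : 0 < t₀ := lt_of_lt_of_le (by positivity) ht₀_lower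
  -- The affine map with `a ↦ 1`, `z a ↦ -1` and `0 ↦ y₀`.
  set ℓ : Polynomial ℝ := Polynomial.C (-2 / ((z - 1) * a)) * Polynomial.X + Polynomial.C y₀ with hℓ
  -- Normalised to vanish at `0`. So `Q / X` is a polynomial of degree below `n` (zero if `n = 0`),
  -- and its distance to `1/t` is `T_n(ℓ(t)) / (t t₀)`.
  set Q : Polynomial ℝ := 1 - Polynomial.C t₀⁻¹ * (Polynomial.Chebyshev.T ℝ n).comp ℓ with hQ
  have hQdeg : Q.natDegree ≤ n := by
    refine (Polynomial.natDegree_sub_le _ _).trans (max_le (by simp) ?_)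
    refine (Polynomial.natDegree_C_mul_le _ _).trans ?_
    refine Polynomial.natDegree_comp_le.trans ?_
    have h1 : ℓ.natDegree ≤ 1 := Polynomial.natDegree_linear_le
    have h2 : (Polynomial.Chebyshev.T ℝ n).natDegree = n := by
      rw [Polynomial.Chebyshev.natDegree_T]; simp
    rw [h2]
    nlinarith
  have hQ0 : Q.coeff 0 = 0 := by
    rw [Polynomial.coeff_zero_eq_eval_zero, hQ, hℓ]
    simp [Polynomial.eval_comp, ← ht₀, ht₀_pos.ne']
  have hQX : Q.divX * Polynomial.X = Q := by
    have := Polynomial.divX_mul_X_add Q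
    rwa [hQ0, Polynomial.C_0, add_zero] at this
  refine ⟨Q.divX, fun k hk => ?_, fun t hat hta => ?_⟩
  · rw [Polynomial.coeff_divX]
    exact Polynomial.coeff_eq_zero_of_natDegree_lt (by omega)
  · have ht : 0 < t := ha.trans_le hat
    have h1 : Q.divX.eval t * t = 1 - t₀⁻¹ * (Polynomial.Chebyshev.T ℝ n).eval (ℓ.eval t) := by
      have := congrArg (Polynomial.eval t) hQX
      rw [Polynomial.eval_mul, Polynomial.eval_X] at this
      rw [this, hQ]
      simp [Polynomial.eval_comp]
    have h2 : t⁻¹ - Q.divX.eval t = t⁻¹ * (t₀⁻¹ * (Polynomial.Chebyshev.T ℝ n).eval (ℓ.eval t)) := by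
      field_simp at h1 ⊢
      linarith
    have h3 : |ℓ.eval t| ≤ 1 := by
      have : ℓ.eval t = ((z + 1) * a - 2 * t) / ((z - 1) * a) := by
        rw [hℓ, hy₀]
        simp
        field_simp
        ring
      rw [this, abs_le, le_div_iff₀ (by positivity), div_le_iff₀ (by positivity)]
      constructor <;> linarith
    have h4 := Polynomial.Chebyshev.abs_eval_T_real_le_one n h3
    rw [h2, abs_mul, abs_mul, abs_of_pos (inv_pos.2 ht), abs_of_pos (inv_pos.2 ht₀_pos)]
    calc t⁻¹ * (t₀⁻¹ * |(Polynomial.Chebyshev.T ℝ n).eval (ℓ.eval t)|)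
        ≤ a⁻¹ * ((1 / 2 * (rate z ^ n)⁻¹)⁻¹ * 1) := by gcongr
      _ = 2 / a * rate z ^ n := by field_simp

section Banded

variable {ι : Type*} [Fintype ι] [DecidableEq ι] {A : Matrix ι ι ℝ}

lemma pow_apply_eq_zero_of_banded {d : ℕ} {p : ι → E d} {δ : ℝ}
    (hA : ∀ i j, A i j ≠ 0 → ‖p i - p j‖ ≤ δ) :
    ∀ (k : ℕ) (i j : ι), (k : ℝ) * δ < ‖p i - p j‖ → (A ^ k) i j = 0
  | 0, i, j, h => by
    have : i ≠ j := by
      rintro rfl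
      simp at h
    simp [Matrix.one_apply_ne this]
  | k + 1, i, j, h => by
    rw [pow_succ, Matrix.mul_apply]
    refine Finset.sum_eq_zero fun l _ => ?_
    by_cases h0 : A l j = 0
    · rw [h0, mul_zero]
    · have h1 := hA l j h0
      rw [pow_apply_eq_zero_of_banded hA k i l, zero_mul]
      have h2 := norm_sub_le_norm_sub_add_norm_sub (p i) (p l) (p j)
      push_cast at h
      linarith

lemma abs_sum_unitary_le {U : Matrix ι ι ℝ} (hU : U * Uᵀ = 1) {f : ι → ℝ} {B : ℝ} (hB : 0 ≤ B)
    (hf : ∀ k, |f k| ≤ B) (i j : ι) : |(U * Matrix.diagonal f * Uᵀ) i j| ≤ B := by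
  have hrow : ∀ i, ∑ k, U i k ^ 2 = 1 := fun i => by
    have := congrFun (congrFun hU i) i
    rw [Matrix.mul_apply, Matrix.one_apply_eq] at this
    simpa [sq] using this
  rw [Matrix.mul_apply]
  simp only [Matrix.mul_diagonal, Matrix.transpose_apply]
  calc |∑ k, U i k * f k * U j k| ≤ ∑ k, |U i k * f k * U j k| := Finset.abs_sum_le_sum_abs _ _
    _ ≤ ∑ k, B * ((U i k ^ 2 + U j k ^ 2) / 2) := by
        refine Finset.sum_le_sum fun k _ => ?_
        have h1 : |U i k * f k * U j k| = |f k| * (|U i k| * |U j k|) := by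
          rw [abs_mul, abs_mul]; ring
        rw [h1]
        refine mul_le_mul (hf k) ?_ (by positivity) hB
        nlinarith [sq_nonneg (|U i k| - |U j k|), sq_abs (U i k), sq_abs (U j k)]
    _ = B := by
        rw [← Finset.mul_sum, ← Finset.sum_div, Finset.sum_add_distrib, hrow, hrow]
        norm_num

lemma exists_diagonalization (hA : A.IsHermitian) {a b : ℝ}
    (ha : ∀ v : ι → ℝ, a * ∑ i, v i ^ 2 ≤ v ⬝ᵥ A *ᵥ v)
    (hb : ∀ v : ι → ℝ, v ⬝ᵥ A *ᵥ v ≤ b * ∑ i, v i ^ 2) :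
    ∃ (U : Matrix ι ι ℝ) (ev : ι → ℝ), U * Uᵀ = 1 ∧ Uᵀ * U = 1 ∧
      A = U * Matrix.diagonal ev * Uᵀ ∧ ∀ k, a ≤ ev k ∧ ev k ≤ b := by
  refine ⟨hA.eigenvectorUnitary, hA.eigenvalues, ?_, ?_, ?_, fun k => ?_⟩
  · exact Unitary.coe_mul_star_self hA.eigenvectorUnitary
  · exact Unitary.coe_star_mul_self hA.eigenvectorUnitary
  · exact hA.spectral_theorem
  · have h1 := hA.eigenvalues_eq k
    have h2 : ∑ i, (hA.eigenvectorBasis k) i ^ 2 = 1 := by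
      have := hA.eigenvectorBasis.orthonormal.1 k
      rw [EuclideanSpace.norm_eq, Real.sqrt_eq_one] at this
      simpa using this
    have h3 := ha (hA.eigenvectorBasis k)
    have h4 := hb (hA.eigenvectorBasis k)
    rw [h2, mul_one] at h3 h4
    simp only [star_trivial, RCLike.re_to_real] at h1
    rw [h1]
    exact ⟨h3, h4⟩

lemma aeval_conj_diagonal {U : Matrix ι ι ℝ} (hU : U * Uᵀ = 1) (hU' : Uᵀ * U = 1) (f : ι → ℝ)
    (P : Polynomial ℝ) :
    Polynomial.aeval (U * Matrix.diagonal f * Uᵀ) P =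
      U * Matrix.diagonal (fun k => P.eval (f k)) * Uᵀ := by
  have hpow : ∀ n : ℕ, (U * Matrix.diagonal f * Uᵀ) ^ n = U * Matrix.diagonal (fun k => f k ^ n) * Uᵀ := by
    intro n
    induction n with
    | zero => simp [hU]
    | succ n ih =>
      rw [pow_succ, ih]
      calc U * Matrix.diagonal (fun k => f k ^ n) * Uᵀ * (U * Matrix.diagonal f * Uᵀ)
          = U * Matrix.diagonal (fun k => f k ^ n) * (Uᵀ * U) * Matrix.diagonal f * Uᵀ := by
            simp only [Matrix.mul_assoc]
        _ = U * (Matrix.diagonal (fun k => f k ^ n) * Matrix.diagonal f) * Uᵀ := by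
            rw [hU', Matrix.mul_one, Matrix.mul_assoc U]
        _ = _ := by
            rw [Matrix.diagonal_mul_diagonal]
            simp only [pow_succ]
  induction P using Polynomial.induction_on' with
  | add p q hp hq =>
    rw [map_add, hp, hq, ← Matrix.add_mul, ← Matrix.mul_add, Matrix.diagonal_add]
    simp
  | monomial n c =>
    rw [Polynomial.aeval_monomial, hpow, ← Algebra.smul_def, ← Matrix.smul_mul, ← Matrix.mul_smul,
      ← Matrix.diagonal_smul]
    congr 3
    ext k
    simp

/-- The Demko–Moss–Smith estimate: the entries of the inverse of a well conditioned banded symmetric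
matrix decay exponentially. -/
theorem abs_inv_apply_le_of_banded (hA : A.IsHermitian) {a z : ℝ} (ha : 0 < a) (hz : 2 ≤ z)
    (hlow : ∀ v : ι → ℝ, a * ∑ i, v i ^ 2 ≤ v ⬝ᵥ A *ᵥ v)
    (hupp : ∀ v : ι → ℝ, v ⬝ᵥ A *ᵥ v ≤ z * a * ∑ i, v i ^ 2)
    {d : ℕ} {p : ι → E d} {δ : ℝ} (hδ : 0 < δ)
    (hband : ∀ i j, A i j ≠ 0 → ‖p i - p j‖ ≤ δ) (i j : ι) :
    |A⁻¹ i j| ≤ 2 / a * Real.exp (Real.log (rate z) * (‖p i - p j‖ / δ)) := by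
  obtain ⟨U, ev, hU, hU', hAeq, hev⟩ := exists_diagonalization hA hlow hupp
  -- For every `k < n` one has `k δ < ‖p i - p j‖`, so `A ^ k` vanishes at `(i, j)`. There the entry
  -- of the inverse is just the approximation error.
  set n := ⌈‖p i - p j‖ / δ⌉₊ with hn
  obtain ⟨P, hP, hPt⟩ := exists_polynomial_approx_inv ha hz n
  have hr := rate_pos hz
  have hev0 : ∀ k, ev k ≠ 0 := fun k => (ha.trans_le (hev k).1).ne'
  have hinv : A⁻¹ = U * Matrix.diagonal (fun k => (ev k)⁻¹) * Uᵀ := by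
    refine Matrix.inv_eq_right_inv ?_
    rw [hAeq]
    calc U * Matrix.diagonal ev * Uᵀ * (U * Matrix.diagonal (fun k => (ev k)⁻¹) * Uᵀ)
        = U * Matrix.diagonal ev * (Uᵀ * U) * Matrix.diagonal (fun k => (ev k)⁻¹) * Uᵀ := by
          simp only [Matrix.mul_assoc]
      _ = U * (Matrix.diagonal ev * Matrix.diagonal (fun k => (ev k)⁻¹)) * Uᵀ := by
          rw [hU', Matrix.mul_one, Matrix.mul_assoc U]
      _ = 1 := by
          rw [Matrix.diagonal_mul_diagonal]
          simp only [mul_inv_cancel₀ (hev0 _), Matrix.diagonal_one, Matrix.mul_one, hU]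
  have hPA : Polynomial.aeval A P = U * Matrix.diagonal (fun k => P.eval (ev k)) * Uᵀ := by
    rw [hAeq]; exact aeval_conj_diagonal hU hU' ev P
  have hzero : (Polynomial.aeval A P) i j = 0 := by
    rw [Polynomial.aeval_eq_sum_range, Matrix.sum_apply]
    refine Finset.sum_eq_zero fun k _ => ?_
    rw [Matrix.smul_apply]
    rcases le_or_gt n k with h | h
    · rw [hP k h, zero_smul]
    · rw [pow_apply_eq_zero_of_banded hband k i j, smul_zero]
      rw [hn, Nat.lt_ceil, lt_div_iff₀ hδ] at h
      exact h
  have hdiff : A⁻¹ i j = (U * Matrix.diagonal (fun k => (ev k)⁻¹ - P.eval (ev k)) * Uᵀ) i j := by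
    have : U * Matrix.diagonal (fun k => (ev k)⁻¹ - P.eval (ev k)) * Uᵀ = A⁻¹ - Polynomial.aeval A P := by
      rw [hinv, hPA, ← Matrix.sub_mul, ← Matrix.mul_sub, Matrix.diagonal_sub]
    rw [this, Matrix.sub_apply, hzero, sub_zero]
  rw [hdiff]
  refine (abs_sum_unitary_le hU (by positivity) (fun k => hPt _ (hev k).1 (hev k).2) i j).trans ?_
  have h1 : rate z ^ n = Real.exp (Real.log (rate z) * n) := by
    rw [mul_comm, Real.exp_nat_mul, Real.exp_log hr]
  rw [h1]
  refine mul_le_mul_of_nonneg_left (Real.exp_le_exp.2 ?_) (by positivity)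
  exact mul_le_mul_of_nonpos_left (Nat.le_ceil _) (Real.log_neg hr (rate_lt_one hz)).le

end Banded

/-! ### Packing estimates for separated points -/

section Packing

variable {d : ℕ} {ι : Type*} {p : ι → E d} {q : ℝ}

lemma card_mul_volume_le (hd : 1 ≤ d) (hsep : ∀ i j, i ≠ j → 2 * q ≤ ‖p i - p j‖) (s : Finset ι) {S : Set (E d)}
    (hS : ∀ i ∈ s, Metric.ball (p i) q ⊆ S) :
    (s.card : ℝ≥0∞) * (ENNReal.ofReal q ^ d * ENNReal.ofReal (ballVol d)) ≤ volume S := by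
  calc (s.card : ℝ≥0∞) * (ENNReal.ofReal q ^ d * ENNReal.ofReal (ballVol d))
      = ∑ i ∈ s, volume (Metric.ball (p i) q) := by
        simp_rw [volume_ball_eq hd]
        rw [Finset.sum_const, nsmul_eq_mul]
    _ = volume (⋃ i ∈ s, Metric.ball (p i) q) := by
        rw [measure_biUnion_finset _ fun i _ => measurableSet_ball]
        intro i _ j _ hij
        refine Metric.ball_disjoint_ball ?_
        rw [dist_eq_norm]
        linarith [hsep i j hij]
    _ ≤ volume S := measure_mono (Set.iUnion₂_subset hS)

lemma card_mul_pow_le (hd : 1 ≤ d) (hq : 0 < q) (hsep : ∀ i j, i ≠ j → 2 * q ≤ ‖p i - p j‖)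
    (s : Finset ι) (y : E d) {r : ℝ} (hr : 0 ≤ r) (hs : ∀ i ∈ s, ‖y - p i‖ ≤ r) :
    (s.card : ℝ) ≤ (1 + r / q) ^ d := by
  have h := card_mul_volume_le hd hsep s (S := Metric.ball y (r + q)) fun i hi => by
    refine Metric.ball_subset_ball' ?_
    rw [dist_comm, dist_eq_norm]
    linarith [hs i hi]
  rw [volume_ball_eq hd, ← ENNReal.ofReal_pow hq.le, ← ENNReal.ofReal_pow (by positivity),
    ← ENNReal.ofReal_mul (by positivity), ← ENNReal.ofReal_mul (by positivity),
    ← ENNReal.ofReal_natCast, ← ENNReal.ofReal_mul (by positivity)] at h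
  have hv := ballVol_pos d
  rw [ENNReal.ofReal_le_ofReal_iff (by positivity), ← mul_assoc] at h
  have h2 := le_of_mul_le_mul_right h hv
  have h3 : 1 + r / q = (r + q) / q := by field_simp; ring
  rw [h3, div_pow, le_div_iff₀ (by positivity)]
  exact h2

lemma card_mul_pow_le_of_cover (hd : 1 ≤ d) {κ : Type*} [Fintype κ] {p' : κ → E d} (hq : 0 < q)
    (hsep : ∀ i j, i ≠ j → 2 * q ≤ ‖p i - p j‖) (s : Finset ι) {r : ℝ} (hr : 0 ≤ r)
    (hs : ∀ i ∈ s, ∃ k, ‖p i - p' k‖ ≤ r) :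
    (s.card : ℝ) * q ^ d ≤ Fintype.card κ * (r + q) ^ d := by
  have h := card_mul_volume_le hd hsep s (S := ⋃ k, Metric.ball (p' k) (r + q)) fun i hi => by
    obtain ⟨k, hk⟩ := hs i hi
    refine (Metric.ball_subset_ball' ?_).trans (Set.subset_iUnion (fun k => Metric.ball (p' k) (r + q)) k)
    rw [dist_eq_norm]
    linarith
  have h2 : volume (⋃ k, Metric.ball (p' k) (r + q)) ≤
      Fintype.card κ * (ENNReal.ofReal (r + q) ^ d * ENNReal.ofReal (ballVol d)) := by
    refine (measure_iUnion_fintype_le _ _).trans ?_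
    simp_rw [volume_ball_eq hd]
    rw [Finset.sum_const, nsmul_eq_mul, Finset.card_univ]
  have h3 := h.trans h2
  have hv := ballVol_pos d
  rw [← ENNReal.ofReal_pow hq.le, ← ENNReal.ofReal_pow (by positivity),
    ← ENNReal.ofReal_mul (by positivity), ← ENNReal.ofReal_mul (by positivity),
    ← ENNReal.ofReal_natCast, ← ENNReal.ofReal_mul (by positivity),
    ← ENNReal.ofReal_natCast, ← ENNReal.ofReal_mul (by positivity),
    ENNReal.ofReal_le_ofReal_iff (by positivity), ← mul_assoc, ← mul_assoc] at h3
  exact le_of_mul_le_mul_right h3 hv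

/-- The points are grouped into shells of width `q`, and by packing the `m`-th shell beyond `T q`
has at most `(T + m + 2)^d` of them. The factor `B` isolates the dependence on `T`: `B = 1` serves
for `T = 0` and `B = T^d` for `T ≥ 2`. -/
lemma sum_exp_neg_dist_le (hd : 1 ≤ d) [Fintype ι] (hq : 0 < q)
    (hsep : ∀ i j, i ≠ j → 2 * q ≤ ‖p i - p j‖) (y : E d) {θ T B : ℝ} (hθ : 0 < θ) (hT : 0 ≤ T)
    (hB : ∀ m : ℕ, (T + m + 2) ^ d ≤ B * ((m : ℝ) + 2) ^ d)
    (hsum : Summable fun m : ℕ => ((m : ℝ) + 2) ^ d * Real.exp (-θ * m))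
    (s : Finset ι) (hs : ∀ i ∈ s, T * q ≤ ‖y - p i‖) :
    ∑ i ∈ s, Real.exp (-θ * (‖y - p i‖ / q)) ≤
      B * Real.exp (-θ * T) * ∑' m : ℕ, ((m : ℝ) + 2) ^ d * Real.exp (-θ * m) := by
  classical
  have hB0 : 0 ≤ B := by
    have h := hB 0
    have h2 : 0 ≤ (T + (0 : ℕ) + 2) ^ d := by positivity
    have h3 : (0 : ℝ) < (((0 : ℕ) : ℝ) + 2) ^ d := by positivity
    exact nonneg_of_mul_nonneg_left (h2.trans h) h3
  set g : ι → ℕ := fun i => ⌊‖y - p i‖ / q - T⌋₊ with hg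
  calc ∑ i ∈ s, Real.exp (-θ * (‖y - p i‖ / q)) ≤ ∑ i ∈ s, Real.exp (-θ * (T + g i)) := by
        refine Finset.sum_le_sum fun i hi => Real.exp_le_exp.2 ?_
        have h1 : 0 ≤ ‖y - p i‖ / q - T := by
          rw [sub_nonneg, le_div_iff₀ hq]; exact hs i hi
        have h2 := Nat.floor_le h1
        exact mul_le_mul_of_nonpos_left (by linarith) (by linarith)
    _ = ∑ m ∈ s.image g, (({i ∈ s | g i = m}.card : ℕ) : ℝ) * Real.exp (-θ * (T + m)) := by
        rw [Finset.sum_comp (fun m : ℕ => Real.exp (-θ * (T + m))) g]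
        simp only [nsmul_eq_mul]
    _ ≤ ∑ m ∈ s.image g, B * Real.exp (-θ * T) * (((m : ℝ) + 2) ^ d * Real.exp (-θ * m)) := by
        refine Finset.sum_le_sum fun m _ => ?_
        have h1 : (({i ∈ s | g i = m}.card : ℕ) : ℝ) ≤ (1 + (T + m + 1) * q / q) ^ d := by
          refine card_mul_pow_le hd hq hsep _ y (by positivity) fun i hi => ?_
          have h2 := Nat.lt_floor_add_one (‖y - p i‖ / q - T)
          have h3 : ((g i : ℕ) : ℝ) = m := by rw [(Finset.mem_filter.1 hi).2]
          change _ < ((g i : ℕ) : ℝ) + 1 at h2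
          rw [h3, sub_lt_iff_lt_add, div_lt_iff₀ hq] at h2
          linarith
        rw [mul_div_cancel_right₀ _ hq.ne', show 1 + (T + m + 1) = T + m + 2 by ring] at h1
        rw [mul_add, Real.exp_add]
        calc _ ≤ B * ((m : ℝ) + 2) ^ d * (Real.exp (-θ * T) * Real.exp (-θ * m)) := by
              gcongr
              exact h1.trans (hB m)
          _ = _ := by ring
    _ ≤ _ := by
        rw [← Finset.mul_sum]
        refine mul_le_mul_of_nonneg_left ?_ (by positivity)
        exact hsum.sum_le_tsum _ fun m _ => by positivity

end Packing

/-! ### The matrix of one level -/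

section Level

variable {d : ℕ} {Φ : E d → ℝ} {τ cΦ CΦ : ℝ} {ι : Type*}

/-- The kernel matrix of one set of points. -/
def kernelMatrix (Φ : E d → ℝ) (δ : ℝ) (p : ι → E d) : Matrix ι ι ℝ :=
  Matrix.of fun i j => scaledKernel Φ δ (p i - p j)

lemma IsKernel.scaledKernel_eq_zero (hΦ : IsKernel Φ τ cΦ CΦ) {δ : ℝ} (hδ : 0 < δ) {x : E d}
    (hx : δ ≤ ‖x‖) : scaledKernel Φ δ x = 0 := by
  rw [scaledKernel, hΦ.eq_zero_of_one_le, mul_zero]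
  rw [norm_smul, norm_inv, Real.norm_of_nonneg hδ.le, ← div_eq_inv_mul, one_le_div hδ]
  exact hx

lemma IsKernel.abs_scaledKernel_le (hΦ : IsKernel Φ τ cΦ CΦ) {δ : ℝ} (hδ : 0 < δ) (x : E d) :
    |scaledKernel Φ δ x| ≤ (δ ^ d)⁻¹ := by
  rw [scaledKernel, abs_mul, abs_of_pos (by positivity)]
  exact mul_le_of_le_one_right (by positivity) (hΦ.abs_le_one _)

lemma IsKernel.isHermitian_kernelMatrix (hΦ : IsKernel Φ τ cΦ CΦ) (δ : ℝ) (p : ι → E d) :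
    (kernelMatrix Φ δ p).IsHermitian := by
  ext i j
  simp only [kernelMatrix, Matrix.conjTranspose_apply, Matrix.of_apply, scaledKernel, star_trivial]
  rw [← neg_sub (p i) (p j), smul_neg, hΦ.map_neg]

variable [Fintype ι]

lemma dotProduct_mulVec_eq (A : Matrix ι ι ℝ) (v : ι → ℝ) :
    v ⬝ᵥ A *ᵥ v = ∑ i, ∑ j, v i * v j * A i j := by
  simp only [dotProduct, Matrix.mulVec, Finset.mul_sum]
  refine Finset.sum_congr rfl fun i _ => Finset.sum_congr rfl fun j _ => ?_
  ring

variable {p : ι → E d} {q δ cq ν : ℝ}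

/-- This is `quadForm_lower` for the points `p i / δ` with `s = q / δ`. The powers of `δ` cancel,
and `δ / q ≤ ν c_q` makes the remaining factor uniform in the level. -/
lemma IsKernel.kernelMatrix_lower (hΦ : IsKernel Φ τ cΦ CΦ) (hd : 1 ≤ d) (hq : 0 < q) (hδ : 0 < δ)
    (hδq : δ ≤ ν * cq * q) (hsep : ∀ i j, i ≠ j → 2 * q ≤ ‖p i - p j‖) (v : ι → ℝ) :
    (constK d τ cΦ cq ν * q ^ d)⁻¹ * ∑ i, v i ^ 2 ≤ v ⬝ᵥ kernelMatrix Φ δ p *ᵥ v := by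
  have hC := constCd_pos d
  have hc := hΦ.c_pos
  have hM := constMd_pos d
  have h := hΦ.quadForm_lower hd v (y := fun i => δ⁻¹ • p i) (s := q / δ) (by positivity) fun i j hij => by
    rw [← smul_sub, norm_smul, norm_inv, Real.norm_of_nonneg hδ.le, ← div_eq_inv_mul, le_div_iff₀ hδ]
    calc 2 * (q / δ) * δ = 2 * q := by field_simp
      _ ≤ _ := hsep i j hij
  have e1 : v ⬝ᵥ kernelMatrix Φ δ p *ᵥ v =
      (δ ^ d)⁻¹ * ∑ j, ∑ k, v j * v k * Φ (δ⁻¹ • p j - δ⁻¹ • p k) := by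
    rw [dotProduct_mulVec_eq, Finset.mul_sum]
    refine Finset.sum_congr rfl fun i _ => ?_
    rw [Finset.mul_sum]
    refine Finset.sum_congr rfl fun j _ => ?_
    rw [kernelMatrix, Matrix.of_apply, scaledKernel, smul_sub]
    ring
  rw [e1]
  have h0 : 0 ≤ ∑ i, v i ^ 2 := Finset.sum_nonneg fun i _ => sq_nonneg _
  have h1 : δ ^ 2 ≤ (ν * cq * q) ^ 2 := by gcongr
  have h2 : (1 + 4 * constMd d ^ 2 * ν ^ 2 * cq ^ 2) ^ (-τ) ≤
      (1 + 4 * constMd d ^ 2 / (q / δ) ^ 2) ^ (-τ) := by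
    refine Real.rpow_le_rpow_of_nonpos (by positivity) ?_ (by linarith [hΦ.tau_pos])
    have : 4 * constMd d ^ 2 / (q / δ) ^ 2 = 4 * constMd d ^ 2 * (δ ^ 2 / q ^ 2) := by field_simp
    rw [this]
    have h3 : δ ^ 2 / q ^ 2 ≤ ν ^ 2 * cq ^ 2 := by
      rw [div_le_iff₀ (by positivity)]
      linarith
    linarith [mul_le_mul_of_nonneg_left h3 (by positivity : 0 ≤ 4 * constMd d ^ 2)]
  calc (constK d τ cΦ cq ν * q ^ d)⁻¹ * ∑ i, v i ^ 2
      = (δ ^ d)⁻¹ * (((q / δ) ^ d)⁻¹ * (constCd d * cΦ) *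
          (1 + 4 * constMd d ^ 2 * ν ^ 2 * cq ^ 2) ^ (-τ) * ∑ j, v j ^ 2) := by
        rw [constK, Real.rpow_neg (by positivity), div_pow]
        field_simp
    _ ≤ (δ ^ d)⁻¹ * (((q / δ) ^ d)⁻¹ * (constCd d * cΦ) *
          (1 + 4 * constMd d ^ 2 / (q / δ) ^ 2) ^ (-τ) * ∑ j, v j ^ 2) := by gcongr
    _ ≤ _ := by gcongr

lemma IsKernel.sum_abs_kernelMatrix_le (hΦ : IsKernel Φ τ cΦ CΦ) (hd : 1 ≤ d) (hq : 0 < q) (hδ : 0 < δ)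
    (hsep : ∀ i j, i ≠ j → 2 * q ≤ ‖p i - p j‖) (i : ι) :
    ∑ j, |kernelMatrix Φ δ p i j| ≤ (δ ^ d)⁻¹ * (1 + δ / q) ^ d := by
  classical
  have h1 : ∑ j, |kernelMatrix Φ δ p i j| =
      ∑ j ∈ Finset.univ.filter (fun j => ‖p i - p j‖ ≤ δ), |kernelMatrix Φ δ p i j| := by
    symm
    refine Finset.sum_filter_of_ne fun j _ hj => ?_
    by_contra! h
    exact hj (by rw [kernelMatrix, Matrix.of_apply, hΦ.scaledKernel_eq_zero hδ h.le, abs_zero])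
  rw [h1]
  refine (Finset.sum_le_card_nsmul _ _ _ fun j _ => hΦ.abs_scaledKernel_le hδ _).trans ?_
  rw [nsmul_eq_mul, mul_comm]
  gcongr
  exact card_mul_pow_le hd hq hsep _ (p i) hδ.le fun j hj => (Finset.mem_filter.1 hj).2

lemma dotProduct_mulVec_le_of_row_sum {A : Matrix ι ι ℝ} (hA : A.IsHermitian) {b : ℝ}
    (hb : ∀ i, ∑ j, |A i j| ≤ b) (v : ι → ℝ) : v ⬝ᵥ A *ᵥ v ≤ b * ∑ i, v i ^ 2 := by
  have hsymm : ∀ i j, A i j = A j i := fun i j => by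
    simpa using (hA.apply i j).symm
  have h1 : v ⬝ᵥ A *ᵥ v ≤ ∑ i, ∑ j, (v i ^ 2 * |A i j| / 2 + v j ^ 2 * |A j i| / 2) := by
    rw [dotProduct_mulVec_eq]
    refine Finset.sum_le_sum fun i _ => Finset.sum_le_sum fun j _ => ?_
    rw [hsymm j i]
    have h2 : v i * v j * A i j ≤ |v i| * |v j| * |A i j| := by
      rw [← abs_mul, ← abs_mul]; exact le_abs_self _
    nlinarith [sq_nonneg (|v i| - |v j|), sq_abs (v i), sq_abs (v j), abs_nonneg (A i j),
      mul_nonneg (sq_nonneg (|v i| - |v j|)) (abs_nonneg (A i j))]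
  refine h1.trans ?_
  simp_rw [Finset.sum_add_distrib]
  rw [Finset.sum_comm (f := fun i j => v j ^ 2 * |A j i| / 2), ← Finset.sum_add_distrib, Finset.mul_sum]
  refine Finset.sum_le_sum fun i _ => ?_
  rw [← Finset.sum_add_distrib]
  calc ∑ j, (v i ^ 2 * |A i j| / 2 + v i ^ 2 * |A i j| / 2) = v i ^ 2 * ∑ j, |A i j| := by
        rw [Finset.mul_sum]
        refine Finset.sum_congr rfl fun j _ => ?_
        ring
    _ ≤ v i ^ 2 * b := by gcongr; exact hb i
    _ = _ := mul_comm _ _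

/-- For `δ ≤ 2q` the matrix is the scalar `Φ_δ(0)`, which is taken as `a`. For `δ > 2q` the row sums
are at most `(1/δ + 1/q)^d ≤ (4/q)^d`, which is `z` times the coercivity constant. Row sums alone
would not do for small `δ`, where `1/δ` is not controlled by `1/q`. -/
lemma IsKernel.exists_condition_bounds (hΦ : IsKernel Φ τ cΦ CΦ) (hd : 1 ≤ d) (hq : 0 < q) (hδ : 0 < δ)
    (hδq : δ ≤ ν * cq * q) (hsep : ∀ i j, i ≠ j → 2 * q ≤ ‖p i - p j‖) [Nonempty ι] :
    ∃ a, (constK d τ cΦ cq ν * q ^ d)⁻¹ ≤ a ∧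
      (∀ v : ι → ℝ, a * ∑ i, v i ^ 2 ≤ v ⬝ᵥ kernelMatrix Φ δ p *ᵥ v) ∧
      ∀ v : ι → ℝ, v ⬝ᵥ kernelMatrix Φ δ p *ᵥ v ≤ constZ d τ cΦ cq ν * a * ∑ i, v i ^ 2 := by
  classical
  have hK := hΦ.constK_pos cq ν
  have hlow := hΦ.kernelMatrix_lower hd hq hδ hδq hsep
  rcases le_or_gt δ (2 * q) with h | h
  · have hdiag : ∀ v : ι → ℝ, v ⬝ᵥ kernelMatrix Φ δ p *ᵥ v = scaledKernel Φ δ 0 * ∑ i, v i ^ 2 := by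
      intro v
      rw [dotProduct_mulVec_eq, Finset.mul_sum]
      refine Finset.sum_congr rfl fun i _ => ?_
      rw [Finset.sum_eq_single i]
      · rw [kernelMatrix, Matrix.of_apply, sub_self]; ring
      · intro j _ hj
        rw [kernelMatrix, Matrix.of_apply,
          hΦ.scaledKernel_eq_zero hδ (h.trans (hsep i j hj.symm)), mul_zero]
      · simp
    have hle : (constK d τ cΦ cq ν * q ^ d)⁻¹ ≤ scaledKernel Φ δ 0 := by
      obtain ⟨i⟩ := ‹Nonempty ι›
      have h1 := hlow (Pi.single i 1)
      rw [hdiag] at h1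
      have h2 : ∑ j, (Pi.single i 1 : ι → ℝ) j ^ 2 = 1 := by
        rw [Finset.sum_eq_single i]
        · simp
        · intro j _ hj; simp [hj]
        · simp
      rwa [h2, mul_one, mul_one] at h1
    refine ⟨scaledKernel Φ δ 0, hle, fun v => (hdiag v).ge, fun v => ?_⟩
    rw [hdiag, mul_assoc]
    have h3 : 0 ≤ scaledKernel Φ δ 0 * ∑ i, v i ^ 2 :=
      mul_nonneg ((by positivity : (0 : ℝ) ≤ _).trans hle) (Finset.sum_nonneg fun i _ => sq_nonneg _)
    exact le_mul_of_one_le_left h3 (by linarith [hΦ.two_le_constZ hd cq ν])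
  · refine ⟨_, le_rfl, hlow, fun v => ?_⟩
    refine dotProduct_mulVec_le_of_row_sum (hΦ.isHermitian_kernelMatrix δ p) (fun i => ?_) v
    refine (hΦ.sum_abs_kernelMatrix_le hd hq hδ hsep i).trans ?_
    rw [← inv_pow, ← mul_pow, constZ]
    calc (δ⁻¹ * (1 + δ / q)) ^ d ≤ (4 * q⁻¹) ^ d := by
          refine pow_le_pow_left₀ (by positivity) ?_ d
          have h1 : δ⁻¹ * (1 + δ / q) = δ⁻¹ + q⁻¹ := by field_simp
          have h2 : δ⁻¹ ≤ q⁻¹ := inv_anti₀ hq (by linarith)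
          have h3 : 0 < q⁻¹ := by positivity
          rw [h1]
          linarith
      _ = _ := by rw [mul_pow, inv_pow]; field_simp

/-- The bandwidth is `δ` and the logarithm of the rate is `-2Rθ`. Since `R ≥ c_q ν` and `δ ≤ ν c_q
q`, the decay measured in units of `δ` is at least decay with rate `θ` in units of `q`. -/
lemma IsKernel.abs_inv_kernelMatrix_le [DecidableEq ι] (hΦ : IsKernel Φ τ cΦ CΦ) (hd : 1 ≤ d) (hq : 0 < q)
    (hδ : 0 < δ) (hcq : 0 < cq) (hν : 0 < ν)
    (hδq : δ ≤ ν * cq * q) (hsep : ∀ i j, i ≠ j → 2 * q ≤ ‖p i - p j‖) (i j : ι) :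
    |(kernelMatrix Φ δ p)⁻¹ i j| ≤ 2 * constK d τ cΦ cq ν * q ^ d *
      Real.exp (-constTheta d τ cΦ cq ν * (‖p i - p j‖ / q)) := by
  have : Nonempty ι := ⟨i⟩
  have hK := hΦ.constK_pos cq ν
  have hz := hΦ.two_le_constZ hd cq ν
  have hθ := hΦ.constTheta_pos hd cq ν
  obtain ⟨a, ha, hlow, hupp⟩ := hΦ.exists_condition_bounds hd hq hδ hδq hsep
  have ha0 : 0 < a := lt_of_lt_of_le (by positivity) ha
  refine (abs_inv_apply_le_of_banded (p := p) (hΦ.isHermitian_kernelMatrix δ p) ha0 hz hlow hupp hδ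
    (fun i j hij => ?_) i j).trans ?_
  · by_contra! h
    exact hij (by rw [kernelMatrix, Matrix.of_apply, hΦ.scaledKernel_eq_zero hδ h.le])
  have h1 : 2 / a ≤ 2 * constK d τ cΦ cq ν * q ^ d := by
    rw [inv_le_comm₀ (by positivity) ha0] at ha
    rw [div_eq_mul_inv]
    linarith
  refine mul_le_mul h1 (Real.exp_le_exp.2 ?_) (Real.exp_pos _).le (by positivity)
  rw [← hΦ.exp_constTheta hd cq ν, Real.log_exp]
  have hR : cq * ν ≤ constR d cq ν := by
    have h1 : (1 : ℝ) ≤ √d := Real.one_le_sqrt.2 (by exact_mod_cast hd)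
    have h2 : cq * ν ≤ max (cq * ν) 4 := le_max_left _ _
    rw [constR]
    nlinarith [mul_pos hcq hν]
  have h2 : ‖p i - p j‖ / q ≤ cq * ν * (‖p i - p j‖ / δ) := by
    rw [← mul_div_assoc, div_le_div_iff₀ hq hδ]
    nlinarith [norm_nonneg (p i - p j)]
  have h3 : 0 ≤ ‖p i - p j‖ / δ := by positivity
  have h4 : cq * ν * (‖p i - p j‖ / δ) ≤ constR d cq ν * (‖p i - p j‖ / δ) := by gcongr
  have h5 : constTheta d τ cΦ cq ν * (‖p i - p j‖ / q) ≤
      constTheta d τ cΦ cq ν * (constR d cq ν * (‖p i - p j‖ / δ)) := by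
    gcongr; exact h2.trans h4
  have h6 : 0 ≤ constTheta d τ cΦ cq ν * (constR d cq ν * (‖p i - p j‖ / δ)) := by
    have := four_le_constR hd cq ν
    positivity
  nlinarith

/-- The Lagrange functions decay exponentially. -/
theorem IsKernel.abs_lagrange_le [DecidableEq ι] (hΦ : IsKernel Φ τ cΦ CΦ) (hd : 1 ≤ d) (hq : 0 < q)
    (hcq : 0 < cq) (hν : 0 < ν) (hqδ : ν * q ≤ δ)
    (hδq : δ ≤ ν * cq * q) (hsep : ∀ i j, i ≠ j → 2 * q ≤ ‖p i - p j‖) (y : E d) (n : ι) :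
    |∑ m, scaledKernel Φ δ (y - p m) * (kernelMatrix Φ δ p)⁻¹ m n| ≤ constC d τ cΦ cq ν *
      Real.exp (-constTheta d τ cΦ cq ν * (‖y - p n‖ / q)) := by
  have hδ : 0 < δ := lt_of_lt_of_le (by positivity) hqδ
  have hK := hΦ.constK_pos cq ν
  have hθ := hΦ.constTheta_pos hd cq ν
  have hC := hΦ.le_constC hd hcq.le hν
  set θ := constTheta d τ cΦ cq ν
  set K := constK d τ cΦ cq ν
  have h1 : ∀ m ∈ Finset.univ.filter (fun m => ‖y - p m‖ ≤ δ),
      |scaledKernel Φ δ (y - p m) * (kernelMatrix Φ δ p)⁻¹ m n| ≤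
      (δ ^ d)⁻¹ * (2 * K * q ^ d * (Real.exp (cq * ν * θ) * Real.exp (-θ * (‖y - p n‖ / q)))) := by
    intro m hm
    have hm' : ‖y - p m‖ ≤ δ := (Finset.mem_filter.1 hm).2
    rw [abs_mul]
    refine mul_le_mul (hΦ.abs_scaledKernel_le hδ _) ?_ (abs_nonneg _) (by positivity)
    refine (hΦ.abs_inv_kernelMatrix_le hd hq hδ hcq hν hδq hsep m n).trans ?_
    refine mul_le_mul_of_nonneg_left ?_ (by positivity)
    rw [← Real.exp_add]
    refine Real.exp_le_exp.2 ?_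
    have h2 := norm_sub_le_norm_sub_add_norm_sub y (p m) (p n)
    -- Moving from `y` to a node `p m` within distance `δ` costs the factor `e^(c_q ν θ)` in the
    -- constant `C`.
    have h3 : ‖y - p n‖ / q ≤ ν * cq + ‖p m - p n‖ / q := by
      rw [div_le_iff₀ hq, add_mul, div_mul_cancel₀ _ hq.ne']
      linarith
    nlinarith [mul_le_mul_of_nonneg_left h3 hθ.le]
  have h0 : ∑ m, scaledKernel Φ δ (y - p m) * (kernelMatrix Φ δ p)⁻¹ m n =
      ∑ m ∈ Finset.univ.filter (fun m => ‖y - p m‖ ≤ δ),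
        scaledKernel Φ δ (y - p m) * (kernelMatrix Φ δ p)⁻¹ m n := by
    symm
    refine Finset.sum_filter_of_ne fun m _ hm => ?_
    by_contra! h
    exact hm (by rw [hΦ.scaledKernel_eq_zero hδ h.le, zero_mul])
  rw [h0]
  refine (Finset.abs_sum_le_sum_abs _ _).trans ((Finset.sum_le_card_nsmul _ _ _ h1).trans ?_)
  rw [nsmul_eq_mul]
  have hcard := card_mul_pow_le hd hq hsep (Finset.univ.filter (fun m => ‖y - p m‖ ≤ δ)) y hδ.le
    fun m hm => (Finset.mem_filter.1 hm).2
  have hcard2 : (1 + δ / q) ^ d ≤ (1 + ν * cq) ^ d := by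
    have : δ / q ≤ ν * cq := by rw [div_le_iff₀ hq]; exact hδq
    gcongr
  have hpow : (δ ^ d)⁻¹ * q ^ d ≤ (ν ^ d)⁻¹ := by
    rw [inv_mul_le_iff₀ (by positivity), ← div_eq_mul_inv, le_div_iff₀ (by positivity), ← mul_pow,
      mul_comm q]
    gcongr
  calc _ ≤ (1 + ν * cq) ^ d * ((δ ^ d)⁻¹ * (2 * K * q ^ d *
        (Real.exp (cq * ν * θ) * Real.exp (-θ * (‖y - p n‖ / q))))) := by
        gcongr
        exact hcard.trans hcard2
    _ = (2 * K * Real.exp (cq * ν * θ) * (1 + ν * cq) ^ d * ((δ ^ d)⁻¹ * q ^ d)) *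
        Real.exp (-θ * (‖y - p n‖ / q)) := by ring
    _ ≤ (2 * K * Real.exp (cq * ν * θ) * (1 + ν * cq) ^ d * (ν ^ d)⁻¹) *
        Real.exp (-θ * (‖y - p n‖ / q)) := by gcongr
    _ ≤ _ := by gcongr

end Level

/-! ### Node sequences -/

lemma two_mul_sepDist_le {d n : ℕ} (x : Fin n → E d) (i j : Fin n) (hij : i ≠ j) :
    2 * sepDist x ≤ ‖x i - x j‖ := by
  have h : sInf {r : ℝ | ∃ j k : Fin n, j ≠ k ∧ r = ‖x j - x k‖} ≤ ‖x i - x j‖ :=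
    csInf_le ⟨0, by rintro _ ⟨j, k, -, rfl⟩; exact norm_nonneg _⟩ ⟨i, j, hij, rfl⟩
  rw [sepDist]
  linarith

lemma sepDist_nonneg {d n : ℕ} (x : Fin n → E d) : 0 ≤ sepDist x := by
  have h : 0 ≤ sInf {r : ℝ | ∃ j k : Fin n, j ≠ k ∧ r = ‖x j - x k‖} :=
    Real.sInf_nonneg (by rintro _ ⟨j, k, -, rfl⟩; exact norm_nonneg _)
  rw [sepDist]
  linarith

lemma iInf_le_fillDist {d n : ℕ} {Ω : Set (E d)} (hΩ : Bornology.IsBounded Ω) {x : Fin n → E d}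
    (hn : 1 ≤ n) {y : E d} (hy : y ∈ Ω) : ⨅ j, ‖y - x j‖ ≤ fillDist Ω x := by
  obtain ⟨B, hB⟩ := hΩ.exists_norm_le
  refine le_ciSup (f := fun y : Ω => ⨅ j : Fin n, ‖(y : E d) - x j‖)
    ⟨B + ‖x ⟨0, hn⟩‖, ?_⟩ (⟨y, hy⟩ : Ω)
  rintro _ ⟨y, rfl⟩
  refine (ciInf_le ⟨0, ?_⟩ (⟨0, hn⟩ : Fin n)).trans ((norm_sub_le _ _).trans ?_)
  · rintro _ ⟨j, rfl⟩; exact norm_nonneg _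
  · linarith [hB y y.2]

namespace IsNodeSequence

variable {d : ℕ} {Ω : Set (E d)} {N : ℕ → ℕ} {x : ∀ ℓ, Fin (N ℓ) → E d} {μ ch cq : ℝ}

lemma exists_norm_sub_le (hX : IsNodeSequence Ω N x μ ch cq) (hΩ : Bornology.IsBounded Ω) {ℓ : ℕ}
    (hℓ : 1 ≤ ℓ) {y : E d} (hy : y ∈ Ω) : ∃ j, ‖y - x ℓ j‖ ≤ fillDist Ω (x ℓ) := by
  have : Nonempty (Fin (N ℓ)) := ⟨⟨0, hX.nonempty ℓ hℓ⟩⟩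
  obtain ⟨j, hj⟩ := exists_eq_ciInf_of_finite (f := fun j => ‖y - x ℓ j‖)
  exact ⟨j, hj.trans_le (iInf_le_fillDist hΩ (hX.nonempty ℓ hℓ) hy)⟩

/-- A nonempty open set in positive dimension is infinite, so finitely many nodes miss some point of
it. -/
lemma fillDist_pos (hX : IsNodeSequence Ω N x μ ch cq) (hd : 1 ≤ d) (hΩo : IsOpen Ω)
    (hΩ : Bornology.IsBounded Ω) {ℓ : ℕ} (hℓ : 1 ≤ ℓ) : 0 < fillDist Ω (x ℓ) := by
  have : Nonempty (Fin d) := ⟨⟨0, hd⟩⟩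
  have hne : (Ω \ Set.range (x ℓ)).Nonempty := by
    have h1 : Ω.Infinite := infinite_of_mem_nhds (x ℓ ⟨0, hX.nonempty ℓ hℓ⟩)
      (hΩo.mem_nhds (hX.mem ℓ hℓ _))
    exact (h1.sdiff (Set.finite_range _)).nonempty
  obtain ⟨y, hy, hyx⟩ := hne
  obtain ⟨j, hj⟩ := hX.exists_norm_sub_le hΩ hℓ hy
  refine lt_of_lt_of_le (norm_pos_iff.2 (sub_ne_zero.2 ?_)) hj
  rintro rfl
  exact hyx ⟨j, rfl⟩

/-- This also rules out levels with a single node: there `sInf ∅ = 0` gives separation distance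
zero, contradicting `0 < h_ℓ ≤ c_q q_ℓ`. -/
lemma sepDist_pos (hX : IsNodeSequence Ω N x μ ch cq) (hd : 1 ≤ d) (hΩo : IsOpen Ω)
    (hΩ : Bornology.IsBounded Ω) {ℓ : ℕ} (hℓ : 1 ≤ ℓ) : 0 < sepDist (x ℓ) := by
  refine lt_of_le_of_ne (sepDist_nonneg _) fun h => ?_
  have h1 := hX.fill_le_sep ℓ hℓ
  rw [← h, mul_zero] at h1
  exact absurd (hX.fillDist_pos hd hΩo hΩ hℓ) (not_lt.2 h1)

lemma one_le_cq (hX : IsNodeSequence Ω N x μ ch cq) (hd : 1 ≤ d) (hΩo : IsOpen Ω)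
    (hΩ : Bornology.IsBounded Ω) : 1 ≤ cq := by
  have h1 := hX.fill_le_sep 1 le_rfl
  have h2 := hX.sep_le_fill 1 le_rfl
  have h3 := hX.sepDist_pos hd hΩo hΩ le_rfl
  by_contra! h
  nlinarith

lemma fillDist_le_one (hX : IsNodeSequence Ω N x μ ch cq) (hd : 1 ≤ d) (hΩo : IsOpen Ω)
    (hΩ : Bornology.IsBounded Ω) {ℓ : ℕ} (hℓ : 1 ≤ ℓ) : fillDist Ω (x ℓ) ≤ fillDist Ω (x 1) := by
  induction ℓ, hℓ using Nat.le_induction with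
  | base => exact le_rfl
  | succ ℓ hℓ ih =>
    refine (hX.fill_upper ℓ hℓ).trans (le_trans ?_ ih)
    exact mul_le_of_le_one_left (hX.fillDist_pos hd hΩo hΩ hℓ).le hX.mu_lt_one.le

/-- The total volume of the small balls on level `ℓ` is controlled by level one. -/
lemma card_mul_sepDist_pow_le (hX : IsNodeSequence Ω N x μ ch cq) (hd : 1 ≤ d) (hΩo : IsOpen Ω)
    (hΩ : Bornology.IsBounded Ω) {ℓ : ℕ} (hℓ : 1 ≤ ℓ) :
    (N ℓ : ℝ) * sepDist (x ℓ) ^ d ≤ N 1 * (2 * cq) ^ d * sepDist (x 1) ^ d := by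
  -- The disjoint balls of radius `q_ℓ` lie in the balls of radius `h_1 + q_ℓ` around the nodes of
  -- level one, and `h_1 + q_ℓ ≤ 2 h_1 ≤ 2 c_q q_1`.
  have h1 := card_mul_pow_le_of_cover (p' := x 1) hd (hX.sepDist_pos hd hΩo hΩ hℓ)
    (two_mul_sepDist_le (x ℓ)) Finset.univ (hX.fillDist_pos hd hΩo hΩ le_rfl).le
    fun i _ => hX.exists_norm_sub_le hΩ le_rfl (hX.mem ℓ hℓ i)
  simp only [Finset.card_univ, Fintype.card_fin] at h1
  refine h1.trans ?_
  rw [mul_assoc, ← mul_pow]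
  have h2 := hX.fill_le_sep 1 le_rfl
  have h3 := (hX.sep_le_fill ℓ hℓ).trans (hX.fillDist_le_one hd hΩo hΩ hℓ)
  have h4 := sepDist_nonneg (x ℓ)
  have h5 := (hX.fillDist_pos hd hΩo hΩ le_rfl).le
  gcongr
  linarith

end IsNodeSequence

/-! ### Row sums of the Lagrange matrices -/

section RowSums

variable {d : ℕ} {Φ : E d → ℝ} {τ cΦ CΦ : ℝ} {Ω : Set (E d)} {N : ℕ → ℕ}
  {x : ∀ ℓ, Fin (N ℓ) → E d} {μ ch cq ν : ℝ}

lemma abs_matX_le (hΦ : IsKernel Φ τ cΦ CΦ) (hX : IsNodeSequence Ω N x μ ch cq) (hd : 1 ≤ d)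
    (hΩo : IsOpen Ω) (hΩ : Bornology.IsBounded Ω) (hν : 0 < ν) (k : ℕ) {ℓ : ℕ} (hℓ : 1 ≤ ℓ)
    (i : Fin (N k)) (n : Fin (N ℓ)) :
    |matX Φ Ω N x ν k ℓ i n| ≤ constC d τ cΦ cq ν *
      Real.exp (-constTheta d τ cΦ cq ν * (‖x k i - x ℓ n‖ / sepDist (x ℓ))) := by
  have hcq : 0 < cq := by linarith [hX.one_le_cq hd hΩo hΩ]
  have h1 : ν * sepDist (x ℓ) ≤ ν * fillDist Ω (x ℓ) := by
    have := hX.sep_le_fill ℓ hℓ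
    gcongr
  have h2 : ν * fillDist Ω (x ℓ) ≤ ν * cq * sepDist (x ℓ) := by
    rw [mul_assoc]
    have := hX.fill_le_sep ℓ hℓ
    gcongr
  exact hΦ.abs_lagrange_le hd (hX.sepDist_pos hd hΩo hΩ hℓ) hcq hν h1 h2 (two_mul_sepDist_le (x ℓ)) (x k i) n

lemma IsKernel.constC_pos (hΦ : IsKernel Φ τ cΦ CΦ) (hν : 0 < ν) (hcq : 0 ≤ cq) :
    0 < constC d τ cΦ cq ν := by
  have := hΦ.constK_pos cq ν
  have : 0 < max 1 (ν ^ d)⁻¹ := lt_max_of_lt_left one_pos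
  rw [constC]
  positivity

lemma sum_abs_matX_far_le (hΦ : IsKernel Φ τ cΦ CΦ) (hX : IsNodeSequence Ω N x μ ch cq) (hd : 1 ≤ d)
    (hΩo : IsOpen Ω) (hΩ : Bornology.IsBounded Ω) (hν : 0 < ν) (k : ℕ) {ℓ : ℕ} (hℓ : 1 ≤ ℓ)
    (i : Fin (N k)) {T B : ℝ} (hT : 0 ≤ T) (hB : ∀ m : ℕ, (T + m + 2) ^ d ≤ B * ((m : ℝ) + 2) ^ d)
    (s : Finset (Fin (N ℓ))) (hs : ∀ n ∈ s, T * sepDist (x ℓ) ≤ ‖x k i - x ℓ n‖) :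
    ∑ n ∈ s, |matX Φ Ω N x ν k ℓ i n| ≤
      B * Real.exp (-constTheta d τ cΦ cq ν * T) * (constC d τ cΦ cq ν * constCSigma d τ cΦ cq ν) := by
  have hC := hΦ.constC_pos hν (by linarith [hX.one_le_cq hd hΩo hΩ] : 0 ≤ cq)
  refine (Finset.sum_le_sum fun n _ => abs_matX_le hΦ hX hd hΩo hΩ hν k hℓ i n).trans ?_
  rw [← Finset.mul_sum]
  have h := sum_exp_neg_dist_le hd (hX.sepDist_pos hd hΩo hΩ hℓ) (two_mul_sepDist_le (x ℓ)) (x k i)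
    (hΦ.constTheta_pos hd cq ν) hT hB (hΦ.summable_constCSigma hd cq ν) s hs
  refine (mul_le_mul_of_nonneg_left h hC.le).trans_eq ?_
  rw [constCSigma]
  ring

lemma sum_abs_matX_le (hΦ : IsKernel Φ τ cΦ CΦ) (hX : IsNodeSequence Ω N x μ ch cq) (hd : 1 ≤ d)
    (hΩo : IsOpen Ω) (hΩ : Bornology.IsBounded Ω) (hν : 0 < ν) (k : ℕ) {ℓ : ℕ} (hℓ : 1 ≤ ℓ)
    (i : Fin (N k)) :
    ∑ n, |matX Φ Ω N x ν k ℓ i n| ≤ constC d τ cΦ cq ν * constCSigma d τ cΦ cq ν := by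
  have h := sum_abs_matX_far_le hΦ hX hd hΩo hΩ hν k hℓ i (T := 0) (B := 1) le_rfl
    (fun m => by rw [zero_add, one_mul]) Finset.univ (fun n _ => by rw [zero_mul]; exact norm_nonneg _)
  simpa using h

lemma sum_abs_matXTrunc_le (hΦ : IsKernel Φ τ cΦ CΦ) (hX : IsNodeSequence Ω N x μ ch cq) (hd : 1 ≤ d)
    (hΩo : IsOpen Ω) (hΩ : Bornology.IsBounded Ω) (hν : 0 < ν) (T : ℝ) (k : ℕ) {ℓ : ℕ} (hℓ : 1 ≤ ℓ)
    (i : Fin (N k)) :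
    ∑ n, |matXTrunc Φ Ω N x ν T k ℓ i n| ≤ constC d τ cΦ cq ν * constCSigma d τ cΦ cq ν := by
  refine (Finset.sum_le_sum fun n _ => ?_).trans (sum_abs_matX_le hΦ hX hd hΩo hΩ hν k hℓ i)
  rw [matXTrunc, Matrix.of_apply]
  split_ifs
  · exact le_rfl
  · simp

/-- Discarded nodes are at distance at least `T q_ℓ`. From `T ≥ 2` follows `T + m + 2 ≤ T (m + 2)`,
so the shell counts grow by at most `T^d`, and `T^d ≤ e^(θT/2)` uses up half of the decay `e^(-θT)`.
-/
lemma sum_abs_matX_sub_matXTrunc_le (hΦ : IsKernel Φ τ cΦ CΦ) (hX : IsNodeSequence Ω N x μ ch cq)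
    (hd : 1 ≤ d) (hΩo : IsOpen Ω) (hΩ : Bornology.IsBounded Ω) (hν : 0 < ν) {T : ℝ} (hT : 2 ≤ T)
    (hTexp : T ^ d ≤ Real.exp (constTheta d τ cΦ cq ν / 2 * T)) (k : ℕ) {ℓ : ℕ}
    (hℓ : 1 ≤ ℓ) (i : Fin (N k)) :
    ∑ n, |matX Φ Ω N x ν k ℓ i n - matXTrunc Φ Ω N x ν T k ℓ i n| ≤
      Real.exp (-(constTheta d τ cΦ cq ν / 2 * T)) * (constC d τ cΦ cq ν * constCSigma d τ cΦ cq ν) := by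
  classical
  have hC := hΦ.constC_pos hν (by linarith [hX.one_le_cq hd hΩo hΩ] : 0 ≤ cq)
  have hS : 0 ≤ constCSigma d τ cΦ cq ν :=
    (by positivity : (0 : ℝ) ≤ 6 ^ d / 3).trans (hΦ.le_constCSigma hd cq ν)
  set s := Finset.univ.filter fun n : Fin (N ℓ) =>
    ¬ ‖x k i - x ℓ n‖ < T * max (sepDist (x k)) (sepDist (x ℓ)) with hs
  have h1 : ∑ n, |matX Φ Ω N x ν k ℓ i n - matXTrunc Φ Ω N x ν T k ℓ i n| =
      ∑ n ∈ s, |matX Φ Ω N x ν k ℓ i n| := by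
    rw [hs, Finset.sum_filter]
    refine Finset.sum_congr rfl fun n _ => ?_
    rw [matXTrunc, Matrix.of_apply]
    by_cases h : ‖x k i - x ℓ n‖ < T * max (sepDist (x k)) (sepDist (x ℓ)) <;> simp [h]
  rw [h1]
  refine (sum_abs_matX_far_le hΦ hX hd hΩo hΩ hν k hℓ i (T := T) (B := T ^ d) (by linarith)
    (fun m => ?_) s fun n hn => ?_).trans ?_
  · rw [← mul_pow]
    refine pow_le_pow_left₀ (by positivity) ?_ d
    have : (0 : ℝ) ≤ m := by positivity
    nlinarith
  · have h2 := not_lt.1 (Finset.mem_filter.1 hn).2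
    have h3 : sepDist (x ℓ) ≤ max (sepDist (x k)) (sepDist (x ℓ)) := le_max_right _ _
    exact (mul_le_mul_of_nonneg_left h3 (by linarith)).trans h2
  · refine mul_le_mul_of_nonneg_right ?_ (by positivity)
    calc T ^ d * Real.exp (-constTheta d τ cΦ cq ν * T)
        ≤ Real.exp (constTheta d τ cΦ cq ν / 2 * T) * Real.exp (-constTheta d τ cΦ cq ν * T) := by gcongr
      _ = _ := by rw [← Real.exp_add]; congr 1; ring

end RowSums

/-! ### Block lower triangular systems -/

section Triangular

variable {N : ℕ → ℕ} {L : ℕ}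

lemma sum_ite_lt_eq (a : Fin L) (W : ℕ → ℝ) :
    ∑ r : Fin L, (if r < a then W r else 0) = ∑ r ∈ Finset.range a, W r := by
  have h := Fin.sum_univ_eq_sum_range (fun r : ℕ => if r < (a : ℕ) then W r else 0) L
  simp only [Fin.lt_def]
  rw [h, ← Finset.sum_filter]
  congr 1
  ext r
  simp only [Finset.mem_filter, Finset.mem_range]
  omega

/-- A sum against a strictly lower block triangular matrix with bounded block row sums. -/
lemma abs_sum_lower_le {G : Idx N L → Idx N L → ℝ} {u : Idx N L → ℝ} {W : ℕ → ℝ} {b : ℝ} (p : Idx N L)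
    (hW : ∀ r : Fin L, r < p.1 → ∀ n, |u ⟨r, n⟩| ≤ W r)
    (hG : ∀ r : Fin L, r < p.1 → ∑ n, |G p ⟨r, n⟩| ≤ b)
    (hG0 : ∀ r : Fin L, ¬ r < p.1 → ∀ n, G p ⟨r, n⟩ = 0) (hW0 : ∀ r, 0 ≤ W r) :
    |∑ r, G p r * u r| ≤ b * ∑ r ∈ Finset.range p.1, W r := by
  rw [Fintype.sum_sigma, ← sum_ite_lt_eq, Finset.mul_sum]
  refine (Finset.abs_sum_le_sum_abs _ _).trans (Finset.sum_le_sum fun r _ => ?_)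
  split_ifs with h
  · calc |∑ n, G p ⟨r, n⟩ * u ⟨r, n⟩| ≤ ∑ n, |G p ⟨r, n⟩ * u ⟨r, n⟩| := Finset.abs_sum_le_sum_abs _ _
      _ ≤ ∑ n, |G p ⟨r, n⟩| * W r := by
          refine Finset.sum_le_sum fun n _ => ?_
          rw [abs_mul]
          exact mul_le_mul_of_nonneg_left (hW r h n) (abs_nonneg _)
      _ = (∑ n, |G p ⟨r, n⟩|) * W r := (Finset.sum_mul _ _ _).symm
      _ ≤ b * W r := mul_le_mul_of_nonneg_right (hG r h) (hW0 r)
  · rw [mul_zero]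
    refine (abs_eq_zero.2 (Finset.sum_eq_zero fun n _ => ?_)).le
    rw [hG0 r h n, zero_mul]

/-- A discrete Gronwall lemma: `W` is a supersolution of the scalar recursion over the levels, and
forward substitution preserves the bound. -/
lemma abs_le_of_lower_triangular {G : Idx N L → Idx N L → ℝ} {u g : Idx N L → ℝ} {V W : ℕ → ℝ} {b : ℝ}
    (hu : ∀ p, u p + ∑ r, G p r * u r = g p) (hg : ∀ p, |g p| ≤ V p.1)
    (hG : ∀ p : Idx N L, ∀ r : Fin L, r < p.1 → ∑ n, |G p ⟨r, n⟩| ≤ b)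
    (hG0 : ∀ p : Idx N L, ∀ r : Fin L, ¬ r < p.1 → ∀ n, G p ⟨r, n⟩ = 0) (hW0 : ∀ r, 0 ≤ W r)
    (hVW : ∀ a, V a + b * ∑ r ∈ Finset.range a, W r ≤ W a) (p : Idx N L) : |u p| ≤ W p.1 := by
  suffices h : ∀ m : ℕ, ∀ p : Idx N L, (p.1 : ℕ) = m → |u p| ≤ W p.1 from h _ p rfl
  intro m
  induction m using Nat.strong_induction_on with
  | _ m ih =>
    intro p hp
    have h1 := abs_sum_lower_le (G := G) (u := u) (W := W) (b := b) p
      (fun r hr n => ih r (by rw [← hp]; exact hr) ⟨r, n⟩ rfl) (hG p) (hG0 p) hW0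
    have h2 : u p = g p - ∑ r, G p r * u r := by rw [← hu p]; ring
    rw [h2]
    exact (abs_sub _ _).trans ((add_le_add (hg p) h1).trans (hVW _))

end Triangular

/-! ### Stability of the triangular system under thresholding -/

section Stability

variable {d : ℕ} {Φ : E d → ℝ} {τ cΦ CΦ : ℝ} {Ω : Set (E d)} {N : ℕ → ℕ}
  {x : ∀ ℓ, Fin (N ℓ) → E d} {μ ch cq ν : ℝ}

lemma mul_sum_range_pow (b F : ℝ) (a : ℕ) :
    b * ∑ r ∈ Finset.range a, F * (1 + b) ^ r = F * ((1 + b) ^ a - 1) := by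
  rw [← Finset.mul_sum, ← geom_sum_mul]
  ring

/-- The strictly lower triangular part of `T'_L`. -/
def lowerMat (Φ : E d → ℝ) (Ω : Set (E d)) (N : ℕ → ℕ) (x : ∀ ℓ, Fin (N ℓ) → E d) (ν : ℝ) (L : ℕ)
    (p r : Idx N L) : ℝ :=
  if r.1 < p.1 then matX Φ Ω N x ν (p.1 + 1) (r.1 + 1) p.2 r.2 else 0

lemma matT'_mulVec (L : ℕ) (β : Idx N L → ℝ) (p : Idx N L) :
    (matT' Φ Ω N x ν L *ᵥ β) p = β p + ∑ r, lowerMat Φ Ω N x ν L p r * β r := by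
  have h : ∀ r, matT' Φ Ω N x ν L p r = (1 : Matrix (Idx N L) (Idx N L) ℝ) p r + lowerMat Φ Ω N x ν L p r := by
    intro r
    rw [matT', Matrix.of_apply, lowerMat, Matrix.one_apply]
    by_cases h : r.1 < p.1
    · have : p ≠ r := by rintro rfl; exact lt_irrefl _ h
      simp [h, this]
    · simp [h]
  rw [Matrix.mulVec, dotProduct]
  simp_rw [h, add_mul]
  rw [Finset.sum_add_distrib]
  congr 1
  have := congrFun (Matrix.one_mulVec β) p
  rwa [Matrix.mulVec, dotProduct] at this

lemma one_sub_matMTrunc_mulVec (T : ℝ) (L : ℕ) (β : Idx N L → ℝ) (p : Idx N L) :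
    ((1 - matMTrunc Φ Ω N x ν T L) *ᵥ β) p =
      β p + ∑ r, -matMTrunc Φ Ω N x ν T L p r * β r := by
  rw [Matrix.sub_mulVec, Matrix.one_mulVec, Pi.sub_apply, sub_eq_add_neg, Matrix.mulVec, dotProduct,
    ← Finset.sum_neg_distrib]
  simp only [neg_mul]

/-- The difference solves the exact system, with the discarded entries acting on `β'` as source.
Gronwall is applied twice: to `β'`, which grows like `(1+b)^a`, and to the difference, whose source
grows at the same rate. This resonance produces the factor `a + 1`. -/
theorem abs_sub_solution_le (hΦ : IsKernel Φ τ cΦ CΦ) (hX : IsNodeSequence Ω N x μ ch cq)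
    (hd : 1 ≤ d) (hΩo : IsOpen Ω) (hΩ : Bornology.IsBounded Ω) (hν : 0 < ν) {T : ℝ} (hT : 2 ≤ T)
    (hTexp : T ^ d ≤ Real.exp (constTheta d τ cΦ cq ν / 2 * T)) {L : ℕ} {g β β' : Idx N L → ℝ} {F b : ℝ}
    (hb : b = constC d τ cΦ cq ν * constCSigma d τ cΦ cq ν) (hF : ∀ p, |g p| ≤ F) (hF0 : 0 ≤ F)
    (hβ : matT' Φ Ω N x ν L *ᵥ β = g) (hβ' : (1 - matMTrunc Φ Ω N x ν T L) *ᵥ β' = g) (p : Idx N L) :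
    |β p - β' p| ≤ Real.exp (-(constTheta d τ cΦ cq ν / 2 * T)) * F * (p.1 + 1) * (1 + b) ^ (p.1 : ℕ) := by
  have hC := hΦ.constC_pos hν (by linarith [hX.one_le_cq hd hΩo hΩ] : 0 ≤ cq)
  have hS : 0 ≤ constCSigma d τ cΦ cq ν :=
    (by positivity : (0 : ℝ) ≤ 6 ^ d / 3).trans (hΦ.le_constCSigma hd cq ν)
  have hb0 : 0 ≤ b := by rw [hb]; positivity
  set ε := Real.exp (-(constTheta d τ cΦ cq ν / 2 * T)) with hε
  have hG : ∀ p : Idx N L, ∀ r : Fin L, r < p.1 → ∑ n, |lowerMat Φ Ω N x ν L p ⟨r, n⟩| ≤ b := by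
    intro p r hr
    simp only [lowerMat, hr, if_true]
    rw [hb]
    exact sum_abs_matX_le hΦ hX hd hΩo hΩ hν _ (by omega) _
  have hG0 : ∀ p : Idx N L, ∀ r : Fin L, ¬ r < p.1 → ∀ n, lowerMat Φ Ω N x ν L p ⟨r, n⟩ = 0 := by
    intro p r hr n
    simp only [lowerMat, hr, if_false]
  have hβ'_le : ∀ p : Idx N L, |β' p| ≤ F * (1 + b) ^ (p.1 : ℕ) := by
    refine abs_le_of_lower_triangular (G := fun p r => -matMTrunc Φ Ω N x ν T L p r) (g := g)
      (V := fun _ => F) (W := fun a => F * (1 + b) ^ a) (b := b) (fun p => ?_) hF (fun p r hr => ?_)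
      (fun p r hr n => ?_) (fun r => by positivity) (fun a => ?_)
    · rw [← hβ', one_sub_matMTrunc_mulVec]
    · simp only [matMTrunc, Matrix.of_apply, hr, if_true, neg_neg]
      rw [hb]
      exact sum_abs_matXTrunc_le hΦ hX hd hΩo hΩ hν T _ (by omega) _
    · simp only [matMTrunc, Matrix.of_apply, hr, if_false, neg_zero]
    · rw [mul_sum_range_pow]
      linarith
  have key : ∀ p, (β - β') p + ∑ r, lowerMat Φ Ω N x ν L p r * (β - β') r =
      -∑ r, (lowerMat Φ Ω N x ν L p r + matMTrunc Φ Ω N x ν T L p r) * β' r := by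
    intro p
    have h1 := congrFun hβ p
    have h2 := congrFun hβ' p
    rw [matT'_mulVec] at h1
    rw [one_sub_matMTrunc_mulVec] at h2
    simp only [Pi.sub_apply, mul_sub, add_mul, neg_mul, Finset.sum_sub_distrib, Finset.sum_add_distrib,
      Finset.sum_neg_distrib] at h1 h2 ⊢
    linarith
  have hgV : ∀ p : Idx N L, |-∑ r, (lowerMat Φ Ω N x ν L p r + matMTrunc Φ Ω N x ν T L p r) * β' r| ≤
      ε * F * (1 + b) ^ (p.1 : ℕ) := by
    intro p
    rw [abs_neg]
    refine (abs_sum_lower_le (G := fun p r => lowerMat Φ Ω N x ν L p r + matMTrunc Φ Ω N x ν T L p r)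
      (W := fun a => F * (1 + b) ^ a) (b := ε * b) p (fun r _ n => hβ'_le ⟨r, n⟩) (fun r hr => ?_)
      (fun r hr n => ?_) (fun r => by positivity)).trans ?_
    · simp only [lowerMat, matMTrunc, Matrix.of_apply, hr, if_true, ← sub_eq_add_neg]
      rw [hb]
      exact sum_abs_matX_sub_matXTrunc_le hΦ hX hd hΩo hΩ hν hT hTexp _ (by omega) _
    · simp only [lowerMat, matMTrunc, Matrix.of_apply, hr, if_false, add_zero]
    · rw [mul_assoc, mul_sum_range_pow, mul_assoc]
      gcongr
      linarith
  have := abs_le_of_lower_triangular (u := β - β') (W := fun a => ε * F * (a + 1) * (1 + b) ^ a)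
    (V := fun a => ε * F * (1 + b) ^ a) (b := b) key hgV hG hG0
    (fun r => by positivity) (fun a => ?_) p
  · exact this
  -- Bounding `r + 1` by `a` leaves a geometric sum, which contributes `a`. The source contributes
  -- the missing `1`.
  · have h1 : ∑ r ∈ Finset.range a, ε * F * ((r : ℝ) + 1) * (1 + b) ^ r ≤
        ∑ r ∈ Finset.range a, (ε * F * a) * (1 + b) ^ r := by
      refine Finset.sum_le_sum fun r hr => ?_
      have : (r : ℝ) + 1 ≤ a := by exact_mod_cast Finset.mem_range.1 hr
      gcongr
    have h2 := mul_le_mul_of_nonneg_left h1 hb0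
    rw [mul_sum_range_pow] at h2
    have h3 : 0 ≤ ε * F * a := by positivity
    have h4 : ε * F * (a + 1) * (1 + b) ^ a = ε * F * (1 + b) ^ a + ε * F * a * (1 + b) ^ a := by ring
    rw [h4]
    linarith

end Stability

/-! ### Coefficients -/

section Coefficients

variable {d : ℕ} {Φ : E d → ℝ} {τ cΦ CΦ : ℝ} {Ω : Set (E d)} {N : ℕ → ℕ}
  {x : ∀ ℓ, Fin (N ℓ) → E d} {μ ch cq ν : ℝ}

lemma matD_mulVec (L : ℕ) (c : Idx N L → ℝ) (a : Fin L) (i : Fin (N (a + 1))) :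
    (matD Φ Ω N x ν L *ᵥ c) ⟨a, i⟩ = (matA Φ Ω N x ν (a + 1) *ᵥ fun n => c ⟨a, n⟩) i := by
  rw [Matrix.mulVec, dotProduct, Fintype.sum_sigma, Finset.sum_eq_single a]
  · simp only [matD, Matrix.blockDiagonal'_apply_eq]
    rfl
  · intro r _ hr
    refine Finset.sum_eq_zero fun n _ => ?_
    rw [matD, Matrix.blockDiagonal'_apply_ne _ _ _ hr.symm, zero_mul]
  · simp

/-- Coercivity gives `‖c‖² ≤ k ⟨c, g⟩`. Then Cauchy–Schwarz applies, and one factor `‖c‖²` is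
cancelled after squaring. -/
lemma sum_sq_le_of_coercive {ι : Type*} [Fintype ι] {A : Matrix ι ι ℝ} {k : ℝ} (hk : 0 < k)
    (hA : ∀ v : ι → ℝ, k⁻¹ * ∑ i, v i ^ 2 ≤ v ⬝ᵥ A *ᵥ v) {c g : ι → ℝ} (h : A *ᵥ c = g) :
    ∑ i, c i ^ 2 ≤ k ^ 2 * ∑ i, g i ^ 2 := by
  have h1 := hA c
  rw [h, dotProduct, inv_mul_le_iff₀ hk] at h1
  have h2 := Finset.sum_mul_sq_le_sq_mul_sq Finset.univ c g
  have h3 : 0 ≤ ∑ i, c i ^ 2 := Finset.sum_nonneg fun i _ => sq_nonneg _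
  rcases h3.eq_or_lt with h0 | h0
  · rw [← h0]
    exact mul_nonneg (sq_nonneg _) (Finset.sum_nonneg fun i _ => sq_nonneg _)
  · have h4 : (∑ i, c i ^ 2) ^ 2 ≤ k ^ 2 * (∑ i, c i * g i) ^ 2 := by
      rw [← mul_pow]
      exact pow_le_pow_left₀ h3 h1 2
    have h5 : (∑ i, c i ^ 2) * (∑ i, c i ^ 2) ≤ (∑ i, c i ^ 2) * (k ^ 2 * ∑ i, g i ^ 2) := by
      nlinarith [mul_le_mul_of_nonneg_left h2 (sq_nonneg k)]
    exact le_of_mul_le_mul_left h5 h0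

/-- The coefficients on one level in terms of the right-hand side. -/
lemma sum_sq_coeff_le (hΦ : IsKernel Φ τ cΦ CΦ) (hX : IsNodeSequence Ω N x μ ch cq)
    (hd : 1 ≤ d) (hΩo : IsOpen Ω) (hΩ : Bornology.IsBounded Ω) (hν : 0 < ν) {L : ℕ}
    {c γ : Idx N L → ℝ} (hc : matD Φ Ω N x ν L *ᵥ c = γ) (a : Fin L) {G : ℝ}
    (hG : ∀ n, |γ ⟨a, n⟩| ≤ G) :
    ∑ n, c ⟨a, n⟩ ^ 2 ≤
      (constK d τ cΦ cq ν * sepDist (x (a + 1)) ^ d) ^ 2 * (N (a + 1) * G ^ 2) := by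
  have hℓ : 1 ≤ (a : ℕ) + 1 := by omega
  have hK := hΦ.constK_pos cq ν
  have hq := hX.sepDist_pos hd hΩo hΩ hℓ
  have hh := hX.fillDist_pos hd hΩo hΩ hℓ
  have h2 : ν * fillDist Ω (x (a + 1)) ≤ ν * cq * sepDist (x (a + 1)) := by
    rw [mul_assoc]
    have := hX.fill_le_sep _ hℓ
    gcongr
  have h3 : matA Φ Ω N x ν (a + 1) *ᵥ (fun n => c ⟨a, n⟩) = fun n => γ ⟨a, n⟩ := by
    ext i
    rw [← matD_mulVec, hc]
  refine (sum_sq_le_of_coercive (by positivity)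
    (hΦ.kernelMatrix_lower hd hq (by positivity) h2 (two_mul_sepDist_le _)) h3).trans ?_
  gcongr
  calc ∑ n, γ ⟨a, n⟩ ^ 2 ≤ ∑ _n : Fin (N (a + 1)), G ^ 2 := by
        refine Finset.sum_le_sum fun n _ => ?_
        rw [← sq_abs]
        exact pow_le_pow_left₀ (abs_nonneg _) (hG n) 2
    _ = N (a + 1) * G ^ 2 := by simp

end Coefficients

/-! ### `L²` estimates -/

section L2

variable {d : ℕ} {Φ : E d → ℝ} {τ cΦ CΦ : ℝ}

lemma IsKernel.continuous_scaledKernel (hΦ : IsKernel Φ τ cΦ CΦ) (δ : ℝ) (p : E d) :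
    Continuous fun y => scaledKernel Φ δ (y - p) := by
  unfold scaledKernel
  exact continuous_const.mul (hΦ.cont.comp (by fun_prop))

lemma IsKernel.lintegral_scaledKernel_sq_le (hΦ : IsKernel Φ τ cΦ CΦ) (hd : 1 ≤ d) {δ : ℝ} (hδ : 0 < δ)
    (p : E d) :
    ∫⁻ y, ENNReal.ofReal (scaledKernel Φ δ (y - p) ^ 2) ≤ ENNReal.ofReal ((δ ^ d)⁻¹ * ballVol d) := by
  calc ∫⁻ y, ENNReal.ofReal (scaledKernel Φ δ (y - p) ^ 2)
      ≤ ∫⁻ y, (Metric.closedBall p δ).indicator (fun _ => ENNReal.ofReal (((δ ^ d)⁻¹) ^ 2)) y := by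
        refine lintegral_mono fun y => ?_
        by_cases hy : y ∈ Metric.closedBall p δ
        · rw [Set.indicator_of_mem hy]
          refine ENNReal.ofReal_le_ofReal ?_
          rw [← sq_abs]
          exact pow_le_pow_left₀ (abs_nonneg _) (hΦ.abs_scaledKernel_le hδ _) 2
        · rw [Set.indicator_of_notMem hy, hΦ.scaledKernel_eq_zero hδ]
          · simp
          · rw [Metric.mem_closedBall, dist_eq_norm, not_le] at hy
            exact hy.le
    _ = ENNReal.ofReal ((δ ^ d)⁻¹ * ballVol d) := by
        have hv := ballVol_pos d
        rw [lintegral_indicator measurableSet_closedBall, setLIntegral_const, volume_closedBall_eq hd,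
          ← ENNReal.ofReal_pow hδ.le, ← ENNReal.ofReal_mul (by positivity),
          ← ENNReal.ofReal_mul (by positivity)]
        congr 1
        field_simp

variable {ι : Type*} [Fintype ι]

/-- Bounded overlap: by packing, at most `(1 + δ/q)^d` kernels are nonzero at `y`, so Cauchy–Schwarz
costs only that factor. -/
lemma IsKernel.sq_sum_scaledKernel_le (hΦ : IsKernel Φ τ cΦ CΦ) (hd : 1 ≤ d) {p : ι → E d} {q δ : ℝ}
    (hq : 0 < q) (hδ : 0 < δ) (hsep : ∀ i j, i ≠ j → 2 * q ≤ ‖p i - p j‖) (c : ι → ℝ) (y : E d) :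
    (∑ n, c n * scaledKernel Φ δ (y - p n)) ^ 2 ≤
      (1 + δ / q) ^ d * ∑ n, c n ^ 2 * scaledKernel Φ δ (y - p n) ^ 2 := by
  classical
  set s := Finset.univ.filter fun n => ‖y - p n‖ ≤ δ with hs
  have h1 : ∑ n, c n * scaledKernel Φ δ (y - p n) = ∑ n ∈ s, c n * scaledKernel Φ δ (y - p n) := by
    symm
    refine Finset.sum_filter_of_ne fun m _ hm => ?_
    by_contra! h
    exact hm (by rw [hΦ.scaledKernel_eq_zero hδ h.le, mul_zero])
  have hcard := card_mul_pow_le hd hq hsep s y hδ.le fun m hm => (Finset.mem_filter.1 hm).2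
  rw [h1]
  refine (sq_sum_le_card_mul_sum_sq).trans ?_
  have h2 : ∑ n ∈ s, (c n * scaledKernel Φ δ (y - p n)) ^ 2 ≤
      ∑ n, c n ^ 2 * scaledKernel Φ δ (y - p n) ^ 2 := by
    simp_rw [mul_pow]
    exact Finset.sum_le_univ_sum_of_nonneg fun n => by positivity
  exact mul_le_mul hcard h2 (Finset.sum_nonneg fun n _ => sq_nonneg _) (by positivity)

end L2

section Approximant

variable {d : ℕ} {Φ : E d → ℝ} {τ cΦ CΦ : ℝ} {Ω : Set (E d)} {N : ℕ → ℕ}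
  {x : ∀ ℓ, Fin (N ℓ) → E d} {μ ch cq ν : ℝ}

lemma approximant_sub (L : ℕ) (α α' : Idx N L → ℝ) (y : E d) :
    approximant Φ Ω N x ν L α y - approximant Φ Ω N x ν L α' y =
      approximant Φ Ω N x ν L (α - α') y := by
  simp only [approximant, Pi.sub_apply, sub_mul, Finset.sum_sub_distrib]

/-- The factor `L` comes from Cauchy–Schwarz over the levels, and `(1 + ν c_q)^d` from the overlap
within one level. -/
lemma lintegral_approximant_sq_le (hΦ : IsKernel Φ τ cΦ CΦ) (hX : IsNodeSequence Ω N x μ ch cq)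
    (hd : 1 ≤ d) (hΩo : IsOpen Ω) (hΩ : Bornology.IsBounded Ω) (hν : 0 < ν) (L : ℕ) (c : Idx N L → ℝ) :
    ∫⁻ y, ENNReal.ofReal (approximant Φ Ω N x ν L c y ^ 2) ≤
      ENNReal.ofReal (L * ∑ a : Fin L, (1 + ν * cq) ^ d *
        ((((ν * fillDist Ω (x (a + 1))) ^ d)⁻¹ * ballVol d) * ∑ n, c ⟨a, n⟩ ^ 2)) := by
  have hv := ballVol_pos d
  have hcq : 0 < cq := by linarith [hX.one_le_cq hd hΩo hΩ]
  have hδ : ∀ a : Fin L, 0 < ν * fillDist Ω (x (a + 1)) := fun a =>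
    mul_pos hν (hX.fillDist_pos hd hΩo hΩ (by omega))
  have hpt : ∀ y, approximant Φ Ω N x ν L c y ^ 2 ≤ ∑ a : Fin L, ∑ n,
      (L * (1 + ν * cq) ^ d * c ⟨a, n⟩ ^ 2) * basisFun Φ Ω N x ν (a + 1) n y ^ 2 := by
    intro y
    rw [approximant]
    refine sq_sum_le_card_mul_sum_sq.trans ?_
    rw [Finset.card_univ, Fintype.card_fin, Finset.mul_sum]
    refine Finset.sum_le_sum fun a _ => ?_
    have hq := hX.sepDist_pos hd hΩo hΩ (by omega : 1 ≤ (a : ℕ) + 1)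
    have h1 := hΦ.sq_sum_scaledKernel_le hd hq (hδ a) (two_mul_sepDist_le (x (a + 1)))
      (fun n => c ⟨a, n⟩) y
    have h2 : ν * fillDist Ω (x (a + 1)) / sepDist (x (a + 1)) ≤ ν * cq := by
      rw [div_le_iff₀ hq, mul_assoc]
      have := hX.fill_le_sep (a + 1) (by omega)
      gcongr
    have h3 : (1 + ν * fillDist Ω (x (a + 1)) / sepDist (x (a + 1))) ^ d ≤ (1 + ν * cq) ^ d := by
      have := hδ a
      gcongr
    calc L * (∑ n, c ⟨a, n⟩ * basisFun Φ Ω N x ν (a + 1) n y) ^ 2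
        ≤ L * ((1 + ν * cq) ^ d * ∑ n, c ⟨a, n⟩ ^ 2 * basisFun Φ Ω N x ν (a + 1) n y ^ 2) := by
          refine mul_le_mul_of_nonneg_left (h1.trans ?_) (by positivity)
          exact mul_le_mul_of_nonneg_right h3 (Finset.sum_nonneg fun n _ => by positivity)
      _ = _ := by
          rw [Finset.mul_sum, Finset.mul_sum]
          refine Finset.sum_congr rfl fun n _ => ?_
          ring
  have hmeas : ∀ (a : Fin L) n, Measurable fun y =>
      ENNReal.ofReal ((L * (1 + ν * cq) ^ d * c ⟨a, n⟩ ^ 2) * basisFun Φ Ω N x ν (a + 1) n y ^ 2) :=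
    fun a n => ENNReal.measurable_ofReal.comp
      ((((hΦ.continuous_scaledKernel _ _).pow 2).const_mul _).measurable)
  calc ∫⁻ y, ENNReal.ofReal (approximant Φ Ω N x ν L c y ^ 2)
      ≤ ∫⁻ y, ∑ a : Fin L, ∑ n, ENNReal.ofReal
          ((L * (1 + ν * cq) ^ d * c ⟨a, n⟩ ^ 2) * basisFun Φ Ω N x ν (a + 1) n y ^ 2) := by
        refine lintegral_mono fun y => (ENNReal.ofReal_le_ofReal (hpt y)).trans_eq ?_
        rw [ENNReal.ofReal_sum_of_nonneg fun a _ => Finset.sum_nonneg fun n _ => by positivity]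
        refine Finset.sum_congr rfl fun a _ => ?_
        rw [ENNReal.ofReal_sum_of_nonneg fun n _ => by positivity]
    _ = ∑ a : Fin L, ∑ n, ∫⁻ y, ENNReal.ofReal
          ((L * (1 + ν * cq) ^ d * c ⟨a, n⟩ ^ 2) * basisFun Φ Ω N x ν (a + 1) n y ^ 2) := by
        rw [lintegral_finsetSum _ fun a _ => Finset.measurable_sum _ fun n _ => hmeas a n]
        refine Finset.sum_congr rfl fun a _ => ?_
        rw [lintegral_finsetSum _ fun n _ => hmeas a n]
    _ ≤ ∑ a : Fin L, ∑ n, ENNReal.ofReal ((L * (1 + ν * cq) ^ d * c ⟨a, n⟩ ^ 2) *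
          (((ν * fillDist Ω (x (a + 1))) ^ d)⁻¹ * ballVol d)) := by
        refine Finset.sum_le_sum fun a _ => Finset.sum_le_sum fun n _ => ?_
        rw [ENNReal.ofReal_mul (p := L * (1 + ν * cq) ^ d * c ⟨a, n⟩ ^ 2) (by positivity)]
        simp_rw [ENNReal.ofReal_mul (p := L * (1 + ν * cq) ^ d * c ⟨a, n⟩ ^ 2) (by positivity)]
        rw [lintegral_const_mul' _ _ ENNReal.ofReal_ne_top]
        gcongr
        exact hΦ.lintegral_scaledKernel_sq_le hd (hδ a) _
    _ = _ := by
        have hδ' := hδ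
        rw [Finset.mul_sum, ENNReal.ofReal_sum_of_nonneg fun a _ => ?_]
        · refine Finset.sum_congr rfl fun a _ => ?_
          have := hδ a
          rw [← ENNReal.ofReal_sum_of_nonneg fun n _ => by positivity]
          congr 1
          rw [Finset.mul_sum, Finset.mul_sum, Finset.mul_sum]
          refine Finset.sum_congr rfl fun n _ => ?_
          ring
        · have := hδ a
          have : 0 ≤ ∑ n, c ⟨a, n⟩ ^ 2 := Finset.sum_nonneg fun n _ => sq_nonneg _
          positivity

end Approximant

/-! ### Numerical consequences of the assumptions on `L` and `T` -/

/-- With `X = s^(-dL²)`, the assumption on `L` raised to the power `2L` bounds powers of `L` and `b`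
by `X`, and the assumption on `T` says `X² ≤ e^(θT/2)`. The left-hand side is bounded by `X²`. -/
lemma polynomial_le_exp {d L : ℕ} (hL1 : 1 ≤ L) {b cq s θ T : ℝ} (hcq : 1 ≤ cq)
    (hb : (2 * cq) ^ d ≤ b) (hs : 0 < s) (hθ : 0 < θ)
    (hL : 2 * b * L * Real.exp (θ / L) * cq ^ ((d : ℝ) / (2 * L) - (d : ℝ) / 2) ≤
      s ^ (-((d : ℝ) * L / 2)))
    (hT : -4 * d * (L : ℝ) ^ 2 / θ * Real.log s ≤ T) :
    (L : ℝ) ^ 3 * (2 * cq) ^ d * (1 + b) ^ (2 * (L - 1)) ≤ Real.exp (θ / 2 * T) := by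
  have hL0 : (1 : ℝ) ≤ L := by exact_mod_cast hL1
  have hb1 : 1 ≤ b := le_trans (one_le_pow₀ (by linarith)) hb
  obtain ⟨M, rfl⟩ : ∃ M, L = M + 1 := ⟨L - 1, by omega⟩
  set L' : ℝ := ((M + 1 : ℕ) : ℝ) with hL'
  have hcq0 : 0 < cq := by linarith
  have h1 : (2 * b * L') ^ (2 * (M + 1)) * ((cq ^ d) ^ M)⁻¹ ≤ Real.exp (-(d * L' ^ 2 * Real.log s)) := by
    have h2 := pow_le_pow_left₀ (by positivity) hL (2 * (M + 1))
    have e1 : (s ^ (-((d : ℝ) * L' / 2))) ^ (2 * (M + 1)) = Real.exp (-(d * L' ^ 2 * Real.log s)) := by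
      rw [Real.rpow_def_of_pos hs, ← Real.exp_nat_mul]
      congr 1
      push_cast
      rw [hL']
      push_cast
      ring
    have e2 : (cq ^ ((d : ℝ) / (2 * L') - (d : ℝ) / 2)) ^ (2 * (M + 1)) = ((cq ^ d) ^ M)⁻¹ := by
      rw [← Real.rpow_natCast, ← Real.rpow_mul hcq0.le, ← pow_mul, ← Real.rpow_natCast cq,
        ← Real.rpow_neg hcq0.le]
      congr 1
      rw [hL']
      push_cast
      field_simp
      ring
    rw [mul_pow, e2, e1, mul_pow _ (Real.exp _)] at h2
    refine le_trans ?_ h2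
    have h3 : 1 ≤ Real.exp (θ / L') ^ (2 * (M + 1)) := one_le_pow₀ (Real.one_le_exp (by positivity))
    gcongr
    exact le_mul_of_one_le_right (by positivity) h3
  -- The power of `c_q` has exponent `-d(L-1)`, and `c_q^d ≤ b` trades it for `L - 1 = M` of the
  -- `2L` factors `b`.
  have h4 : (2 * L') ^ (2 * M + 2) * b ^ (M + 2) ≤ Real.exp (-(d * L' ^ 2 * Real.log s)) := by
    refine le_trans ?_ h1
    rw [← div_eq_mul_inv, le_div_iff₀ (by positivity)]
    have h5 : (cq ^ d) ^ M ≤ b ^ M := by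
      refine pow_le_pow_left₀ (by positivity) (le_trans ?_ hb) M
      gcongr
      linarith
    calc (2 * L') ^ (2 * M + 2) * b ^ (M + 2) * (cq ^ d) ^ M
        ≤ (2 * L') ^ (2 * M + 2) * b ^ (M + 2) * b ^ M := by gcongr
      _ = (2 * b * L') ^ (2 * (M + 1)) := by
          rw [show 2 * b * L' = (2 * L') * b by ring, mul_pow]
          ring
  have h6 : Real.exp (-(d * L' ^ 2 * Real.log s)) ^ 2 ≤ Real.exp (θ / 2 * T) := by
    rw [← Real.exp_nat_mul]
    refine Real.exp_le_exp.2 ?_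
    have h7 := mul_le_mul_of_nonneg_left hT (by positivity : 0 ≤ θ / 2)
    have h8 : θ / 2 * (-4 * d * L' ^ 2 / θ * Real.log s) = 2 * -(d * L' ^ 2 * Real.log s) := by
      field_simp
      ring
    rw [h8] at h7
    exact_mod_cast h7
  refine le_trans ?_ (le_trans (pow_le_pow_left₀ (by positivity) h4 2) h6)
  have h9 : (1 + b) ^ (2 * (M + 1 - 1)) ≤ (2 * b) ^ (2 * M) := by
    rw [Nat.add_sub_cancel]
    gcongr
    linarith
  have h10 : L' ^ 3 ≤ (2 * L') ^ 4 := by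
    have : L' ^ 3 ≤ L' ^ 4 := pow_le_pow_right₀ hL0 (by norm_num)
    have : 0 ≤ L' ^ 4 := by positivity
    have : (2 * L') ^ 4 = 16 * L' ^ 4 := by ring
    linarith
  have h11 : (2 : ℝ) ^ (2 * M) ≤ (2 * L') ^ (4 * M) := by
    calc (2 : ℝ) ^ (2 * M) ≤ 2 ^ (4 * M) := pow_le_pow_right₀ (by norm_num) (by omega)
      _ ≤ (2 * L') ^ (4 * M) := by gcongr; linarith
  have h12 : b ^ (2 * M + 1) ≤ b ^ (2 * M + 4) := pow_le_pow_right₀ hb1 (by omega)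
  calc L' ^ 3 * (2 * cq) ^ d * (1 + b) ^ (2 * (M + 1 - 1))
      ≤ L' ^ 3 * b * (2 * b) ^ (2 * M) := by gcongr
    _ = L' ^ 3 * 2 ^ (2 * M) * b ^ (2 * M + 1) := by rw [mul_pow]; ring
    _ ≤ (2 * L') ^ 4 * (2 * L') ^ (4 * M) * b ^ (2 * M + 4) := by gcongr
    _ = _ := by ring

/-- Here `μ^(-d) > 2` enters: it gives `-d log (c_h μ) ≥ log 2`, and with `θ ≤ 1/4` the threshold is
at least `16 log 2`. -/
lemma two_le_of_threshold {d L : ℕ} (hL1 : 1 ≤ L) {μ ch θ T : ℝ} (hμ : 0 < μ)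
    (hch : 0 < ch) (hch1 : ch ≤ 1) (h2 : 2 < (μ ^ d)⁻¹) (hθ : 0 < θ) (hθ1 : θ ≤ 1 / 4)
    (hT : -4 * d * (L : ℝ) ^ 2 / θ * Real.log (ch * μ) ≤ T) : 2 ≤ T := by
  have hL0 : (1 : ℝ) ≤ L := by exact_mod_cast hL1
  have h3 : Real.log 2 ≤ -(d * Real.log (ch * μ)) := by
    rw [Real.log_mul hch.ne' hμ.ne']
    have h4 := Real.log_le_log (by norm_num) h2.le
    rw [Real.log_inv, Real.log_pow] at h4
    have h5 : Real.log ch ≤ 0 := Real.log_nonpos hch.le hch1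
    have h6 : 0 ≤ (d : ℝ) := by positivity
    nlinarith
  have h7 := Real.log_two_gt_d9
  refine le_trans ?_ hT
  have h8 : -4 * d * (L : ℝ) ^ 2 / θ * Real.log (ch * μ) =
      4 * L ^ 2 * (-(d * Real.log (ch * μ))) / θ := by ring
  rw [h8, le_div_iff₀ hθ]
  have h9 : (1 : ℝ) ≤ L ^ 2 := one_le_pow₀ hL0
  nlinarith

/-! ### The essential supremum of `f`, the constant `c_f` and the `L²` norm. -/

lemma abs_le_toReal_eLpNorm_top {d : ℕ} {Ω : Set (E d)} (hΩo : IsOpen Ω) {f : E d → ℝ}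
    (hf : ContinuousOn f Ω) (htop : eLpNorm f ∞ (volume.restrict Ω) ≠ ⊤) {y : E d} (hy : y ∈ Ω) :
    |f y| ≤ (eLpNorm f ∞ (volume.restrict Ω)).toReal := by
  set F := (eLpNorm f ∞ (volume.restrict Ω)).toReal
  -- The inequality `|f| ≤ F` is written as an equation of continuous functions, since such an
  -- equation passes from almost everywhere to everywhere on an open set.
  have h1 : (fun y => max |f y| F) =ᵐ[volume.restrict Ω] fun _ => F := by
    filter_upwards [ae_le_eLpNormEssSup (f := f) (μ := volume.restrict Ω)] with y hy
    refine max_eq_right ?_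
    rw [← eLpNorm_exponent_top] at hy
    rw [← Real.norm_eq_abs, ← toReal_enorm]
    exact ENNReal.toReal_mono htop hy
  have h2 := Measure.eqOn_open_of_ae_eq h1 hΩo (hf.abs.sup continuousOn_const) continuousOn_const hy
  exact max_eq_right_iff.1 h2

/-- `c_f²` in terms of `K` and the volume of the unit ball. -/
lemma constCfSq_eq {d : ℕ} {τ cΦ cq ν : ℝ} (N1 : ℕ) (q1 : ℝ) :
    constCfSq d τ cΦ cq ν N1 q1 =
      N1 * (1 + 2 * ν * cq) ^ d * ballVol d * q1 ^ d * constK d τ cΦ cq ν ^ 2 * (ν ^ d)⁻¹ := by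
  have e1 : Real.pi ^ ((d : ℝ) / 2) = √Real.pi ^ d := by
    rw [Real.sqrt_eq_rpow, ← Real.rpow_natCast, ← Real.rpow_mul Real.pi_pos.le]
    congr 1; ring
  have e2 : (1 + 4 * constMd d ^ 2 * ν ^ 2 * cq ^ 2) ^ (2 * τ) =
      ((1 + 4 * constMd d ^ 2 * ν ^ 2 * cq ^ 2) ^ τ) ^ 2 := by
    rw [show 2 * τ = τ * (2 : ℕ) by push_cast; ring, Real.rpow_mul (by positivity),
      Real.rpow_natCast]
  rw [constCfSq, e1, e2, ballVol, constK]
  simp only [div_eq_mul_inv, mul_inv, mul_pow, inv_pow]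
  ring

lemma eLpNorm_two_le_of_lintegral_sq_le {α : Type*} [MeasurableSpace α] {μ : Measure α} {g : α → ℝ}
    {c : ℝ} (hc : 0 ≤ c) (h : ∫⁻ y, ENNReal.ofReal (g y ^ 2) ∂μ ≤ ENNReal.ofReal (c ^ 2)) :
    eLpNorm g 2 μ ≤ ENNReal.ofReal c := by
  rw [eLpNorm_eq_lintegral_rpow_enorm_toReal (by norm_num) (by norm_num)]
  have h1 : ∀ y, ‖g y‖ₑ ^ (2 : ℝ≥0∞).toReal = ENNReal.ofReal (g y ^ 2) := fun y => by
    rw [ENNReal.toReal_ofNat, ENNReal.rpow_ofNat, ← ofReal_norm,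
      ← ENNReal.ofReal_pow (norm_nonneg _), Real.norm_eq_abs, sq_abs]
  simp_rw [h1]
  refine (ENNReal.rpow_le_rpow h (by positivity)).trans_eq ?_
  rw [ENNReal.toReal_ofNat, ENNReal.ofReal_rpow_of_nonneg (by positivity) (by positivity),
    ← Real.sqrt_eq_rpow, Real.sqrt_sq hc]

section Main

variable {d : ℕ} {Φ : E d → ℝ} {τ cΦ CΦ : ℝ} {Ω : Set (E d)} {N : ℕ → ℕ}
  {x : ∀ ℓ, Fin (N ℓ) → E d} {μ ch cq ν : ℝ}

/-- A coefficient vector whose image under `D_L` is bounded by `G` gives an approximant that is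
small in `L²`. -/
lemma lintegral_approximant_sq_le_of_abs_le (hΦ : IsKernel Φ τ cΦ CΦ)
    (hX : IsNodeSequence Ω N x μ ch cq) (hd : 1 ≤ d) (hΩo : IsOpen Ω) (hΩ : Bornology.IsBounded Ω)
    (hν : 0 < ν) {L : ℕ} {c γ : Idx N L → ℝ} (hc : matD Φ Ω N x ν L *ᵥ c = γ) {G : ℝ}
    (hG : ∀ p, |γ p| ≤ G) :
    ∫⁻ y, ENNReal.ofReal (approximant Φ Ω N x ν L c y ^ 2) ≤
      ENNReal.ofReal (constCfSq d τ cΦ cq ν (N 1) (sepDist (x 1)) *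
        ((L : ℝ) ^ 2 * (2 * cq) ^ d * G ^ 2)) := by
  have hv := ballVol_pos d
  have hK := hΦ.constK_pos cq ν
  have hcq : 0 < cq := by linarith [hX.one_le_cq hd hΩo hΩ]
  have hq1 := hX.sepDist_pos hd hΩo hΩ le_rfl
  refine (lintegral_approximant_sq_le hΦ hX hd hΩo hΩ hν L c).trans (ENNReal.ofReal_le_ofReal ?_)
  set B := (1 + 2 * ν * cq) ^ d * ((ν ^ d)⁻¹ * ballVol d) * constK d τ cΦ cq ν ^ 2 *
    (N 1 * (2 * cq) ^ d * sepDist (x 1) ^ d) * G ^ 2 with hB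
  have key : ∀ a : Fin L, (1 + ν * cq) ^ d *
      ((((ν * fillDist Ω (x (a + 1))) ^ d)⁻¹ * ballVol d) * ∑ n, c ⟨a, n⟩ ^ 2) ≤ B := by
    intro a
    have hℓ : 1 ≤ (a : ℕ) + 1 := by omega
    have hq := hX.sepDist_pos hd hΩo hΩ hℓ
    have hh := hX.fillDist_pos hd hΩo hΩ hℓ
    have h1 := sum_sq_coeff_le hΦ hX hd hΩo hΩ hν hc a fun n => hG ⟨a, n⟩
    have h2 := hX.card_mul_sepDist_pow_le hd hΩo hΩ hℓ
    -- Of the factor `q_ℓ^(2d)` from coercivity, one half cancels `h_ℓ^(-d)` from the kernel norm.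
    -- The other half pairs with `N(ℓ)` in the volume count.
    have h3 : ((fillDist Ω (x (a + 1))) ^ d)⁻¹ * sepDist (x (a + 1)) ^ d ≤ 1 := by
      rw [inv_mul_le_iff₀ (by positivity), mul_one]
      exact pow_le_pow_left₀ hq.le (hX.sep_le_fill _ hℓ) d
    have h4 : (1 + ν * cq) ^ d ≤ (1 + 2 * ν * cq) ^ d := by
      refine pow_le_pow_left₀ (by positivity) ?_ d
      nlinarith [mul_pos hν hcq]
    calc (1 + ν * cq) ^ d *
          ((((ν * fillDist Ω (x (a + 1))) ^ d)⁻¹ * ballVol d) * ∑ n, c ⟨a, n⟩ ^ 2)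
        ≤ (1 + 2 * ν * cq) ^ d * ((((ν * fillDist Ω (x (a + 1))) ^ d)⁻¹ * ballVol d) *
          ((constK d τ cΦ cq ν * sepDist (x (a + 1)) ^ d) ^ 2 * (N (a + 1) * G ^ 2))) := by
          gcongr
      _ = (1 + 2 * ν * cq) ^ d * ((ν ^ d)⁻¹ * ballVol d) * constK d τ cΦ cq ν ^ 2 *
          ((((fillDist Ω (x (a + 1))) ^ d)⁻¹ * sepDist (x (a + 1)) ^ d) *
            (N (a + 1) * sepDist (x (a + 1)) ^ d)) * G ^ 2 := by
          rw [mul_pow ν, mul_inv]; ring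
      _ ≤ B := by
          rw [hB]
          refine mul_le_mul_of_nonneg_right (mul_le_mul_of_nonneg_left ?_ (by positivity))
            (sq_nonneg G)
          exact (mul_le_mul h3 h2 (by positivity) zero_le_one).trans_eq (one_mul _)
  calc (L : ℝ) * ∑ a : Fin L, (1 + ν * cq) ^ d *
        ((((ν * fillDist Ω (x (a + 1))) ^ d)⁻¹ * ballVol d) * ∑ n, c ⟨a, n⟩ ^ 2)
      ≤ L * ∑ _a : Fin L, B := by
        gcongr with a
        exact key a
    _ = _ := by
        rw [Finset.sum_const, Finset.card_univ, Fintype.card_fin, nsmul_eq_mul, constCfSq_eq, hB]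
        ring

end Main

end Multiscale

end

/-! ### The perturbation estimate. -/

theorem theorem4p9 (d : ℕ) (hd : 1 ≤ d)
    (Φ : Multiscale.E d → ℝ) (τ cΦ CΦ : ℝ) (hΦ : Multiscale.IsKernel Φ τ cΦ CΦ)
    (Ω : Set (Multiscale.E d)) (hΩo : IsOpen Ω) (hΩb : Bornology.IsBounded Ω)
    (N : ℕ → ℕ) (x : ∀ ℓ, Fin (N ℓ) → Multiscale.E d) (μ ch cq ν : ℝ)
    (hX : Multiscale.IsNodeSequence Ω N x μ ch cq) (hν : 0 < ν)
    (L : ℕ)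
    (hL : 2 * Multiscale.constC d τ cΦ cq ν * Multiscale.constCSigma d τ cΦ cq ν * L *
        Real.exp (Multiscale.constTheta d τ cΦ cq ν / L) *
        cq ^ ((d : ℝ) / (2 * L) - (d : ℝ) / 2) ≤ (ch * μ) ^ (-((d : ℝ) * L / 2)))
    (T : ℝ) (hT : 0 < T)
    (hTexp : T ^ d ≤ Real.exp (Multiscale.constTheta d τ cΦ cq ν / 2 * T))
    (hTL : -4 * d * (L : ℝ) ^ 2 / Multiscale.constTheta d τ cΦ cq ν * Real.log (ch * μ) ≤ T)
    (f : Multiscale.E d → ℝ) (hf : ContinuousOn f Ω)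
    (α β α' β' : Multiscale.Idx N L → ℝ)
    (hα : Multiscale.matD Φ Ω N x ν L *ᵥ α = β)
    (hβ : Multiscale.matT' Φ Ω N x ν L *ᵥ β = Multiscale.samples N x f L)
    (hα' : Multiscale.matD Φ Ω N x ν L *ᵥ α' = β')
    (hβ' : (1 - Multiscale.matMTrunc Φ Ω N x ν T L) *ᵥ β' = Multiscale.samples N x f L) :
    MeasureTheory.eLpNorm
        (fun y => Multiscale.approximant Φ Ω N x ν L α y - Multiscale.approximant Φ Ω N x ν L α' y)
        2 (MeasureTheory.volume.restrict Ω) ≤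
      ENNReal.ofReal
          (Real.sqrt (Multiscale.constCfSq d τ cΦ cq ν (N 1) (Multiscale.sepDist (x 1))) *
            Real.sqrt L * Real.exp (-(Multiscale.constTheta d τ cΦ cq ν / 4 * T))) *
        MeasureTheory.eLpNorm f ∞ (MeasureTheory.volume.restrict Ω) := by
  open Multiscale MeasureTheory in
  simp_rw [approximant_sub]
  rcases Nat.eq_zero_or_pos L with rfl | hL1
  · have h0 : (fun y => approximant Φ Ω N x ν 0 (α - α') y) = fun _ => 0 := by
      ext y
      simp [approximant]
    rw [h0]
    simp
  have hcq1 := hX.one_le_cq hd hΩo hΩb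
  have hcq : 0 < cq := by linarith
  have hq1 := hX.sepDist_pos hd hΩo hΩb le_rfl
  have hK := hΦ.constK_pos cq ν
  have hv := ballVol_pos d
  have hN1 : (0 : ℝ) < N 1 := by exact_mod_cast hX.nonempty 1 le_rfl
  have hL0 : (0 : ℝ) < L := by exact_mod_cast hL1
  have hθ := hΦ.constTheta_pos hd cq ν
  have hcf : 0 < constCfSq d τ cΦ cq ν (N 1) (sepDist (x 1)) := by
    rw [constCfSq_eq]
    positivity
  -- A continuous function on `Ω` may be unbounded. Then the right-hand side is `⊤`, because the
  -- constant in front is positive.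
  by_cases htop : eLpNorm f ∞ (volume.restrict Ω) = ⊤
  · rw [htop, ENNReal.mul_top]
    · exact le_top
    · rw [Ne, ENNReal.ofReal_eq_zero, not_le]
      positivity
  set F := (eLpNorm f ∞ (volume.restrict Ω)).toReal with hF
  have hF0 : 0 ≤ F := ENNReal.toReal_nonneg
  have hs : 0 < ch * μ := mul_pos hX.ch_pos hX.mu_pos
  have hsamp : ∀ p : Idx N L, |samples N x f L p| ≤ F := fun p =>
    abs_le_toReal_eLpNorm_top hΩo hf htop (hX.mem _ (by omega) _)
  have hT2 := two_le_of_threshold hL1 hX.mu_pos hX.ch_pos hX.ch_le_one hX.two_lt hθ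
    (hΦ.constTheta_le hd cq ν) hTL
  obtain ⟨b, hb⟩ : ∃ b, b = constC d τ cΦ cq ν * constCSigma d τ cΦ cq ν := ⟨_, rfl⟩
  have hb1 : (2 * cq) ^ d ≤ b := hb ▸ hΦ.two_mul_pow_le hd hcq.le hν
  have hb0 : 0 ≤ b := le_trans (by positivity) hb1
  set θ := constTheta d τ cΦ cq ν with hθdef
  have hpoly : (L : ℝ) ^ 3 * (2 * cq) ^ d * (1 + b) ^ (2 * (L - 1)) ≤ Real.exp (θ / 2 * T) :=
    polynomial_le_exp hL1 hcq1 hb1 hs hθ (by rw [hb, ← mul_assoc]; exact hL) hTL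
  set G := Real.exp (-(θ / 2 * T)) * F * L * (1 + b) ^ (L - 1) with hG
  have hdiff : ∀ p, |(β - β') p| ≤ G := by
    intro p
    refine (abs_sub_solution_le hΦ hX hd hΩo hΩb hν hT2 hTexp hb hsamp hF0 hβ hβ' p).trans ?_
    have h1 : ((p.1 : ℕ) : ℝ) + 1 ≤ L := by exact_mod_cast p.1.2
    have h2 : (1 + b) ^ (p.1 : ℕ) ≤ (1 + b) ^ (L - 1) :=
      pow_le_pow_right₀ (by linarith) (by have := p.1.2; omega)
    rw [hG]
    gcongr
  have hD : matD Φ Ω N x ν L *ᵥ (α - α') = β - β' := by rw [Matrix.mulVec_sub, hα, hα']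
  rw [← ENNReal.ofReal_toReal htop, ← ENNReal.ofReal_mul (by positivity)]
  refine eLpNorm_two_le_of_lintegral_sq_le (by positivity) ?_
  -- The `L²` estimate holds on all of `ℝ^d`, so restricting to `Ω` costs nothing.
  refine (setLIntegral_le_lintegral _ _).trans
    ((lintegral_approximant_sq_le_of_abs_le hΦ hX hd hΩo hΩb hν hD hdiff).trans
      (ENNReal.ofReal_le_ofReal ?_))
  have e0 : (√(constCfSq d τ cΦ cq ν (N 1) (sepDist (x 1))) * √L * Real.exp (-(θ / 4 * T)) * F) ^ 2 =
      constCfSq d τ cΦ cq ν (N 1) (sepDist (x 1)) * (L * Real.exp (-(θ / 4 * T)) ^ 2 * F ^ 2) := by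
    rw [mul_pow, mul_pow, mul_pow, Real.sq_sqrt hcf.le, Real.sq_sqrt hL0.le, mul_assoc, mul_assoc,
      mul_assoc]
  rw [← hF, e0]
  refine mul_le_mul_of_nonneg_left ?_ hcf.le
  -- The squared decay `e^(-θT)` of `β - β'` is split: `hpoly` consumes `e^(θT/2)`, and the claimed
  -- rate is left.
  have e1 : Real.exp (-(θ / 4 * T)) ^ 2 = Real.exp (-(θ / 2 * T)) ^ 2 * Real.exp (θ / 2 * T) := by
    rw [← Real.exp_nat_mul, ← Real.exp_nat_mul, ← Real.exp_add]
    congr 1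
    push_cast
    ring
  have e2 : ((1 + b) ^ (L - 1)) ^ 2 = (1 + b) ^ (2 * (L - 1)) := by rw [← pow_mul, mul_comm]
  calc (L : ℝ) ^ 2 * (2 * cq) ^ d * G ^ 2
      = L * (Real.exp (-(θ / 2 * T)) ^ 2 *
          (L ^ 3 * (2 * cq) ^ d * (1 + b) ^ (2 * (L - 1)))) * F ^ 2 := by
        rw [hG, ← e2]
        ring
    _ ≤ L * (Real.exp (-(θ / 2 * T)) ^ 2 * Real.exp (θ / 2 * T)) * F ^ 2 := by gcongr
    _ = _ := by
        rw [e1]
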